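/- Let $\mathfrak g$ be a finite-dimensional complex Lie algebra with basis $I_1,\dots,I_d$ and dual basis $I^1,\dots,I^d$ of $\mathfrak g^*$, and let $\mathfrak d=T^*\mathfrak g=\mathfrak g\ltimes\mathfrak g^*$. Put $\mathcal O=\mathbb C[[t]]\subset\mathcal K=\mathbb C((t))$, $\mathfrak g(\mathcal K)=\mathfrak g\otimes\mathcal K$, $\mathfrak g(\mathcal O)=\mathfrak g\otimes\mathcal O$, $\mathfrak g_{<0}=t^{-1}\mathfrak g[t^{-1}]$, so that $\mathfrak g(\mathcal K)=\mathfrak g(\mathcal O)\oplus\mathfrak g_{<0}$, and write $a_n=a\otimes t^n$. The double Yangian is the $\mathbb C[[\hbar]]$-Hopf algebra attached to the decomposition $\mathfrak g(\mathcal K)\times\mathfrak g(\mathcal K)=\operatorname{diag}(\mathfrak g(\mathcal K))\oplus(\mathfrak g(\mathcal O)\times\mathfrak g_{<0})$. As an algebra it is the ($\hbar$-adically completed) smash product $$DY_\hbar(\mathfrak d)=U(\mathfrak g(\mathcal K))[[\hbar]]\ltimes\bigl(U(\mathfrak g(\mathcal O))\otimes U(\mathfrak g_{<0})\bigr)^*[[\hbar]],$$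 where $(-)^*$ is the topological dual and the second factor is regarded as the algebra of functions on the formal group $\mathbf K=\exp(\mathfrak g(\mathcal O)\times\mathfrak g_{<0})\cong\exp(\operatorname{diag}\mathfrak g(\mathcal K))\backslash\exp(\mathfrak g(\mathcal K)\times\mathfrak g(\mathcal K))$, whose points are the $e^{\hbar y}$, and on which $U(\mathfrak g(\mathcal K))$ acts by right translation. For $\kappa\in\mathbf K$ and $g\in\exp(\operatorname{diag}\mathfrak g(\mathcal K))$ write $\kappa g=(\kappa\triangleright g)(\kappa\triangleleft g)$ with $\kappa\triangleright g\in\exp(\operatorname{diag}\mathfrak g(\mathcal K))$ and $\kappa\triangleleft g\in\mathbf K$. Elements of the completed $n$-th tensor power are described by their symbols, that is, $\hbar$-adic linear maps from $U((\mathfrak g(\mathcal O)\times\mathfrak g_{<0})^n)$ (generated by the $\hbar y$) to $U(\mathfrak g(\mathcal K)^n)$, equivalently "functions on $\mathbf K^n$ with values in $U(\mathfrak g(\mathcal K)^n)$", with the smash product. The coproduct $\Delta$ is the multiplicative map with $(\Delta F)(\kappa_1,\kappa_2)=F(\kappa_1\kappa_2)$ for functions $F$ and $(\Delta x)(\kappa_1,\kappa_2)=(\kappa_2\triangleright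 x)\otimes1+1\otimes x$ for $x\in\mathfrak g(\mathcal K)$; $\Delta^{\rm op}$ is its flip. For $n\ge0$, $I^\alpha_{-n-1}$ and $I^\alpha_n$ denote the functions $e^{\hbar y}\mapsto\lambda(y)$, where $\lambda(y)$ is the coefficient of $I_{\alpha,n}$ in the $\mathfrak g(\mathcal O)$-component of $y$, respectively the coefficient of $I_{\alpha,-n-1}$ in the $\mathfrak g_{<0}$-component of $y$ (residue pairing). Put $$\gamma_<=\sum_{n\ge0}\sum_{\alpha=1}^d I_{\alpha,n}\otimes I^\alpha_{-n-1},\qquad \gamma_<^{21}=\sum_{n\ge0}\sum_{\alpha=1}^d I^\alpha_n\otimes I_{\alpha,-n-1},$$ that is, $\hbar\gamma_<$ and $\hbar\gamma_<^{21}$ are the symbols $(e^{\hbar y_1},e^{\hbar y_2})\mapsto \hbar(y_2)_{\ge0}\otimes1$ and $(e^{\hbar y_1},e^{\hbar y_2})\mapsto 1\otimes\hbar(y_1)_{<0}$ (where $(y)_{\ge 0}$ and $(y)_{<0}$ are the two components of $y\in\mathfrak g(\mathcal O)\times\mathfrak g_{<0}$). Then $\Delta(x)=\exp(\hbar\gamma_<)(x\otimes1+1\otimes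 x)\exp(-\hbar\gamma_<)$ for $x\in\mathfrak g(\mathcal K)$, and the element $$R=\exp(\hbar\gamma_<^{21})\exp(-\hbar\gamma_<)$$ is invertible, lies in $Y_\hbar(\mathfrak d)\,\widehat\otimes\,Y_\hbar^*(\mathfrak d)$, where $Y_\hbar(\mathfrak d)=U(\mathfrak g(\mathcal O))[[\hbar]]\ltimes U(\mathfrak g_{<0})^*[[\hbar]]$ and $Y^*_\hbar(\mathfrak d)=U(\mathfrak g_{<0})[[\hbar]]\ltimes U(\mathfrak g(\mathcal O))^*[[\hbar]]$, and satisfies: 1. $R\,\Delta(x)\,R^{-1}=\Delta^{\rm op}(x)$ for all $x\in DY_\hbar(\mathfrak d)$; 2. $(\Delta\otimes1)R=R^{13}R^{23}$ and $(1\otimes\Delta)R=R^{13}R^{12}$; 3. $R^{12}R^{13}R^{23}=R^{23}R^{13}R^{12}$. -/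

import Mathlib

open TensorProduct

noncomputable section

namespace DoubleYangian

attribute [local instance] LieRing.ofAssociativeRing

section Enveloping

variable {k : Type*} [CommRing k]

/-- The universal enveloping algebra of a Lie algebra over `k`. -/
abbrev U (k : Type*) [CommRing k] (L : Type*) [LieRing L] [LieAlgebra k L] : Type _ :=
  UniversalEnvelopingAlgebra k L

variable {L : Type*} [LieRing L] [LieAlgebra k L]

/-- The canonical map of a Lie algebra into its enveloping algebra. -/
def gen (k : Type*) [CommRing k] {L : Type*} [LieRing L] [LieAlgebra k L] : L →ₗ[k] U k L :=
  (UniversalEnvelopingAlgebra.ι k : L →ₗ⁅k⁆ U k L)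

theorem gen_lie (x y : L) : gen k ⁅x, y⁆ = gen k x * gen k y - gen k y * gen k x := by
  simp only [gen, LieHom.coe_toLinearMap, LieHom.map_lie, LieRing.of_associative_ring_bracket]

/-- Extension of a linear map respecting brackets to the enveloping algebra. -/
def liftU {A : Type*} [Ring A] [Algebra k A] (f : L →ₗ[k] A)
    (hf : ∀ x y, f ⁅x, y⁆ = f x * f y - f y * f x) : U k L →ₐ[k] A :=
  UniversalEnvelopingAlgebra.lift k
    { f with
      map_lie' := fun {x y} => by
        rw [LieRing.of_associative_ring_bracket]
        exact hf x y }

@[simp]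
theorem liftU_gen {A : Type*} [Ring A] [Algebra k A] (f : L →ₗ[k] A)
    (hf : ∀ x y, f ⁅x, y⁆ = f x * f y - f y * f x) (x : L) : liftU f hf (gen k x) = f x := by
  unfold liftU gen
  exact UniversalEnvelopingAlgebra.lift_ι_apply _ _ _

theorem algHom_extU {A : Type*} [Ring A] [Algebra k A] {f g : U k L →ₐ[k] A}
    (h : ∀ x : L, f (gen k x) = g (gen k x)) : f = g := by
  apply UniversalEnvelopingAlgebra.hom_ext
  ext x
  exact h x

/-- Induction on an enveloping algebra by right multiplication with generators. -/
theorem U_induction {p : U k L → Prop} (zero : p 0) (one : p 1)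
    (add : ∀ a b, p a → p b → p (a + b)) (smul : ∀ (r : k) a, p a → p (r • a))
    (mul : ∀ a (x : L), p a → p (a * gen k x)) (a : U k L) : p a := by
  let N : Submodule k (U k L) :=
    { carrier := {a | p a}
      add_mem' := fun {a b} ha hb => add a b ha hb
      zero_mem' := zero
      smul_mem' := fun r a ha => smul r a ha }
  let T : Subalgebra k (U k L) :=
    { carrier := {b | ∀ a, p a → p (a * b)}
      mul_mem' := fun {b c} hb hc a ha => by
        rw [← mul_assoc]; exact hc _ (hb a ha)
      add_mem' := fun {b c} hb hc a ha => by
        rw [mul_add]; exact add _ _ (hb a ha) (hc a ha)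
      algebraMap_mem' := fun r a ha => by
        rw [← Algebra.commutes, ← Algebra.smul_def]; exact smul r a ha }
  let f : U k L →ₐ[k] T := liftU
    { toFun := fun x => ⟨gen k x, fun a ha => mul a x ha⟩
      map_add' := fun x y => Subtype.ext (map_add _ x y)
      map_smul' := fun r x => Subtype.ext (map_smul _ r x) }
    (fun x y => Subtype.ext (gen_lie x y))
  have hf : T.val.comp f = AlgHom.id k _ := algHom_extU (fun x => by simp [f])
  have h := (f a).2 1 one
  have h2 : ((f a : T) : U k L) = a := congrArg (fun g : U k L →ₐ[k] U k L => g a) hf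
  rw [h2, one_mul] at h
  exact h

/-- The coproduct of the enveloping algebra: the elements of `L` are primitive. -/
def comulU : U k L →ₐ[k] U k L ⊗[k] U k L :=
  liftU
    { toFun := fun x => gen k x ⊗ₜ 1 + 1 ⊗ₜ gen k x
      map_add' := fun x y => by simp only [map_add, add_tmul, tmul_add]; abel
      map_smul' := fun a x => by
        simp only [map_smul, RingHom.id_apply, smul_add, smul_tmul', tmul_smul] }
    (fun x y => by
        simp only [LinearMap.coe_mk, AddHom.coe_mk, gen_lie, sub_tmul, tmul_sub, mul_add,
          add_mul, Algebra.TensorProduct.tmul_mul_tmul, one_mul, mul_one]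
        abel)

/-- The counit of the enveloping algebra. -/
def counitU : U k L →ₐ[k] k := liftU 0 (fun x y => by simp)

/-- The functor `U` on morphisms. -/
def mapU {L' : Type*} [LieRing L'] [LieAlgebra k L'] (f : L →ₗ⁅k⁆ L') : U k L →ₐ[k] U k L' :=
  liftU (gen k ∘ₗ (f : L →ₗ[k] L')) (fun x y => by simp [gen_lie])

@[simp]
theorem mapU_gen {L' : Type*} [LieRing L'] [LieAlgebra k L'] (f : L →ₗ⁅k⁆ L') (x : L) :
    mapU f (gen k x) = gen k (f x) := by
  simp [mapU]

@[simp]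
theorem comulU_gen (x : L) :
    comulU (gen k x) = gen k x ⊗ₜ[k] (1 : U k L) + (1 : U k L) ⊗ₜ[k] gen k x := by
  simp [comulU]

@[simp]
theorem counitU_gen (x : L) : counitU (gen k x) = 0 := by
  simp [counitU]

instance instBialgebraU : Bialgebra k (U k L) :=
  Bialgebra.ofAlgHom comulU counitU
    (algHom_extU fun x => by
      simp [tmul_add, add_tmul, Algebra.TensorProduct.one_def, add_assoc])
    (algHom_extU fun x => by simp)
    (algHom_extU fun x => by simp)

theorem comul_eq (a : U k L) : Coalgebra.comul (R := k) a = comulU a := rfl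

theorem counit_eq (a : U k L) : Coalgebra.counit (R := k) a = counitU a := rfl

@[simp]
theorem comul_gen (x : L) : Coalgebra.comul (R := k) (gen k x)
    = gen k x ⊗ₜ[k] (1 : U k L) + (1 : U k L) ⊗ₜ[k] gen k x := by
  rw [comul_eq, comulU_gen]

@[simp]
theorem counit_gen (x : L) : Coalgebra.counit (R := k) (gen k x) = 0 := by
  rw [counit_eq, counitU_gen]

/-- The antipode as an anti-homomorphism: `x ↦ -x` on `L`. -/
def antipodeHomU : U k L →ₐ[k] (U k L)ᵐᵒᵖ :=
  liftU (-((MulOpposite.opLinearEquiv k : U k L ≃ₗ[k] (U k L)ᵐᵒᵖ) : U k L →ₗ[k] _) ∘ₗ gen k)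
    (fun x y => by
      apply MulOpposite.unop_injective
      simp [gen_lie])

def antipodeU : U k L →ₗ[k] U k L :=
  ((MulOpposite.opLinearEquiv k : U k L ≃ₗ[k] (U k L)ᵐᵒᵖ).symm : _ →ₗ[k] U k L) ∘ₗ
    (antipodeHomU : U k L →ₐ[k] (U k L)ᵐᵒᵖ).toLinearMap

theorem antipodeU_one : antipodeU (1 : U k L) = 1 := by simp [antipodeU]

theorem antipodeU_mul_gen (a : U k L) (x : L) :
    antipodeU (a * gen k x) = - (gen k x * antipodeU a) := by
  simp [antipodeU, antipodeHomU]

theorem antipodeU_gen_mul (a : U k L) (x : L) :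
    antipodeU (gen k x * a) = - (antipodeU a * gen k x) := by
  simp [antipodeU, antipodeHomU]

instance instHopfAlgebraU : HopfAlgebra k (U k L) where
  antipode := antipodeU
  mul_antipode_rTensor_comul := by
    ext a
    simp only [LinearMap.comp_apply, comul_eq, counit_eq, Algebra.linearMap_apply]
    induction a using U_induction with
    | zero => simp
    | one => simp [Algebra.TensorProduct.one_def, antipodeU_one]
    | add a b ha hb => simp [ha, hb]
    | smul r a ha => simp only [map_smul, ha, Algebra.algebraMap_eq_smul_one, smul_eq_mul, mul_smul]
    | mul a x ha =>
      have key : ∀ z : U k L ⊗[k] U k L, LinearMap.mul' k (U k L) (antipodeU.rTensor (U k L)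
          (z * (gen k x ⊗ₜ[k] (1 : U k L) + (1 : U k L) ⊗ₜ[k] gen k x)))
          = LinearMap.mul' k (U k L) (antipodeU.rTensor (U k L) z) * gen k x
            - gen k x * LinearMap.mul' k (U k L) (antipodeU.rTensor (U k L) z) := by
        intro z
        induction z with
        | zero => simp
        | add z w hz hw => rw [add_mul, map_add, map_add, hz, hw]; simp only [map_add, add_mul, mul_add]; abel
        | tmul b c =>
          simp [mul_add, antipodeU_mul_gen, mul_assoc]
          abel
      rw [map_mul, comulU_gen, key, ha]
      simp [Algebra.commutes]
  mul_antipode_lTensor_comul := by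
    ext a
    simp only [LinearMap.comp_apply, comul_eq, counit_eq, Algebra.linearMap_apply]
    induction a using U_induction with
    | zero => simp
    | one => simp [Algebra.TensorProduct.one_def, antipodeU_one]
    | add a b ha hb => simp [ha, hb]
    | smul r a ha => simp only [map_smul, ha, Algebra.algebraMap_eq_smul_one, smul_eq_mul, mul_smul]
    | mul a x ha =>
      have key : ∀ z : U k L ⊗[k] U k L, LinearMap.mul' k (U k L) (antipodeU.lTensor (U k L)
          (z * (gen k x ⊗ₜ[k] (1 : U k L) + (1 : U k L) ⊗ₜ[k] gen k x))) = 0 := by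
        intro z
        induction z with
        | zero => simp
        | add z w hz hw => rw [add_mul, map_add, map_add, hz, hw, add_zero]
        | tmul b c =>
          simp [mul_add, antipodeU_mul_gen, mul_assoc]
      rw [map_mul, comulU_gen, key]
      simp

instance instIsCocommU : Coalgebra.IsCocomm k (U k L) where
  comm_comp_comul := by
    have : ((Algebra.TensorProduct.comm k (U k L) (U k L)).toAlgHom.comp comulU)
        = (comulU : U k L →ₐ[k] _) := algHom_extU fun x => by simp [add_comm]
    ext a
    exact congrArg (fun f : U k L →ₐ[k] U k L ⊗[k] U k L => f a) this

end Enveloping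

section Splitting

variable (k : Type*) [CommRing k] (A M L : Type*)
  [LieRing A] [LieAlgebra k A] [LieRing M] [LieAlgebra k M] [LieRing L] [LieAlgebra k L]

/-- A decomposition `L = A ⊕ M` of a Lie algebra into two complementary Lie subalgebras
(with the inclusions `inA`, `inM` and the projections `prA`, `prM`). -/
structure LieSplitting where
  inA : A →ₗ⁅k⁆ L
  inM : M →ₗ⁅k⁆ L
  prA : L →ₗ[k] A
  prM : L →ₗ[k] M
  prA_inA : ∀ a, prA (inA a) = a
  prM_inM : ∀ m, prM (inM m) = m
  prA_inM : ∀ m, prA (inM m) = 0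
  prM_inA : ∀ a, prM (inA a) = 0
  sum_pr : ∀ w, inA (prA w) + inM (prM w) = w

variable {k A M L} (S : LieSplitting k A M L)

namespace LieSplitting

/-- `V = U(A) ⊗ U(M)`. -/
abbrev V (_ : LieSplitting k A M L) : Type _ := U k A ⊗[k] U k M

/-- right multiplication by `y ∈ M` on `V`. -/
def rV (y : M) : S.V →ₗ[k] S.V := (LinearMap.mulRight k (gen k y)).lTensor (U k A)

/-- left multiplication by `U(A)` on `V`. -/
def lV : U k A →ₗ[k] S.V →ₗ[k] S.V :=
  LinearMap.rTensorHom (U k M) ∘ₗ LinearMap.mul k (U k A)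

@[simp] theorem rV_tmul (y : M) (u : U k A) (c : U k M) :
    S.rV y (u ⊗ₜ c) = u ⊗ₜ (c * gen k y) := rfl

@[simp] theorem lV_tmul (v u : U k A) (c : U k M) :
    S.lV v (u ⊗ₜ c) = (v * u) ⊗ₜ c := rfl

theorem rV_add (x y : M) (v : S.V) : S.rV (x + y) v = S.rV x v + S.rV y v := by
  induction v using TensorProduct.induction_on with
  | zero => simp
  | add v w hv hw => simp only [map_add, hv, hw]; abel
  | tmul u c => simp [mul_add, tmul_add]

theorem rV_smul (r : k) (y : M) (v : S.V) : S.rV (r • y) v = r • S.rV y v := by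
  induction v using TensorProduct.induction_on with
  | zero => simp
  | add v w hv hw => simp only [map_add, hv, hw, smul_add]
  | tmul u c => simp

theorem rV_lie (x y : M) (v : S.V) :
    S.rV ⁅x, y⁆ v = S.rV y (S.rV x v) - S.rV x (S.rV y v) := by
  induction v using TensorProduct.induction_on with
  | zero => simp
  | add v w hv hw => simp only [map_add, hv, hw]; abel
  | tmul u c => simp [gen_lie, mul_sub, tmul_sub, mul_assoc]

theorem lV_rV (u : U k A) (y : M) (v : S.V) : S.lV u (S.rV y v) = S.rV y (S.lV u v) := by
  induction v using TensorProduct.induction_on with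
  | zero => simp
  | add v w hv hw => simp only [map_add, hv, hw]
  | tmul u c => simp

theorem lV_mul (a b : U k A) (v : S.V) : S.lV (a * b) v = S.lV a (S.lV b v) := by
  induction v using TensorProduct.induction_on with
  | zero => simp
  | add v w hv hw => simp only [map_add, hv, hw]
  | tmul u c => simp [mul_assoc]

theorem lV_one (v : S.V) : S.lV 1 v = v := by
  induction v using TensorProduct.induction_on with
  | zero => simp
  | add v w hv hw => simp only [map_add, hv, hw]
  | tmul u c => simp

/-- The operator `f ↦ (w ↦ f(w) y + f([y, w]))` on linear maps `L → V`. -/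
def twist (y : M) : (L →ₗ[k] S.V) →ₗ[k] (L →ₗ[k] S.V) where
  toFun f := S.rV y ∘ₗ f + f ∘ₗ (LieAlgebra.ad k L (S.inM y) : L →ₗ[k] L)
  map_add' f g := by ext w; simp; abel
  map_smul' r f := by ext w; simp

theorem twist_apply (y : M) (f : L →ₗ[k] S.V) (w : L) :
    S.twist y f w = S.rV y (f w) + f ⁅S.inM y, w⁆ := rfl

/-- `σ(1)`: the map `w ↦ w_A ⊗ 1 + 1 ⊗ w_M`. -/
def sigmaOne : L →ₗ[k] S.V where
  toFun w := gen k (S.prA w) ⊗ₜ 1 + 1 ⊗ₜ gen k (S.prM w)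
  map_add' x y := by simp only [map_add, add_tmul, tmul_add]; abel
  map_smul' r x := by simp only [map_smul, RingHom.id_apply, smul_add, smul_tmul', tmul_smul]

theorem sigmaOne_apply (w : L) :
    S.sigmaOne w = gen k (S.prA w) ⊗ₜ 1 + 1 ⊗ₜ gen k (S.prM w) := rfl

/-- The right `U(M)`-module structure on `L → V` generated by `twist`. -/
def twistHom : U k M →ₐ[k] (Module.End k (L →ₗ[k] S.V))ᵐᵒᵖ :=
  liftU
    { toFun := fun y => MulOpposite.op (S.twist y)
      map_add' := fun x y => by
        apply MulOpposite.unop_injective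
        ext f w
        simp only [MulOpposite.unop_op, MulOpposite.unop_add, LinearMap.add_apply, twist_apply,
          rV_add, map_add, add_lie]
        abel
      map_smul' := fun r x => by
        apply MulOpposite.unop_injective
        ext f w
        simp only [MulOpposite.unop_op, MulOpposite.unop_smul, LinearMap.smul_apply, twist_apply,
          rV_smul, map_smul, smul_lie, RingHom.id_apply, smul_add] }
    (fun x y => by
        apply MulOpposite.unop_injective
        ext f w
        simp only [LinearMap.coe_mk, AddHom.coe_mk, MulOpposite.unop_op, MulOpposite.unop_sub,
          MulOpposite.unop_mul, Module.End.mul_apply, LinearMap.sub_apply, twist_apply,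
          rV_lie, LieHom.map_lie, map_add, lie_lie, map_sub]
        abel)

/-- `σ_w(c) ∈ V`, which represents the product `c w` for `c ∈ U(M)`, `w ∈ L`. -/
def sigma (c : U k M) : L →ₗ[k] S.V := (S.twistHom c).unop S.sigmaOne

theorem sigma_one : S.sigma 1 = S.sigmaOne := by simp [sigma]

theorem sigma_mul_gen (c : U k M) (y : M) (w : L) :
    S.sigma (c * gen k y) w = S.rV y (S.sigma c w) + S.sigma c ⁅S.inM y, w⁆ := by
  simp [sigma, twistHom, twist_apply]

theorem sigma_add (c d : U k M) : S.sigma (c + d) = S.sigma c + S.sigma d := by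
  simp [sigma]

theorem sigma_smul (r : k) (c : U k M) : S.sigma (r • c) = r • S.sigma c := by
  simp [sigma]

theorem sigma_zero : S.sigma 0 = 0 := by simp [sigma]

/-- Right multiplication by `w ∈ L` on `V ≅ U(L)`. -/
def rho (w : L) : S.V →ₗ[k] S.V :=
  TensorProduct.lift
    { toFun := fun u =>
        { toFun := fun c => S.lV u (S.sigma c w)
          map_add' := fun c d => by simp [sigma_add]
          map_smul' := fun r c => by simp [sigma_smul] }
      map_add' := fun u v => by ext c; simp
      map_smul' := fun r u => by ext c; simp }

theorem rho_tmul (w : L) (u : U k A) (c : U k M) :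
    S.rho w (u ⊗ₜ c) = S.lV u (S.sigma c w) := rfl

theorem rho_add (w x : L) (v : S.V) : S.rho (w + x) v = S.rho w v + S.rho x v := by
  induction v using TensorProduct.induction_on with
  | zero => simp
  | add v w hv hw => simp only [map_add, hv, hw]; abel
  | tmul u c => simp [rho_tmul]

theorem rho_smul (r : k) (w : L) (v : S.V) : S.rho (r • w) v = r • S.rho w v := by
  induction v using TensorProduct.induction_on with
  | zero => simp
  | add v w hv hw => simp only [map_add, hv, hw, smul_add]
  | tmul u c => simp [rho_tmul]

theorem rho_sub (w x : L) (v : S.V) : S.rho (w - x) v = S.rho w v - S.rho x v := by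
  have h := S.rho_add (w - x) x v
  rw [sub_add_cancel] at h
  rw [h]; abel

theorem rho_lV (w : L) (u : U k A) (v : S.V) : S.rho w (S.lV u v) = S.lV u (S.rho w v) := by
  induction v using TensorProduct.induction_on with
  | zero => simp
  | add v w hv hw => simp only [map_add, hv, hw]
  | tmul a c => simp [rho_tmul, lV_mul]

theorem rho_rV (w : L) (y : M) (v : S.V) :
    S.rho w (S.rV y v) = S.rV y (S.rho w v) + S.rho ⁅S.inM y, w⁆ v := by
  induction v using TensorProduct.induction_on with
  | zero => simp
  | add v w hv hw => simp only [map_add, hv, hw]; abel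
  | tmul a c => simp [rho_tmul, sigma_mul_gen, lV_rV]

theorem sigmaOne_inM (y : M) : S.sigmaOne (S.inM y) = 1 ⊗ₜ gen k y := by
  simp [sigmaOne_apply, S.prA_inM, S.prM_inM]

theorem sigmaOne_inA (x : A) : S.sigmaOne (S.inA x) = gen k x ⊗ₜ 1 := by
  simp [sigmaOne_apply, S.prA_inA, S.prM_inA]

theorem sigma_inM (c : U k M) (y : M) : S.sigma c (S.inM y) = 1 ⊗ₜ (c * gen k y) := by
  induction c using U_induction generalizing y with
  | zero => simp [sigma_zero]
  | one => simp [sigma_one, sigmaOne_inM]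
  | add a b ha hb => simp [sigma_add, ha, hb, add_mul, tmul_add]
  | smul r a ha => simp [sigma_smul, ha]
  | mul a x ha =>
    rw [sigma_mul_gen, ha, ← LieHom.map_lie, ha, rV_tmul, ← tmul_add, gen_lie]
    congr 1
    noncomm_ring

theorem rho_one (w : L) : S.rho w (1 ⊗ₜ 1) = S.sigmaOne w := by
  rw [rho_tmul, lV_one, sigma_one]

theorem rho_tmul_eq_lV (w : L) (u : U k A) (c : U k M) :
    S.rho w (u ⊗ₜ c) = S.lV u (S.rho w (1 ⊗ₜ c)) := by
  rw [rho_tmul, rho_tmul, lV_one]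

theorem rho_sigmaOne (w x : L) : S.rho x (S.sigmaOne w)
    = S.lV (gen k (S.prA w)) (S.sigmaOne x) + S.rV (S.prM w) (S.sigmaOne x)
      + S.sigmaOne ⁅S.inM (S.prM w), x⁆ := by
  have h : S.sigmaOne w = S.lV (gen k (S.prA w)) (1 ⊗ₜ 1) + S.rV (S.prM w) (1 ⊗ₜ 1) := by
    simp [sigmaOne_apply]
  rw [h, map_add, rho_lV, rho_rV, rho_one, rho_one, add_assoc]

theorem rho_lie_one (w x : L) : S.sigmaOne ⁅w, x⁆
    = S.rho x (S.sigmaOne w) - S.rho w (S.sigmaOne x) := by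
  obtain ⟨a, y, hw⟩ : ∃ a y, w = S.inA a + S.inM y := ⟨_, _, (S.sum_pr w).symm⟩
  obtain ⟨b, z, hx⟩ : ∃ b z, x = S.inA b + S.inM z := ⟨_, _, (S.sum_pr x).symm⟩
  subst hw hx
  rw [rho_sigmaOne, rho_sigmaOne]
  simp only [map_add, S.prA_inA, S.prM_inM, S.prA_inM, S.prM_inA, add_zero, zero_add,
    sigmaOne_inA, sigmaOne_inM, lie_add, add_lie, ← LieHom.map_lie, gen_lie, lV_tmul, rV_tmul,
    one_mul, mul_one, tmul_sub, sub_tmul]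
  rw [← lie_skew (S.inA a) (S.inM z), map_neg]
  abel

theorem sigma_lie (c : U k M) (w x : L) : S.sigma c ⁅w, x⁆
    = S.rho x (S.sigma c w) - S.rho w (S.sigma c x) := by
  induction c using U_induction generalizing w x with
  | zero => simp [sigma_zero]
  | one => rw [sigma_one, rho_lie_one]
  | add a b ha hb => simp only [sigma_add, LinearMap.add_apply, ha, hb, map_add]; abel
  | smul r a ha => simp only [sigma_smul, LinearMap.smul_apply, ha, map_smul, smul_sub]
  | mul a y ha =>
    rw [sigma_mul_gen, sigma_mul_gen, sigma_mul_gen, leibniz_lie, map_add, ha w x,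
      ha ⁅S.inM y, w⁆ x, ha w ⁅S.inM y, x⁆, map_sub,
      map_add, map_add, rho_rV, rho_rV]
    abel

theorem rho_lie (w x : L) (v : S.V) : S.rho ⁅w, x⁆ v
    = S.rho x (S.rho w v) - S.rho w (S.rho x v) := by
  induction v using TensorProduct.induction_on with
  | zero => simp
  | add v w hv hw => simp only [map_add, hv, hw]; abel
  | tmul u c =>
    rw [rho_tmul, rho_tmul, rho_tmul, sigma_lie, map_sub, rho_lV, rho_lV]

/-- The right regular representation of `U(L)` on `V`. -/
def rhoHom : U k L →ₐ[k] (Module.End k S.V)ᵐᵒᵖ :=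
  liftU
    { toFun := fun w => MulOpposite.op (S.rho w)
      map_add' := fun x y => by
        apply MulOpposite.unop_injective
        refine LinearMap.ext (fun v => ?_)
        exact S.rho_add x y v
      map_smul' := fun r x => by
        apply MulOpposite.unop_injective
        refine LinearMap.ext (fun v => ?_)
        exact S.rho_smul r x v }
    (fun x y => by
        apply MulOpposite.unop_injective
        refine LinearMap.ext (fun v => ?_)
        exact S.rho_lie x y v)

/-- The factorization `U(L) → U(A) ⊗ U(M)`, inverse to multiplication `u ⊗ c ↦ u c`. -/
def fact : U k L →ₗ[k] U k A ⊗[k] U k M where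
  toFun b := (S.rhoHom b).unop (1 ⊗ₜ 1)
  map_add' := by simp
  map_smul' := by simp

theorem fact_one : S.fact 1 = 1 ⊗ₜ 1 := by simp [fact]

theorem fact_mul_gen (b : U k L) (w : L) : S.fact (b * gen k w) = S.rho w (S.fact b) := by
  simp [fact, rhoHom]

/-- Multiplication `u ⊗ c ↦ u c`. -/
def mulMap : U k A ⊗[k] U k M →ₗ[k] U k L :=
  LinearMap.mul' k (U k L) ∘ₗ TensorProduct.map (mapU S.inA).toLinearMap (mapU S.inM).toLinearMap

@[simp] theorem mulMap_tmul (u : U k A) (c : U k M) :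
    S.mulMap (u ⊗ₜ c) = mapU S.inA u * mapU S.inM c := by simp [mulMap]

theorem mulMap_lV (u : U k A) (v : S.V) : S.mulMap (S.lV u v) = mapU S.inA u * S.mulMap v := by
  induction v using TensorProduct.induction_on with
  | zero => simp
  | add v w hv hw => simp only [map_add, hv, hw, mul_add]
  | tmul a c => simp [mul_assoc]

theorem mulMap_rV (y : M) (v : S.V) :
    S.mulMap (S.rV y v) = S.mulMap v * gen k (S.inM y) := by
  induction v using TensorProduct.induction_on with
  | zero => simp
  | add v w hv hw => simp only [map_add, hv, hw, add_mul]
  | tmul a c => simp [mul_assoc]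

theorem mulMap_sigma (c : U k M) (w : L) :
    S.mulMap (S.sigma c w) = mapU S.inM c * gen k w := by
  induction c using U_induction generalizing w with
  | zero => simp [sigma_zero]
  | one =>
    rw [sigma_one, sigmaOne_apply]
    conv_rhs => rw [← S.sum_pr w]
    simp
  | add a b ha hb => simp [sigma_add, ha, hb, add_mul]
  | smul r a ha => simp [sigma_smul, ha]
  | mul a y ha =>
    rw [sigma_mul_gen, map_add, mulMap_rV, ha, ha, gen_lie, map_mul, mapU_gen]
    noncomm_ring

theorem mulMap_rho (w : L) (v : S.V) : S.mulMap (S.rho w v) = S.mulMap v * gen k w := by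
  induction v using TensorProduct.induction_on with
  | zero => simp
  | add v w hv hw => simp only [map_add, hv, hw, add_mul]
  | tmul a c => rw [rho_tmul, mulMap_lV, mulMap_sigma, mulMap_tmul, mul_assoc]

@[simp] theorem mulMap_fact (b : U k L) : S.mulMap (S.fact b) = b := by
  induction b using U_induction with
  | zero => simp
  | one => simp [fact_one]
  | add a b ha hb => simp [ha, hb]
  | smul r a ha => simp [ha]
  | mul a y ha => rw [fact_mul_gen, mulMap_rho, ha]

theorem fact_mul_inM (b : U k L) (c : U k M) :
    S.fact (b * mapU S.inM c) = (LinearMap.mulRight k c).lTensor (U k A) (S.fact b) := by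
  induction c using U_induction with
  | zero => simp
  | one => simp
  | add x y hx hy =>
    simp only [map_add, mul_add, hx, hy]
    generalize S.fact b = v
    induction v using TensorProduct.induction_on with
    | zero => simp
    | add v w hv hw => simp only [map_add, ← hv, ← hw]; abel
    | tmul u c => simp [mul_add, tmul_add]
  | smul r x hx =>
    simp only [map_smul, mul_smul_comm, hx]
    generalize S.fact b = v
    induction v using TensorProduct.induction_on with
    | zero => simp
    | add v w hv hw => simp only [map_add, smul_add, hv, hw]
    | tmul u c => simp
  | mul x y hx =>
    rw [map_mul (mapU S.inM), mapU_gen, ← mul_assoc, fact_mul_gen, hx]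
    generalize S.fact b = v
    induction v using TensorProduct.induction_on with
    | zero => simp
    | add v w hv hw => simp only [map_add, hv, hw]
    | tmul u c => simp [rho_tmul, sigma_inM, mul_assoc]

theorem fact_inA (u : U k A) : S.fact (mapU S.inA u) = u ⊗ₜ 1 := by
  induction u using U_induction with
  | zero => simp
  | one => simp [fact_one]
  | add x y hx hy => simp [hx, hy, add_tmul]
  | smul r x hx => simp [hx, smul_tmul']
  | mul x y hx =>
    rw [map_mul (mapU S.inA), mapU_gen, fact_mul_gen, hx, rho_tmul, sigma_one, sigmaOne_inA, lV_tmul]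

@[simp] theorem fact_mulMap (v : S.V) : S.fact (S.mulMap v) = v := by
  induction v using TensorProduct.induction_on with
  | zero => simp
  | add v w hv hw => simp only [map_add, hv, hw]
  | tmul u c => rw [mulMap_tmul, fact_mul_inM, fact_inA]; simp

end LieSplitting

end Splitting

section Symbols

variable {k : Type*} [CommRing k]

theorem comul_mapU {L L' : Type*} [LieRing L] [LieAlgebra k L] [LieRing L'] [LieAlgebra k L']
    (f : L →ₗ⁅k⁆ L') (a : U k L) : Coalgebra.comul (R := k) (mapU f a)
      = TensorProduct.map (mapU f).toLinearMap (mapU f).toLinearMap (Coalgebra.comul a) := by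
  have h : comulU.comp (mapU f)
      = (Algebra.TensorProduct.map (mapU f) (mapU f)).comp (comulU : U k L →ₐ[k] _) :=
    algHom_extU fun x => by simp
  exact congrArg (fun g : U k L →ₐ[k] U k L' ⊗[k] U k L' => g a) h

theorem counit_mapU {L L' : Type*} [LieRing L] [LieAlgebra k L] [LieRing L'] [LieAlgebra k L']
    (f : L →ₗ⁅k⁆ L') (a : U k L) :
    Coalgebra.counit (R := k) (mapU f a) = Coalgebra.counit (R := k) a := by
  have h : counitU.comp (mapU f) = (counitU : U k L →ₐ[k] _) := algHom_extU fun x => by simp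
  exact congrArg (fun g : U k L →ₐ[k] k => g a) h

variable {A M L : Type*}
  [LieRing A] [LieAlgebra k A] [LieRing M] [LieAlgebra k M] [LieRing L] [LieAlgebra k L]

namespace LieSplitting

variable (S : LieSplitting k A M L)

/-- The `U(A)`-part of an element of `U(L)`; on group-like elements, `a m ↦ a`. -/
def piA : U k L →ₗ[k] U k A :=
  TensorProduct.rid k (U k A) ∘ₗ (Coalgebra.counit (R := k) (A := U k M)).lTensor (U k A) ∘ₗ S.fact

/-- The `U(M)`-part of an element of `U(L)`; on group-like elements, `a m ↦ m`. -/
def piM : U k L →ₗ[k] U k M :=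
  TensorProduct.lid k (U k M) ∘ₗ (Coalgebra.counit (R := k) (A := U k A)).rTensor (U k M) ∘ₗ S.fact

theorem piA_mul (u : U k A) (c : U k M) :
    S.piA (mapU S.inA u * mapU S.inM c) = Coalgebra.counit (R := k) c • u := by
  rw [← mulMap_tmul, piA, LinearMap.comp_apply, LinearMap.comp_apply, fact_mulMap]; simp

theorem piM_mul (u : U k A) (c : U k M) :
    S.piM (mapU S.inA u * mapU S.inM c) = Coalgebra.counit (R := k) u • c := by
  rw [← mulMap_tmul, piM, LinearMap.comp_apply, LinearMap.comp_apply, fact_mulMap]; simp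

theorem piA_inA (u : U k A) : S.piA (mapU S.inA u) = u := by
  simpa using S.piA_mul u 1

theorem piM_inM (c : U k M) : S.piM (mapU S.inM c) = c := by
  simpa using S.piM_mul 1 c

/-- Every element of `U(L)` is a sum of products `u c`. -/
theorem induction_mul {p : U k L → Prop} (zero : p 0) (add : ∀ a b, p a → p b → p (a + b))
    (mul : ∀ u c, p (mapU S.inA u * mapU S.inM c)) (b : U k L) : p b := by
  rw [← S.mulMap_fact b]
  generalize S.fact b = v
  induction v using TensorProduct.induction_on with
  | zero => simpa using zero
  | add v w hv hw => rw [map_add]; exact add _ _ hv hw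
  | tmul u c => rw [mulMap_tmul]; exact mul u c

theorem piM_mul_mul (b : U k L) (g : U k L) :
    S.piM (mapU S.inM (S.piM b) * g) = S.piM (b * g) := by
  have h : ∀ (u : U k A) (g : U k L),
      S.piM (mapU S.inA u * g) = Coalgebra.counit (R := k) u • S.piM g := by
    intro u g
    induction g using S.induction_mul with
    | zero => simp
    | add a b ha hb => simp only [mul_add, map_add, ha, hb, smul_add]
    | mul v c => rw [← mul_assoc, ← map_mul, piM_mul, piM_mul, Bialgebra.counit_mul, mul_smul]
  induction b using S.induction_mul with
  | zero => simp
  | add a b ha hb => simp only [add_mul, map_add, ha, hb]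
  | mul u c => rw [piM_mul, mul_assoc, h, map_smul, smul_mul_assoc, map_smul]

theorem comul_piM (b : U k L) : Coalgebra.comul (R := k) (S.piM b)
    = TensorProduct.map S.piM S.piM (Coalgebra.comul b) := by
  induction b using S.induction_mul with
  | zero => simp
  | add a b ha hb => simp only [map_add, ha, hb]
  | mul u c =>
    rw [piM_mul, Bialgebra.comul_mul, comul_mapU, comul_mapU, map_smul]
    have h : ∀ (x : U k A ⊗[k] U k A) (y : U k M ⊗[k] U k M),
        TensorProduct.map S.piM S.piM
          (TensorProduct.map (mapU S.inA).toLinearMap (mapU S.inA).toLinearMap x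
            * TensorProduct.map (mapU S.inM).toLinearMap (mapU S.inM).toLinearMap y)
        = (TensorProduct.lid k k (TensorProduct.map (Coalgebra.counit (R := k))
            (Coalgebra.counit (R := k)) x)) • y := by
      intro x y
      induction x using TensorProduct.induction_on with
      | zero => simp
      | add x x' hx hx' => simp only [map_add, add_mul, hx, hx', add_smul]
      | tmul p q =>
        induction y using TensorProduct.induction_on with
        | zero => simp
        | add y y' hy hy' => simp only [map_add, mul_add, hy, hy', smul_add]
        | tmul c d =>
          simp [piM_mul, TensorProduct.smul_tmul', smul_smul, mul_comm]
    rw [h]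
    congr 1
    have h2 : (TensorProduct.map (Coalgebra.counit (R := k)) (Coalgebra.counit (R := k)))
        (Coalgebra.comul (R := k) u) = (Coalgebra.counit (R := k)).lTensor k
          ((Coalgebra.counit (R := k)).rTensor (U k A) (Coalgebra.comul (R := k) u)) := by
      rw [← LinearMap.comp_apply, ← LinearMap.comp_apply, LinearMap.lTensor_comp_rTensor,
        LinearMap.comp_apply]
    rw [h2, Coalgebra.rTensor_counit_comul]
    simp

theorem counit_piM (b : U k L) :
    Coalgebra.counit (R := k) (S.piM b) = Coalgebra.counit (R := k) b := by
  induction b using S.induction_mul with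
  | zero => simp
  | add a b ha hb => simp only [map_add, ha, hb]
  | mul u c => simp [piM_mul, counit_mapU]

/-- The right action `c ⊗ u ↦ c ◁ u` of `U(A)` on `U(M)`, induced by right translation on the
quotient `exp(A) \ exp(L) ≅ exp(M)`. -/
def act : U k M ⊗[k] U k A →ₗ[k] U k M :=
  S.piM ∘ₗ LinearMap.mul' k (U k L) ∘ₗ
    TensorProduct.map (mapU S.inM).toLinearMap (mapU S.inA).toLinearMap

/-- The dressing action `c ⊗ u ↦ c ▷ u` of `U(M)` on `U(A)`; for group-like elements,
`m a = (m ▷ a) (m ◁ a)`. -/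
def dress : U k M ⊗[k] U k A →ₗ[k] U k A :=
  S.piA ∘ₗ LinearMap.mul' k (U k L) ∘ₗ
    TensorProduct.map (mapU S.inM).toLinearMap (mapU S.inA).toLinearMap

/-- The linear maps `U(M) → U(A)`: this is the completed smash product `U(A) ⋉ U(M)^*`, where
`F u`, for `F ∈ U(M)^*` and `u ∈ U(A)`, is the symbol `c ↦ F(c) u` (functions to the left). -/
def Sym (_ : LieSplitting k A M L) : Type _ := U k M →ₗ[k] U k A

instance : AddCommGroup S.Sym := inferInstanceAs (AddCommGroup (U k M →ₗ[k] U k A))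

instance : Module k S.Sym := inferInstanceAs (Module k (U k M →ₗ[k] U k A))

instance : FunLike S.Sym (U k M) (U k A) :=
  inferInstanceAs (FunLike (U k M →ₗ[k] U k A) (U k M) (U k A))

/-- A linear map as a symbol. -/
def toSym : (U k M →ₗ[k] U k A) ≃ₗ[k] S.Sym := LinearEquiv.refl k _

@[ext] theorem Sym.ext {φ ψ : S.Sym} (h : ∀ c, φ c = ψ c) : φ = ψ :=
  LinearMap.ext (f := S.toSym.symm φ) (g := S.toSym.symm ψ) h

@[simp] theorem toSym_apply (f : U k M →ₗ[k] U k A) (c : U k M) : S.toSym f c = f c := rfl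

@[simp] theorem toSym_symm_apply (φ : S.Sym) (c : U k M) : S.toSym.symm φ c = φ c := rfl

/-- `c ⊗ v ↦ ∑ v₁ ψ(c ◁ v₂)`. -/
def applyAct (ψ : U k M →ₗ[k] U k A) : U k M ⊗[k] U k A →ₗ[k] U k A :=
  LinearMap.mul' k (U k A) ∘ₗ (ψ ∘ₗ S.act).lTensor (U k A) ∘ₗ
    (TensorProduct.leftComm k (U k M) (U k A) (U k A)).toLinearMap ∘ₗ
    (Coalgebra.comul (R := k) (A := U k A)).lTensor (U k M)

/-- The product of symbols, `(φ ψ)(c) = ∑ φ(c₂)₁ ψ(c₁ ◁ φ(c₂)₂)`. -/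
def mulSym (φ ψ : U k M →ₗ[k] U k A) : U k M →ₗ[k] U k A :=
  S.applyAct ψ ∘ₗ φ.lTensor (U k M) ∘ₗ Coalgebra.comul (R := k)

instance : Mul S.Sym := ⟨fun φ ψ => S.toSym (S.mulSym (S.toSym.symm φ) (S.toSym.symm ψ))⟩

instance : One S.Sym := ⟨S.toSym (Algebra.linearMap k (U k A) ∘ₗ Coalgebra.counit (R := k))⟩

theorem mul_def (φ ψ : S.Sym) :
    φ * ψ = S.toSym (S.mulSym (S.toSym.symm φ) (S.toSym.symm ψ)) := rfl

theorem one_def : (1 : S.Sym)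
    = S.toSym (Algebra.linearMap k (U k A) ∘ₗ Coalgebra.counit (R := k)) := rfl

/-- The operator on `U(L)` defined by a symbol, `b ↦ ∑ b₁ φ(π_M(b₂))`. -/
def operator : S.Sym →ₗ[k] Module.End k (U k L) where
  toFun φ := (WithConv.toConv LinearMap.id * WithConv.toConv
    ((mapU S.inA).toLinearMap ∘ₗ S.toSym.symm φ ∘ₗ S.piM) : WithConv (U k L →ₗ[k] U k L)).ofConv
  map_add' φ ψ := by
    simp only [map_add, LinearMap.add_comp, LinearMap.comp_add, WithConv.toConv_add, mul_add,
      WithConv.ofConv_add]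
  map_smul' r φ := by
    simp only [map_smul, LinearMap.smul_comp, LinearMap.comp_smul, WithConv.toConv_smul,
      mul_smul_comm, WithConv.ofConv_smul, RingHom.id_apply]

theorem operator_apply (φ : S.Sym) (b : U k L) : S.operator φ b = LinearMap.mul' k (U k L)
    (((mapU S.inA).toLinearMap ∘ₗ S.toSym.symm φ ∘ₗ S.piM).lTensor (U k L)
      (Coalgebra.comul (R := k) b)) := rfl

theorem operator_injective : Function.Injective S.operator := by
  intro φ ψ h
  have h1 : ∀ χ : S.Sym, WithConv.toConv
      ((mapU S.inA).toLinearMap ∘ₗ S.toSym.symm χ ∘ₗ S.piM : U k L →ₗ[k] U k L)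
      = WithConv.toConv (HopfAlgebra.antipode k (A := U k L))
        * WithConv.toConv (S.operator χ) := by
    intro χ
    have : WithConv.toConv (S.operator χ) = WithConv.toConv LinearMap.id * WithConv.toConv
      ((mapU S.inA).toLinearMap ∘ₗ S.toSym.symm χ ∘ₗ S.piM) := rfl
    rw [this, ← mul_assoc, LinearMap.antipode_mul_id, one_mul]
  have h2 := (h1 φ).trans ((congrArg (fun g => WithConv.toConv (HopfAlgebra.antipode k
    (A := U k L)) * WithConv.toConv g) h).trans (h1 ψ).symm)
  have h3 := WithConv.toConv_injective h2
  ext c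
  have h4 := congrArg S.piA (LinearMap.congr_fun h3 (mapU S.inM c))
  simpa [piA_inA, piM_inM] using h4

theorem operator_mul_inA (ψ : S.Sym) (x : U k L) (v : U k A) :
    S.operator ψ (x * mapU S.inA v) = LinearMap.mul' k (U k L)
      (((mapU S.inA).toLinearMap ∘ₗ S.applyAct (S.toSym.symm ψ) ∘ₗ S.piM.rTensor (U k A)).lTensor
        (U k L) (TensorProduct.assoc k _ _ _ (Coalgebra.comul (R := k) x ⊗ₜ[k] v))) := by
  rw [operator_apply, Bialgebra.comul_mul, comul_mapU]
  generalize Coalgebra.comul (R := k) x = z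
  induction z using TensorProduct.induction_on with
  | zero => simp
  | add z w hz hw => simp only [add_mul, map_add, hz, hw, add_tmul]
  | tmul x y =>
    simp only [assoc_tmul, LinearMap.lTensor_tmul, LinearMap.mul'_apply, LinearMap.comp_apply,
      LinearMap.rTensor_tmul, applyAct]
    generalize Coalgebra.comul (R := k) v = w
    induction w using TensorProduct.induction_on with
    | zero => simp
    | add z w hz hw => simp only [map_add, mul_add, hz, hw, tmul_add]
    | tmul p q => simp [act, piM_mul_mul, mul_assoc]

theorem operator_mul (φ ψ : S.Sym) :
    S.operator (φ * ψ) = S.operator ψ ∘ₗ S.operator φ := by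
  ext b
  have h1 : ∀ z : U k L ⊗[k] U k L, S.operator ψ (LinearMap.mul' k (U k L)
      (((mapU S.inA).toLinearMap ∘ₗ S.toSym.symm φ ∘ₗ S.piM).lTensor (U k L) z))
      = LinearMap.mul' k (U k L) (((mapU S.inA).toLinearMap ∘ₗ S.applyAct (S.toSym.symm ψ) ∘ₗ
        TensorProduct.map S.piM (S.toSym.symm φ ∘ₗ S.piM)).lTensor (U k L)
          (TensorProduct.assoc k _ _ _ ((Coalgebra.comul (R := k)).rTensor (U k L) z))) := by
    intro z
    induction z using TensorProduct.induction_on with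
    | zero => simp
    | add z w hz hw => simp only [map_add, hz, hw]
    | tmul x y =>
      simp only [LinearMap.lTensor_tmul, LinearMap.mul'_apply, LinearMap.comp_apply,
        AlgHom.toLinearMap_apply, LinearMap.rTensor_tmul]
      rw [operator_mul_inA]
      generalize Coalgebra.comul (R := k) x = z
      induction z using TensorProduct.induction_on with
      | zero => simp
      | add z w hz hw => simp only [map_add, hz, hw, add_tmul]
      | tmul x y => simp
  rw [LinearMap.comp_apply, operator_apply S φ, h1, Coalgebra.coassoc_apply, operator_apply]
  generalize Coalgebra.comul (R := k) b = z
  induction z using TensorProduct.induction_on with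
  | zero => simp
  | add z w hz hw => simp only [map_add, hz, hw]
  | tmul x y =>
    simp only [LinearMap.lTensor_tmul, LinearMap.mul'_apply, LinearMap.comp_apply, mul_def,
      mulSym, LinearEquiv.symm_apply_apply, comul_piM]
    congr 3
    generalize Coalgebra.comul (R := k) y = z
    induction z using TensorProduct.induction_on with
    | zero => simp
    | add z w hz hw => simp only [map_add, hz, hw]
    | tmul x y => simp

theorem operator_one : S.operator 1 = LinearMap.id := by
  ext b
  rw [operator_apply, one_def]
  have : (mapU S.inA).toLinearMap ∘ₗ (S.toSym.symm (S.toSym (Algebra.linearMap k (U k A) ∘ₗ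
      Coalgebra.counit (R := k)))) ∘ₗ S.piM
      = Algebra.linearMap k (U k L) ∘ₗ Coalgebra.counit (R := k) := by
    ext c
    simp [counit_piM]
  rw [this, LinearMap.lTensor_comp, LinearMap.comp_apply, Coalgebra.lTensor_counit_comul]
  simp

instance instRingSym : Ring S.Sym :=
  { (inferInstance : AddCommGroup S.Sym), (inferInstance : Mul S.Sym),
    (inferInstance : One S.Sym) with
    mul_assoc := fun a b c => S.operator_injective (by
      simp only [operator_mul, LinearMap.comp_assoc])
    one_mul := fun a => S.operator_injective (by
      simp only [operator_mul, operator_one, LinearMap.comp_id])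
    mul_one := fun a => S.operator_injective (by
      simp only [operator_mul, operator_one, LinearMap.id_comp])
    zero_mul := fun a => S.operator_injective (by
      simp only [operator_mul, map_zero, LinearMap.comp_zero])
    mul_zero := fun a => S.operator_injective (by
      simp only [operator_mul, map_zero, LinearMap.zero_comp])
    left_distrib := fun a b c => S.operator_injective (by
      simp only [operator_mul, map_add, LinearMap.add_comp])
    right_distrib := fun a b c => S.operator_injective (by
      simp only [operator_mul, map_add, LinearMap.comp_add]) }

instance instAlgebraSym : Algebra k S.Sym :=
  Algebra.ofModule
    (fun r a b => S.operator_injective (by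
      simp only [operator_mul, map_smul, LinearMap.comp_smul]))
    (fun r a b => S.operator_injective (by
      simp only [operator_mul, map_smul, LinearMap.smul_comp]))

end LieSplitting

end Symbols

section Legs

variable {k : Type*} [CommRing k]

instance instLieRingPi {ι X : Type*} [LieRing X] : LieRing (ι → X) where
  bracket v w := fun i => ⁅v i, w i⁆
  add_lie u v w := funext fun i => add_lie (u i) (v i) (w i)
  lie_add u v w := funext fun i => lie_add (u i) (v i) (w i)
  lie_self v := funext fun i => lie_self (v i)
  leibniz_lie u v w := funext fun i => leibniz_lie (u i) (v i) (w i)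

instance instLieAlgebraPi {ι X : Type*} [LieRing X] [LieAlgebra k X] : LieAlgebra k (ι → X) where
  lie_smul r v w := funext fun i => lie_smul r (v i) (w i)

/-- The coordinate projection of a power of a Lie algebra. -/
def projHom {n : ℕ} {X : Type*} [LieRing X] [LieAlgebra k X] (i : Fin n) :
    (Fin n → X) →ₗ⁅k⁆ X :=
  { (LinearMap.proj i : (Fin n → X) →ₗ[k] X) with map_lie' := rfl }

/-- A family of homomorphisms as a homomorphism to the power. -/
def piHom {n : ℕ} {X Y : Type*} [LieRing X] [LieAlgebra k X] [LieRing Y] [LieAlgebra k Y]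
    (f : Fin n → (X →ₗ⁅k⁆ Y)) : X →ₗ⁅k⁆ (Fin n → Y) :=
  { LinearMap.pi (fun i => (f i : X →ₗ[k] Y)) with
    map_lie' := fun {x y} => funext fun i => (f i).map_lie x y }

/-- Rearrangement of legs: the leg `j` of the image of `w` is `w i` if `r j = some i`, and it is
trivial if `r j = none`. -/
def legHom (k : Type*) [CommRing k] (X : Type*) [LieRing X] [LieAlgebra k X] {m n : ℕ}
    (r : Fin n → Option (Fin m)) : (Fin m → X) →ₗ⁅k⁆ (Fin n → X) :=
  piHom fun j => (r j).elim 0 projHom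

variable {A M L : Type*}
  [LieRing A] [LieAlgebra k A] [LieRing M] [LieAlgebra k M] [LieRing L] [LieAlgebra k L]

namespace LieSplitting

variable (S : LieSplitting k A M L)

/-- The decomposition `L^n = A^n ⊕ M^n`. -/
def pow (n : ℕ) : LieSplitting k (Fin n → A) (Fin n → M) (Fin n → L) where
  inA := piHom fun i => S.inA.comp (projHom i)
  inM := piHom fun i => S.inM.comp (projHom i)
  prA := LinearMap.pi fun i => S.prA ∘ₗ LinearMap.proj i
  prM := LinearMap.pi fun i => S.prM ∘ₗ LinearMap.proj i
  prA_inA a := funext fun i => S.prA_inA (a i)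
  prM_inM m := funext fun i => S.prM_inM (m i)
  prA_inM m := funext fun i => S.prA_inM (m i)
  prM_inA a := funext fun i => S.prM_inA (a i)
  sum_pr w := funext fun i => S.sum_pr (w i)

/-- The completed `n`-th tensor power of `U(A) ⋉ U(M)^*`. -/
abbrev T (n : ℕ) : Type _ := (S.pow n).Sym

/-- Placing the legs of an element of a tensor power into the legs of another tensor power: the
leg `j` of the result is the leg `i` of the given element if `ins j = some i` (that is,
`res i = some j`), and it is `1` if `ins j = none`. -/
def embed {m n : ℕ} (ins : Fin n → Option (Fin m)) (res : Fin m → Option (Fin n)) :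
    S.T m →ₗ[k] S.T n :=
  (S.pow n).toSym.toLinearMap ∘ₗ
    LinearMap.llcomp k _ _ _ (mapU (legHom k A ins)).toLinearMap ∘ₗ
    (LinearMap.lcomp k _ (mapU (legHom k M res)).toLinearMap) ∘ₗ
    (S.pow m).toSym.symm.toLinearMap

theorem embed_apply {m n : ℕ} (ins : Fin n → Option (Fin m)) (res : Fin m → Option (Fin n))
    (φ : S.T m) (e : U k (Fin n → M)) :
    S.embed ins res φ e = mapU (legHom k A ins) (φ (mapU (legHom k M res) e)) := rfl

/-- The exchange of the two tensor factors. -/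
def flip : S.T 2 →ₗ[k] S.T 2 := S.embed ![some 1, some 0] ![some 1, some 0]

/-- `φ ↦ φ ⊗ 1`. -/
def leg1 : S.T 1 →ₗ[k] S.T 2 := S.embed ![some 0, none] ![some 0]

/-- `φ ↦ 1 ⊗ φ`. -/
def leg2 : S.T 1 →ₗ[k] S.T 2 := S.embed ![none, some 0] ![some 1]

/-- `φ ↦ φ^{12}`. -/
def leg12 : S.T 2 →ₗ[k] S.T 3 := S.embed ![some 0, some 1, none] ![some 0, some 1]

/-- `φ ↦ φ^{13}`. -/
def leg13 : S.T 2 →ₗ[k] S.T 3 := S.embed ![some 0, none, some 1] ![some 0, some 2]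

/-- `φ ↦ φ^{23}`. -/
def leg23 : S.T 2 →ₗ[k] S.T 3 := S.embed ![none, some 0, some 1] ![some 1, some 2]

/-- The common shape of the coproduct in one of the legs:
`φ ↦ (e ↦ ∑ τ(e₁) ▷ δ(φ(α(e₂) β(e₃))))`. -/
def coprod {m n : ℕ} (δ : Fin n → Option (Fin m)) (α β : Fin m → Option (Fin n))
    (τ : Fin n → Option (Fin n)) : S.T m →ₗ[k] S.T n :=
  (S.pow n).toSym.toLinearMap ∘ₗ
    LinearMap.lcomp k _ (Coalgebra.comul (R := k)) ∘ₗ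
    LinearMap.llcomp k _ _ _ (S.pow n).dress ∘ₗ
    TensorProduct.mapBilinear (RingHom.id k) _ _ _ _ (mapU (legHom k M τ)).toLinearMap ∘ₗ
    LinearMap.llcomp k _ _ _ (mapU (legHom k A δ)).toLinearMap ∘ₗ
    LinearMap.lcomp k _ (LinearMap.mul' k _ ∘ₗ
      TensorProduct.map (mapU (legHom k M α)).toLinearMap (mapU (legHom k M β)).toLinearMap ∘ₗ
      Coalgebra.comul (R := k)) ∘ₗ
    (S.pow m).toSym.symm.toLinearMap

theorem coprod_apply {m n : ℕ} (δ : Fin n → Option (Fin m)) (α β : Fin m → Option (Fin n))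
    (τ : Fin n → Option (Fin n)) (φ : S.T m) (e : U k (Fin n → M)) :
    S.coprod δ α β τ φ e = (S.pow n).dress (TensorProduct.map (mapU (legHom k M τ)).toLinearMap
      ((mapU (legHom k A δ)).toLinearMap ∘ₗ (S.pow m).toSym.symm φ ∘ₗ LinearMap.mul' k _ ∘ₗ
        TensorProduct.map (mapU (legHom k M α)).toLinearMap (mapU (legHom k M β)).toLinearMap ∘ₗ
        Coalgebra.comul (R := k)) (Coalgebra.comul (R := k) e)) := rfl

/-- The coproduct `Δ`; on group-like elements, `Δ(φ)(x, y) = (y ▷ w) ⊗ w` with `w = φ(x y)`. So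
`Δ(F)(x, y) = F(x y)` for functions `F`. -/
def comulSym : S.T 1 →ₗ[k] S.T 2 := S.coprod ![some 0, some 0] ![some 0] ![some 1] ![some 1, none]

/-- `Δ ⊗ 1`: for `φ(x, z) = v ⊗ w` one gets `(x, y, z) ↦ (y ▷ v) ⊗ v ⊗ w` with `v ⊗ w = φ(x y, z)`. -/
def comulLeft : S.T 2 →ₗ[k] S.T 3 :=
  S.coprod ![some 0, some 0, some 1] ![some 0, some 2] ![some 1, none] ![some 1, none, none]

/-- `1 ⊗ Δ`: one gets `(x, y, z) ↦ v ⊗ (z ▷ w) ⊗ w` with `v ⊗ w = φ(x, y z)`. -/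
def comulRight : S.T 2 →ₗ[k] S.T 3 :=
  S.coprod ![some 0, some 1, some 1] ![some 0, some 1] ![none, some 2] ![none, some 2, none]

/-- The opposite coproduct. -/
def comulOp : S.T 1 →ₗ[k] S.T 2 := S.flip ∘ₗ S.comulSym

/-- The topology of pointwise convergence on symbols, with discrete values. -/
instance : TopologicalSpace S.Sym :=
  TopologicalSpace.induced (fun φ c => φ c)
    (@Pi.topologicalSpace (U k M) (fun _ => U k A) (fun _ => ⊥))

/-- The exponential series. -/
def symExp [Algebra ℚ k] (φ : S.Sym) : S.Sym :=
  ∑' j : ℕ, algebraMap ℚ k (1 / (Nat.factorial j : ℚ)) • φ ^ j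

/-- The logarithm `∑ (-1)^j (f - 1)^(j+1) / (j+1)` of a linear map `f : U(M) → U(A)` for the
convolution product. -/
def convLog [Algebra ℚ k] (f : U k M →ₗ[k] U k A) : S.Sym :=
  ∑' j : ℕ, algebraMap ℚ k ((-1) ^ j / ((j : ℚ) + 1)) •
    S.toSym (((WithConv.toConv f - 1) ^ (j + 1) : WithConv (U k M →ₗ[k] U k A)).ofConv)

end LieSplitting

end Legs

/-- The field `ℂ((t))`. -/
def Laurent : Type := LaurentSeries ℂ

namespace Laurent
instance : CommRing Laurent := inferInstanceAs (CommRing (LaurentSeries ℂ))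

instance : Algebra ℂ Laurent := (HahnSeries.instAlgebra : Algebra ℂ (HahnSeries ℤ ℂ))

/-- The `n`-th coefficient. -/
def coeff (n : ℤ) : Laurent →ₗ[ℂ] ℂ where
  toFun a := HahnSeries.coeff a n
  map_add' _ _ := rfl
  map_smul' _ _ := rfl

@[ext] theorem ext {a b : Laurent} (h : ∀ n, coeff n a = coeff n b) : a = b :=
  HahnSeries.ext (funext h)

/-- The monomial `t^n`. -/
def mono (n : ℤ) : Laurent := HahnSeries.single n (1 : ℂ)

/-- `∑ a_n t^n ↦ ∑_{n < 0} a_n t^n`. -/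
def negPart : Laurent →ₗ[ℂ] Laurent where
  toFun a := HahnSeries.truncLT (0 : ℤ) (a : HahnSeries ℤ ℂ)
  map_add' a b := HahnSeries.truncLT_add (0 : ℤ) a b
  map_smul' r a := HahnSeries.truncLT_smul (0 : ℤ) r (a : HahnSeries ℤ ℂ)

theorem coeff_negPart (n : ℤ) (a : Laurent) :
    coeff n (negPart a) = if n < 0 then coeff n a else 0 := rfl

theorem coeff_mul_eq_zero {a b : Laurent} {n : ℤ}
    (h : ∀ i j, i + j = n → coeff i a = 0 ∨ coeff j b = 0) : coeff n (a * b) = 0 := by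
  refine Eq.trans (HahnSeries.coeff_mul (Γ := ℤ) (R := ℂ) (x := a) (y := b) (a := n)) ?_
  refine Finset.sum_eq_zero fun ij hij => ?_
  rcases h ij.1 ij.2 (Finset.mem_antidiagonal.mp hij).2.2 with h1 | h1
  · exact mul_eq_zero_of_left h1 _
  · exact mul_eq_zero_of_right _ h1
end Laurent

section Loop

/-- The base ring `ℂ[[ħ]]`. -/
def Kh : Type := PowerSeries ℂ

instance : CommRing Kh := inferInstanceAs (CommRing (PowerSeries ℂ))

instance : Algebra ℂ Kh := inferInstanceAs (Algebra ℂ (PowerSeries ℂ))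

instance : Algebra ℚ Kh := inferInstanceAs (Algebra ℚ (PowerSeries ℂ))

/-- The formal parameter `ħ`. -/
def hbar : Kh := (PowerSeries.X : PowerSeries ℂ)

variable (𝔤 : Type*) [LieRing 𝔤] [LieAlgebra ℂ 𝔤]

/-- The loop algebra `𝔤(K) = 𝔤 ⊗ ℂ((t))`. -/
def Loop : Type _ := Laurent ⊗[ℂ] 𝔤

instance : LieRing (Loop 𝔤) := inferInstanceAs (LieRing (Laurent ⊗[ℂ] 𝔤))

instance : LieAlgebra ℂ (Loop 𝔤) := inferInstanceAs (LieAlgebra ℂ (Laurent ⊗[ℂ] 𝔤))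

variable {𝔤} in
/-- The element `a ⊗ x` of the loop algebra. -/
def Loop.mk (a : Laurent) (x : 𝔤) : Loop 𝔤 := a ⊗ₜ[ℂ] x

variable {𝔤} in
theorem Loop.lie_mk (a b : Laurent) (x y : 𝔤) :
    ⁅Loop.mk a x, Loop.mk b y⁆ = Loop.mk (a * b) ⁅x, y⁆ := rfl

variable {𝔤} in
theorem Loop.induction {p : Loop 𝔤 → Prop} (zero : p 0) (add : ∀ v w, p v → p w → p (v + w))
    (mk : ∀ a x, p (Loop.mk a x)) (w : Loop 𝔤) : p w :=
  TensorProduct.induction_on (R := ℂ) (M := Laurent) (N := 𝔤) w zero mk add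

/-- The linear map `a ⊗ x ↦ f(a) ⊗ x`. -/
def Loop.map (f : Laurent →ₗ[ℂ] Laurent) : Loop 𝔤 →ₗ[ℂ] Loop 𝔤 :=
  (f.rTensor 𝔤 : Laurent ⊗[ℂ] 𝔤 →ₗ[ℂ] Laurent ⊗[ℂ] 𝔤)

@[simp] theorem Loop.map_mk (f : Laurent →ₗ[ℂ] Laurent) (a : Laurent) (x : 𝔤) :
    Loop.map 𝔤 f (Loop.mk a x) = Loop.mk (f a) x := rfl

variable {𝔤} in
theorem Loop.sub_mk (a b : Laurent) (x : 𝔤) :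
    Loop.mk (a - b) x = Loop.mk a x - Loop.mk b x :=
  TensorProduct.sub_tmul (R := ℂ) a b x

variable {𝔤} in
@[simp] theorem Loop.zero_mk (x : 𝔤) : Loop.mk 0 x = 0 :=
  TensorProduct.zero_tmul (R := ℂ) Laurent x

/-- The Lie algebra `𝔤(K)` with scalars extended to `ℂ[[ħ]]`. -/
abbrev LoopH : Type _ := Kh ⊗[ℂ] Loop 𝔤

/-- `t^N 𝔤[[t]]`. -/
def loopGe (N : ℕ) : Submodule ℂ (Loop 𝔤) :=
  Submodule.span ℂ {w | ∃ (a : Laurent) (x : 𝔤), (∀ n < (N : ℤ), Laurent.coeff n a = 0) ∧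
    w = Loop.mk a x}

variable {𝔤} in
theorem lie_mem_span {P : Laurent → Prop} (hP : ∀ a b, P a → P b → P (a * b))
    {v w : Loop 𝔤} (hv : v ∈ Submodule.span ℂ {w : Loop 𝔤 | ∃ a x, P a ∧ w = Loop.mk a x})
    (hw : w ∈ Submodule.span ℂ {w : Loop 𝔤 | ∃ a x, P a ∧ w = Loop.mk a x}) :
    ⁅v, w⁆ ∈ Submodule.span ℂ {w : Loop 𝔤 | ∃ a x, P a ∧ w = Loop.mk a x} := by
  induction hv, hw using Submodule.span_induction₂ with
  | mem_mem v w hv hw =>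
    obtain ⟨a, x, ha, rfl⟩ := hv
    obtain ⟨b, y, hb, rfl⟩ := hw
    exact Submodule.subset_span ⟨a * b, ⁅x, y⁆, hP a b ha hb, by
      rw [Loop.lie_mk]⟩
  | zero_left w hw => simp
  | zero_right v hv => simp
  | add_left u v w _ _ _ hu hv => rw [add_lie]; exact add_mem hu hv
  | add_right u v w _ _ _ hu hv => rw [lie_add]; exact add_mem hu hv
  | smul_left r v w _ _ h => rw [smul_lie]; exact Submodule.smul_mem _ _ h
  | smul_right r v w _ _ h => rw [lie_smul]; exact Submodule.smul_mem _ _ h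

/-- The subalgebra `𝔤(O) = 𝔤[[t]]`. -/
def loopO : LieSubalgebra ℂ (Loop 𝔤) :=
  { loopGe 𝔤 0 with
    lie_mem' := fun {v w} hv hw => lie_mem_span
      (P := fun a => ∀ n < ((0 : ℕ) : ℤ), Laurent.coeff n a = 0) (fun a b ha hb n hn => by
      push_cast at ha hb hn
      refine Laurent.coeff_mul_eq_zero fun i j h => ?_
      rcases lt_or_ge i 0 with h1 | h1
      · exact Or.inl (ha _ h1)
      · exact Or.inr (hb _ (by omega))) hv hw }

/-- The subalgebra `𝔤_{<0} = t⁻¹ 𝔤[t⁻¹]`. -/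
def loopNeg : LieSubalgebra ℂ (Loop 𝔤) :=
  { Submodule.span ℂ {w : Loop 𝔤 | ∃ (a : Laurent) (x : 𝔤),
      (∀ n, 0 ≤ n → Laurent.coeff n a = 0) ∧ w = Loop.mk a x} with
    lie_mem' := fun {v w} hv hw => lie_mem_span
      (P := fun a => ∀ n, 0 ≤ n → Laurent.coeff n a = 0) (fun a b ha hb n hn => by
      refine Laurent.coeff_mul_eq_zero fun i j h => ?_
      rcases lt_or_ge i 0 with h1 | h1
      · exact Or.inr (hb _ (by omega))
      · exact Or.inl (ha _ h1)) hv hw }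

/-- The projection `𝔤(K) → 𝔤_{<0}` along `𝔤(O)`. -/
def truncNeg : Loop 𝔤 →ₗ[ℂ] Loop 𝔤 := Loop.map 𝔤 Laurent.negPart

theorem truncNeg_mem (w : Loop 𝔤) : truncNeg 𝔤 w ∈ loopNeg 𝔤 := by
  induction w using Loop.induction with
  | zero => simp
  | add v w hv hw => rw [map_add]; exact add_mem hv hw
  | mk a x =>
    exact Submodule.subset_span ⟨_, x, fun n hn => by simp [Laurent.coeff_negPart, not_lt.mpr hn], rfl⟩

theorem sub_truncNeg_mem (w : Loop 𝔤) : w - truncNeg 𝔤 w ∈ loopO 𝔤 := by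
  induction w using Loop.induction with
  | zero => simp
  | add v w hv hw => rw [map_add, add_sub_add_comm]; exact add_mem hv hw
  | mk a x =>
    refine Submodule.subset_span ⟨a - Laurent.negPart a, x,
      fun n hn => ?_, by simp [truncNeg, Loop.sub_mk]⟩
    have hn' : n < 0 := by simpa using hn
    simp [Laurent.coeff_negPart, hn']

theorem truncNeg_of_mem_neg {w : Loop 𝔤} (hw : w ∈ loopNeg 𝔤) : truncNeg 𝔤 w = w := by
  change w ∈ Submodule.span ℂ _ at hw
  induction hw using Submodule.span_induction with
  | mem w h =>
    obtain ⟨a, x, ha, rfl⟩ := h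
    have : Laurent.negPart a = a := by
      ext n
      rcases lt_or_ge n 0 with h | h
      · simp [Laurent.coeff_negPart, h]
      · simp [Laurent.coeff_negPart, ha n h]
    simp [truncNeg, this]
  | zero => simp
  | add v w _ _ hv hw => rw [map_add, hv, hw]
  | smul r v _ h => rw [map_smul, h]

theorem truncNeg_of_mem_O {w : Loop 𝔤} (hw : w ∈ loopO 𝔤) : truncNeg 𝔤 w = 0 := by
  change w ∈ Submodule.span ℂ _ at hw
  induction hw using Submodule.span_induction with
  | mem w h =>
    obtain ⟨a, x, ha, rfl⟩ := h
    have : Laurent.negPart a = 0 := by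
      ext n
      rcases lt_or_ge n 0 with h | h
      · simp [ha n (by simpa using h), Laurent.coeff_negPart]
      · simp [Laurent.coeff_negPart, not_lt.mpr h]
    simp [truncNeg, this]
  | zero => simp
  | add v w _ _ hv hw => rw [map_add, hv, hw, add_zero]
  | smul r v _ h => rw [map_smul, h, smul_zero]

/-- `ħ H[[ħ]]` for a subalgebra `H` of `𝔤(K)`. -/
def hbarPart (H : LieSubalgebra ℂ (Loop 𝔤)) : LieSubalgebra Kh (LoopH 𝔤) :=
  { Submodule.span Kh {w : LoopH 𝔤 | ∃ h ∈ H, w = hbar ⊗ₜ h} with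
    lie_mem' := fun {v w} hv hw => by
      change v ∈ Submodule.span Kh _ at hv
      change w ∈ Submodule.span Kh _ at hw
      change ⁅v, w⁆ ∈ Submodule.span Kh _
      induction hv, hw using Submodule.span_induction₂ with
      | mem_mem v w hv hw =>
        obtain ⟨x, hx, rfl⟩ := hv
        obtain ⟨y, hy, rfl⟩ := hw
        have : ⁅hbar ⊗ₜ[ℂ] x, hbar ⊗ₜ[ℂ] y⁆ = hbar • (hbar ⊗ₜ[ℂ] ⁅x, y⁆) := by
          rw [LieAlgebra.ExtendScalars.bracket_tmul, smul_tmul', smul_eq_mul]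
        rw [this]
        exact Submodule.smul_mem _ _ (Submodule.subset_span ⟨_, H.lie_mem hx hy, rfl⟩)
      | zero_left w hw => simp
      | zero_right v hv => simp
      | add_left u v w _ _ _ hu hv => rw [add_lie]; exact add_mem hu hv
      | add_right u v w _ _ _ hu hv => rw [lie_add]; exact add_mem hu hv
      | smul_left r v w _ _ h => rw [smul_lie]; exact Submodule.smul_mem _ _ h
      | smul_right r v w _ _ h => rw [lie_smul]; exact Submodule.smul_mem _ _ h }

theorem hbarPart_induction {H : LieSubalgebra ℂ (Loop 𝔤)} {p : LoopH 𝔤 → Prop}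
    (zero : p 0) (add : ∀ v w, p v → p w → p (v + w)) (smul : ∀ (r : Kh) v, p v → p (r • v))
    (mem : ∀ h ∈ H, p (hbar ⊗ₜ h)) {w : LoopH 𝔤} (hw : w ∈ hbarPart 𝔤 H) : p w := by
  change w ∈ Submodule.span Kh _ at hw
  induction hw using Submodule.span_induction with
  | mem w h => obtain ⟨x, hx, rfl⟩ := h; exact mem x hx
  | zero => exact zero
  | add v w _ _ hv hw => exact add v w hv hw
  | smul r v _ h => exact smul r v h

/-- The `ℂ[[ħ]]`-linear projection to `𝔤_{<0}`. -/
def projNeg : LoopH 𝔤 →ₗ[Kh] LoopH 𝔤 := (truncNeg 𝔤).baseChange Kh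

/-- The `ℂ[[ħ]]`-linear projection to `𝔤(O)`. -/
def projPos : LoopH 𝔤 →ₗ[Kh] LoopH 𝔤 := LinearMap.id - projNeg 𝔤

theorem projNeg_mem (z : LoopH 𝔤) : projNeg 𝔤 (hbar • z) ∈ hbarPart 𝔤 (loopNeg 𝔤) := by
  induction z using TensorProduct.induction_on with
  | zero => simp
  | add v w hv hw => rw [smul_add, map_add]; exact add_mem hv hw
  | tmul f w =>
    have : projNeg 𝔤 (hbar • (f ⊗ₜ w)) = f • (hbar ⊗ₜ[ℂ] truncNeg 𝔤 w) := by
      simp [projNeg, smul_tmul', mul_comm]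
    rw [this]
    exact Submodule.smul_mem _ _ (Submodule.subset_span ⟨_, truncNeg_mem 𝔤 w, rfl⟩)

theorem projPos_mem (z : LoopH 𝔤) : projPos 𝔤 (hbar • z) ∈ hbarPart 𝔤 (loopO 𝔤) := by
  induction z using TensorProduct.induction_on with
  | zero => simp
  | add v w hv hw => rw [smul_add, map_add]; exact add_mem hv hw
  | tmul f w =>
    have : projPos 𝔤 (hbar • (f ⊗ₜ w)) = f • (hbar ⊗ₜ[ℂ] (w - truncNeg 𝔤 w)) := by
      simp [projPos, projNeg, smul_tmul', mul_comm, tmul_sub, smul_sub]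
    rw [this]
    exact Submodule.smul_mem _ _ (Submodule.subset_span ⟨_, sub_truncNeg_mem 𝔤 w, rfl⟩)

theorem projNeg_of_mem_neg {w : LoopH 𝔤} (hw : w ∈ hbarPart 𝔤 (loopNeg 𝔤)) :
    projNeg 𝔤 w = w := by
  refine hbarPart_induction 𝔤 (p := fun w => projNeg 𝔤 w = w) ?_ ?_ ?_ ?_ hw
  · simp
  · intro v w hv hw
    rw [map_add, hv, hw]
  · intro r v h
    rw [map_smul, h]
  · intro h hh
    simp [projNeg, truncNeg_of_mem_neg 𝔤 hh]

theorem projNeg_of_mem_O {w : LoopH 𝔤} (hw : w ∈ hbarPart 𝔤 (loopO 𝔤)) :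
    projNeg 𝔤 w = 0 := by
  refine hbarPart_induction 𝔤 (p := fun w => projNeg 𝔤 w = 0) ?_ ?_ ?_ ?_ hw
  · simp
  · intro v w hv hw
    rw [map_add, hv, hw, add_zero]
  · intro r v h
    rw [map_smul, h, smul_zero]
  · intro h hh
    simp [projNeg, truncNeg_of_mem_O 𝔤 hh]

theorem hbarPart_dvd {H : LieSubalgebra ℂ (Loop 𝔤)} {w : LoopH 𝔤} (hw : w ∈ hbarPart 𝔤 H) :
    ∃ z, w = hbar • z := by
  refine hbarPart_induction 𝔤 (p := fun w => ∃ z, w = hbar • z) ?_ ?_ ?_ ?_ hw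
  · exact ⟨0, by simp⟩
  · intro v w hv hw
    obtain ⟨a, rfl⟩ := hv
    obtain ⟨b, rfl⟩ := hw
    exact ⟨a + b, by simp⟩
  · intro r v h
    obtain ⟨a, rfl⟩ := h
    exact ⟨r • a, smul_comm _ _ _⟩
  · intro h hh
    exact ⟨1 ⊗ₜ h, by simp [smul_tmul']⟩

/-- The Lie algebra `diag(𝔤(K))[[ħ]] ⊕ ħ (𝔤(O) × 𝔤_{<0})[[ħ]]`, that is, the pairs in
`𝔤(K)[[ħ]] × 𝔤(K)[[ħ]]` which are congruent modulo `ħ`. -/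
def PairH : LieSubalgebra Kh (LoopH 𝔤 × LoopH 𝔤) where
  carrier := {v | ∃ z, v.1 - v.2 = hbar • z}
  add_mem' := by
    rintro v w ⟨a, ha⟩ ⟨b, hb⟩
    exact ⟨a + b, by rw [smul_add, ← ha, ← hb, Prod.fst_add, Prod.snd_add]; abel⟩
  zero_mem' := ⟨0, by simp⟩
  smul_mem' := by
    rintro r v ⟨a, ha⟩
    exact ⟨r • a, by rw [smul_comm, ← ha, smul_sub, Prod.smul_fst, Prod.smul_snd]⟩
  lie_mem' := by
    rintro v w ⟨a, ha⟩ ⟨b, hb⟩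
    refine ⟨⁅a, w.1⁆ + ⁅v.2, b⁆, ?_⟩
    rw [smul_add, ← smul_lie, ← lie_smul, ← ha, ← hb, sub_lie, lie_sub]
    exact (sub_add_sub_cancel _ _ _).symm

variable {𝔤} in
theorem PairH.coe_add (v w : PairH 𝔤) :
    ((v + w : PairH 𝔤) : LoopH 𝔤 × LoopH 𝔤) = (v : LoopH 𝔤 × LoopH 𝔤) + w := rfl

variable {𝔤} in
theorem PairH.coe_smul (r : Kh) (v : PairH 𝔤) :
    ((r • v : PairH 𝔤) : LoopH 𝔤 × LoopH 𝔤) = r • (v : LoopH 𝔤 × LoopH 𝔤) := rfl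

/-- The subalgebra `𝔤(O) × 𝔤_{<0}` scaled by `ħ`; its exponentials are the `e^{ħ y}`. -/
abbrev MinusH : Type _ := hbarPart 𝔤 (loopO 𝔤) × hbarPart 𝔤 (loopNeg 𝔤)

/-- The decomposition `𝔤(K) × 𝔤(K) = diag(𝔤(K)) ⊕ (𝔤(O) × 𝔤_{<0})`, with the second summand
scaled by `ħ`. -/
def dySplitting : LieSplitting Kh (LoopH 𝔤) (MinusH 𝔤) (PairH 𝔤) where
  inA :=
    { toFun := fun a => ⟨(a, a), 0, by simp⟩
      map_add' := fun a b => rfl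
      map_smul' := fun r a => rfl
      map_lie' := rfl }
  inM :=
    { toFun := fun v => ⟨(v.1, v.2), by
        obtain ⟨a, ha⟩ := hbarPart_dvd 𝔤 v.1.2
        obtain ⟨b, hb⟩ := hbarPart_dvd 𝔤 v.2.2
        exact ⟨a - b, by rw [smul_sub, ← ha, ← hb]⟩⟩
      map_add' := fun a b => rfl
      map_smul' := fun r a => rfl
      map_lie' := rfl }
  prA :=
    { toFun := fun v => v.1.1 - projPos 𝔤 (v.1.1 - v.1.2)
      map_add' := fun v w => by
        simp only [PairH.coe_add, Prod.fst_add, Prod.snd_add, map_sub, map_add]; abel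
      map_smul' := fun r v => by
        simp only [PairH.coe_smul, Prod.smul_fst, Prod.smul_snd, map_sub, map_smul,
          smul_sub, RingHom.id_apply] }
  prM :=
    { toFun := fun v =>
        (⟨projPos 𝔤 (v.1.1 - v.1.2), by
          obtain ⟨z, hz⟩ := v.2
          rw [hz]
          exact projPos_mem 𝔤 z⟩,
        ⟨- projNeg 𝔤 (v.1.1 - v.1.2), by
          obtain ⟨z, hz⟩ := v.2
          rw [hz]
          exact neg_mem (projNeg_mem 𝔤 z)⟩)
      map_add' := fun v w => by
        refine Prod.ext (Subtype.ext ?_) (Subtype.ext ?_)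
        · change projPos 𝔤 ((v.1.1 + w.1.1) - (v.1.2 + w.1.2))
            = projPos 𝔤 (v.1.1 - v.1.2) + projPos 𝔤 (w.1.1 - w.1.2)
          rw [add_sub_add_comm, map_add]
        · change - projNeg 𝔤 ((v.1.1 + w.1.1) - (v.1.2 + w.1.2))
            = - projNeg 𝔤 (v.1.1 - v.1.2) + - projNeg 𝔤 (w.1.1 - w.1.2)
          rw [add_sub_add_comm, map_add, neg_add]
      map_smul' := fun r v => by
        refine Prod.ext (Subtype.ext ?_) (Subtype.ext ?_)
        · change projPos 𝔤 (r • v.1.1 - r • v.1.2) = r • projPos 𝔤 (v.1.1 - v.1.2)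
          rw [← smul_sub, map_smul]
        · change - projNeg 𝔤 (r • v.1.1 - r • v.1.2) = r • - projNeg 𝔤 (v.1.1 - v.1.2)
          rw [← smul_sub, map_smul, smul_neg] }
  prA_inA a := by simp
  prM_inM v := by
    refine Prod.ext (Subtype.ext ?_) (Subtype.ext ?_)
    · simp [projPos, projNeg_of_mem_O 𝔤 v.1.2, projNeg_of_mem_neg 𝔤 v.2.2]
    · simp [projNeg_of_mem_O 𝔤 v.1.2, projNeg_of_mem_neg 𝔤 v.2.2]
  prA_inM v := by
    simp [projPos, projNeg_of_mem_O 𝔤 v.1.2, projNeg_of_mem_neg 𝔤 v.2.2]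
  prM_inA a := by
    refine Prod.ext (Subtype.ext ?_) (Subtype.ext ?_) <;> simp
  sum_pr v := by
    refine Subtype.ext (Prod.ext ?_ ?_)
    · simp
    · simp [projPos]
      abel

/-- `DYpow 𝔤 n` is the algebra of all linear maps `U(ħ(𝔤(O) × 𝔤_{<0})^n) → U(𝔤(K)^n)[[ħ]]`
(before `ħ`-adic completion), which plays the role of the completed `n`-th tensor power of the
double Yangian. -/
abbrev DYpow (n : ℕ) : Type _ := (dySplitting 𝔤).T n

/-- The canonical element `ħ γ_<`: the logarithm of the map of formal groups with values in
`exp(𝔤(O)) × 1` which is induced by the projection `(y₁, y₂) ↦ ((y₂)_{≥ 0}, 0)`. -/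
def hbarGamma : DYpow 𝔤 2 :=
  ((dySplitting 𝔤).pow 2).convLog (mapU (piHom
    ![(hbarPart 𝔤 (loopO 𝔤)).incl.comp ((LieHom.fst Kh _ _).comp (projHom 1)), 0])).toLinearMap

/-- The canonical element `ħ γ_<^{21}`: the logarithm of the map of formal groups with values in
`1 × exp(𝔤_{<0})` which is induced by the projection `(y₁, y₂) ↦ (0, (y₁)_{< 0})`. -/
def hbarGamma21 : DYpow 𝔤 2 :=
  ((dySplitting 𝔤).pow 2).convLog (mapU (piHom
    ![0, (hbarPart 𝔤 (loopNeg 𝔤)).incl.comp ((LieHom.snd Kh _ _).comp (projHom 0))])).toLinearMap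

/-- `exp(f)` for elements `f` of the completed tensor powers of the double Yangian. -/
def dyExp {n : ℕ} (φ : DYpow 𝔤 n) : DYpow 𝔤 n := ((dySplitting 𝔤).pow n).symExp φ

/-- The universal R-matrix `R = exp(ħ γ_<^{21}) exp(-ħ γ_<)`. -/
def Rmat : DYpow 𝔤 2 := dyExp 𝔤 (hbarGamma21 𝔤) * dyExp 𝔤 (-hbarGamma 𝔤)

/-- Conjugation `a ↦ R a R⁻¹` by an invertible element. -/
def conjBy {n : ℕ} (R : DYpow 𝔤 n) : DYpow 𝔤 n →ₗ[Kh] DYpow 𝔤 n :=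
  LinearMap.mulLeft Kh R ∘ₗ LinearMap.mulRight Kh (Ring.inverse R)

/-- The ideal generated by `ħ`. -/
def hbarIdeal : Ideal Kh := Ideal.span {hbar}

/-- The `ħ`-adic completion of `DYpow 𝔤 n`: the linear maps
`U(ħ(𝔤(O) × 𝔤_{<0})^n) → U(𝔤(K)^n)[[ħ]]`. -/
abbrev DYhat (n : ℕ) : Type _ := AdicCompletion hbarIdeal (DYpow 𝔤 n)

/-- The coproduct `Δ`. -/
def dyComul : DYpow 𝔤 1 →ₗ[Kh] DYpow 𝔤 2 := (dySplitting 𝔤).comulSym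

/-- The opposite coproduct. -/
def dyComulOp : DYpow 𝔤 1 →ₗ[Kh] DYpow 𝔤 2 := (dySplitting 𝔤).comulOp

/-- `ħ t^N 𝔤[[t]]` inside `ħ 𝔤(O)`. -/
def hbarGe (N : ℕ) : Submodule Kh (hbarPart 𝔤 (loopO 𝔤)) :=
  Submodule.span Kh {w | ∃ h ∈ loopGe 𝔤 N, (w : LoopH 𝔤) = hbar ⊗ₜ h}

/-- Membership in the `ħ`-extended topological dual `(U(𝔤(O)) ⊗ U(𝔤_{<0}))^*[[ħ]]`: modulo every
power of `ħ`, the functional is `t`-adically continuous in the arguments from `𝔤(O)`. -/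
def IsContinuousFunctional (F : U Kh (Fin 1 → MinusH 𝔤) →ₗ[Kh] Kh) : Prop :=
  ∀ (N D : ℕ) (b : U Kh (hbarPart 𝔤 (loopNeg 𝔤))), ∃ T : ℕ,
    ∀ l : List (hbarPart 𝔤 (loopO 𝔤)), l.length = D → (∃ y ∈ l, y ∈ hbarGe 𝔤 T) →
      hbar ^ N ∣ F (mapU (piHom fun _ => LieHom.inl Kh _ _) (l.map (gen Kh)).prod *
        mapU (piHom fun _ => LieHom.inr Kh _ _) b)

/-- The span of the products `F u` with `u ∈ U(𝔤(K))` and `F ∈ (U(𝔤(O)) ⊗ U(𝔤_{<0}))^*[[ħ]]`. -/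
def dySpan : Submodule Kh (DYpow 𝔤 1) :=
  Submodule.span Kh {φ | ∃ (F : U Kh (Fin 1 → MinusH 𝔤) →ₗ[Kh] Kh) (u : U Kh (Fin 1 → LoopH 𝔤)),
    IsContinuousFunctional 𝔤 F ∧ φ = ((dySplitting 𝔤).pow 1).toSym (F.smulRight u)}

/-- The double Yangian `U(𝔤(K))[[ħ]] ⋉ (U(𝔤(O)) ⊗ U(𝔤_{<0}))^*[[ħ]]`, as the `ħ`-adic closure of
`dySpan`. -/
def doubleYangian : Submodule Kh (DYhat 𝔤 1) :=
  ⨅ N : ℕ, ((dySpan 𝔤).map (Submodule.mkQ (hbarIdeal ^ N • ⊤ : Submodule Kh (DYpow 𝔤 1)))).comap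
    (AdicCompletion.eval hbarIdeal (DYpow 𝔤 1) N)

/-- The element `x ∈ 𝔤(K)[[ħ]]` of the double Yangian. -/
def dyElem (x : LoopH 𝔤) : DYpow 𝔤 1 :=
  ((dySplitting 𝔤).pow 1).toSym ((Coalgebra.counit (R := Kh)).smulRight (gen Kh fun _ => x))

/-- The projection `((p₁, m₁), (p₂, m₂)) ↦ ((0, m₁), (p₂, 0))` of `(𝔤(O) × 𝔤_{<0})²`. -/
def crossHom : (Fin 2 → MinusH 𝔤) →ₗ⁅Kh⁆ (Fin 2 → MinusH 𝔤) :=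
  piHom ![(LieHom.inr Kh _ _).comp ((LieHom.snd Kh _ _).comp (projHom 0)),
    (LieHom.inl Kh _ _).comp ((LieHom.fst Kh _ _).comp (projHom 1))]

variable {𝔤} in
/-- The element `x ∈ 𝔤(K)[[ħ]]` in the leg `i` of `U(𝔤(K)²)[[ħ]]`. -/
def legElem (i : Fin 2) (x : LoopH 𝔤) : U Kh (Fin 2 → LoopH 𝔤) :=
  gen Kh (Pi.single (M := fun _ => LoopH 𝔤) i x)

/-- Membership in the completed tensor product of `Y = U(𝔤(O))[[ħ]] ⋉ U(𝔤_{<0})^*[[ħ]]` and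
`Y^* = U(𝔤_{<0})[[ħ]] ⋉ U(𝔤(O))^*[[ħ]]`. -/
def InYangianTensorDual (φ : DYpow 𝔤 2) : Prop :=
  ∀ e : U Kh (Fin 2 → MinusH 𝔤), φ e = φ (mapU (crossHom 𝔤) e) ∧
    φ e ∈ Algebra.adjoin Kh
      ({u | ∃ h ∈ loopO 𝔤, u = legElem 0 (1 ⊗ₜ h)} ∪
        {u | ∃ h ∈ loopNeg 𝔤, u = legElem 1 (1 ⊗ₜ h)})

variable {ι : Type*} (b : Module.Basis ι ℂ 𝔤)

variable {𝔤} in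
/-- `I_{α,n} = I_α ⊗ t^n`, for a basis `I_α` of `𝔤`. -/
def basisElem (α : ι) (n : ℤ) : LoopH 𝔤 := 1 ⊗ₜ Loop.mk (Laurent.mono n) (b α)

variable {𝔤} in
/-- The coordinate function of `I_{α,n}` on `𝔤(K)[[ħ]]`. Under the residue pairing of
`𝔤^*(K)` and `𝔤(K)`, this is `I^α_{-n-1} = I^α ⊗ t^{-n-1}`. -/
def coordFun (α : ι) (n : ℤ) : LoopH 𝔤 →ₗ[Kh] Kh :=
  (TensorProduct.AlgebraTensorModule.rid ℂ Kh Kh).toLinearMap ∘ₗ LinearMap.baseChange Kh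
    (TensorProduct.lift (LinearMap.mul ℂ ℂ) ∘ₗ
      TensorProduct.map (Laurent.coeff n) (b.coord α) : Laurent ⊗[ℂ] 𝔤 →ₗ[ℂ] ℂ)

variable {𝔤} in
/-- `F` is the linear function `f` on `𝔤(O) × 𝔤_{<0}`, considered as a function on the formal group:
`F(e^{ħ y}) = f(y)`. As the elements of `MinusH` are the `ħ y`, this reads as
`ħ F(w^j) = δ_{j,1} f(w)`. -/
def IsLogCoordinate (F : U Kh (MinusH 𝔤) →ₗ[Kh] Kh) (f : MinusH 𝔤 →ₗ[Kh] Kh) : Prop :=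
  ∀ (w : MinusH 𝔤) (j : ℕ), hbar * F (gen Kh w ^ j) = if j = 1 then f w else 0

variable {𝔤} in
/-- The function `I^α_{-n-1}` with `n ≥ 0`: a coordinate function on `𝔤(O)`. -/
def coordO (α : ι) (n : ℕ) : MinusH 𝔤 →ₗ[Kh] Kh :=
  coordFun b α n ∘ₗ ((hbarPart 𝔤 (loopO 𝔤)).incl : _ →ₗ[Kh] LoopH 𝔤) ∘ₗ LinearMap.fst Kh _ _

variable {𝔤} in
/-- The function `I^α_n` with `n ≥ 0`: a coordinate function on `𝔤_{<0}`. -/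
def coordNeg (α : ι) (n : ℕ) : MinusH 𝔤 →ₗ[Kh] Kh :=
  coordFun b α (-n - 1) ∘ₗ ((hbarPart 𝔤 (loopNeg 𝔤)).incl : _ →ₗ[Kh] LoopH 𝔤) ∘ₗ
    LinearMap.snd Kh _ _

end Loop

end DoubleYangian

end

open DoubleYangian

/-! The identities are proved on points of formal groups. A morphism of coalgebras from a
cocommutative coalgebra `C` to `U(L)` is a `C`-valued point of exp(L). Such points form a group
under convolution, and the factorization `fact` of `U(L)` as `U(A) ⊗ U(M)` writes each point
uniquely as a point of `A` times a point of `M`. So κg = (κ▷g)(κ◁g) is an identity between elements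
of a group, and the rules for ▷ and ◁ follow from associativity and uniqueness. Symbols that come
from points multiply by (RT)(κ) = R(κ) T(κ ◁ R(κ)) (`ofPt_mul_ofPt`), so an identity between
products of such symbols becomes an identity in a group, checked leg by leg.

Let P = ħ𝔤(O) and N = ħ𝔤_{<0}, and write κ = (κ_P, κ_N). The two projections of κg = (κ▷g)(κ◁g) give
(κ▷g)(κ◁g)_P = κ_P g and (κ▷g)(κ◁g)_N = κ_N g (`dress_mul_pl`, `dress_mul_mi`). The symbols ħγ_< and
ħγ_<^{21} take values in one leg and depend only on the other, so their powers in the smash product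
are convolution powers, and exp and log behave as for power series in one variable. Hence exp(ħγ_<)
is (x, y) ↦ (y_P, 1), exp(ħγ_<^{21}) is (x, y) ↦ (1, x_N), and R is (x, y) ↦ ((y ◁ x_N)_P⁻¹, x_N)
(`rSym_eq`).

The central computation refactors y_P x_N = n'p' with n' in exp(N) and p' in exp(P). It shows y ▷
x_N = n' and (y ◁ x_N)_P = p'. Translation by R sends (x, y) to a pair (x', y') with x'_N = n' and
x'y' = yx (`mi_act_inv`, `act_inv_mul_act`). The relation x'y' = yx is the intertwining property on
functions. Together with the two projection formulas it also gives the intertwining property for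
values in U(𝔤(K)), both coproduct formulas for R, and the Yang-Baxter equation. As n' and p' involve
only x_N and y_P, R lies in the tensor product of the Yangian and its dual.

Two devices pass from points to linear maps. Over a ℚ-algebra the powers wⁿ span U(L), so linear
maps are compared on them; this handles exp, log and the coordinate expansions of γ. A general
symbol φ is not a point, but Δ(φ) has the form c ↦ Φ(c₁ ⊗ l(c₂)) with Φ a universal point and all of
φ contained in the linear map l (`twisted`). The group identities are then applied to Φ, and l only
undergoes a substitution. The intertwining relation is thus an equality of linear maps, and it
extends to the ħ-adic completion by functoriality. -/

noncomputable section

namespace DoubleYangian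

/-! ### Points of formal groups as coalgebra morphisms into enveloping algebras -/

section Points

variable {k : Type*} [CommRing k]

/-- The morphism `c ↦ f(c₁) ⊗ g(c₂)` of coalgebras. -/
def pairHom {C D E : Type*} [AddCommMonoid C] [Module k C] [Coalgebra k C]
    [Coalgebra.IsCocomm k C] [AddCommMonoid D] [Module k D] [Coalgebra k D]
    [AddCommMonoid E] [Module k E] [Coalgebra k E] (f : C →ₗc[k] D) (g : C →ₗc[k] E) :
    C →ₗc[k] D ⊗[k] E :=
  (Coalgebra.TensorProduct.map f g).comp (Coalgebra.comulCoalgHom k C)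

section

variable {L : Type*} [LieRing L] [LieAlgebra k L]

/-- The antipode reverses the coproduct in general; here the coproduct is cocommutative, so the
antipode is a coalgebra morphism and inverses of points are again points. -/
theorem comul_antipodeU (a : U k L) : Coalgebra.comul (R := k) (antipodeU a)
    = TensorProduct.map antipodeU antipodeU (Coalgebra.comul (R := k) a) := by
  induction a using U_induction with
  | zero => simp
  | one => simp [antipodeU_one, Algebra.TensorProduct.one_def]
  | add a b ha hb => simp only [map_add, ha, hb]
  | smul r a ha => simp only [map_smul, ha]
  | mul a x ha =>
    rw [antipodeU_mul_gen, map_neg, Bialgebra.comul_mul, ha, Bialgebra.comul_mul, comul_gen]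
    generalize Coalgebra.comul (R := k) a = z
    induction z using TensorProduct.induction_on with
    | zero => simp
    | add z w hz hw => 
      rw [map_add, mul_add (gen k x ⊗ₜ[k] (1 : U k L) + 1 ⊗ₜ[k] gen k x), add_mul z w, neg_add,
        hz, hw, map_add]
    | tmul b c => simp [mul_add, add_mul, antipodeU_mul_gen, neg_tmul, tmul_neg]; abel

/-- The antipode as a morphism of coalgebras. -/
def antipodeCoalgHom (k L : Type*) [CommRing k] [LieRing L] [LieAlgebra k L] :
    U k L →ₗc[k] U k L where
  toLinearMap := antipodeU
  counit_comp := HopfAlgebra.counit_comp_antipode (A := U k L)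
  map_comp_comul := by
    ext a
    exact (comul_antipodeU a).symm

/-- A homomorphism of Lie algebras as a morphism of coalgebras. -/
def mapC {L' : Type*} [LieRing L'] [LieAlgebra k L'] (f : L →ₗ⁅k⁆ L') : U k L →ₗc[k] U k L' where
  toLinearMap := (mapU f).toLinearMap
  counit_comp := by
    ext a
    exact counit_mapU f a
  map_comp_comul := by
    ext a
    exact (comul_mapU f a).symm

@[simp] theorem mapC_apply {L' : Type*} [LieRing L'] [LieAlgebra k L'] (f : L →ₗ⁅k⁆ L')
    (a : U k L) : mapC f a = mapU f a := rfl

theorem mapU_comp {L' L'' : Type*} [LieRing L'] [LieAlgebra k L'] [LieRing L'']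
    [LieAlgebra k L''] (g : L' →ₗ⁅k⁆ L'') (f : L →ₗ⁅k⁆ L') :
    mapU (g.comp f) = (mapU g : U k L' →ₐ[k] U k L'').comp (mapU f) :=
  algHom_extU fun x => by simp

theorem mapU_id : mapU (LieHom.id : L →ₗ⁅k⁆ L) = AlgHom.id k (U k L) :=
  algHom_extU fun x => by simp

theorem mapU_zero_apply {L' : Type*} [LieRing L'] [LieAlgebra k L'] (a : U k L) :
    mapU (0 : L →ₗ⁅k⁆ L') a = algebraMap k (U k L') (Coalgebra.counit (R := k) a) := by
  have h : mapU (0 : L →ₗ⁅k⁆ L') = (Algebra.ofId k (U k L')).comp counitU :=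
    algHom_extU fun x => by simp
  exact congrArg (fun g : U k L →ₐ[k] U k L' => g a) h

end

/-- The points of the formal group of `L` over a coalgebra `C`: the morphisms of coalgebras
`C → U(L)`. -/
def Pt (k C L : Type*) [CommRing k] [AddCommMonoid C] [Module k C] [Coalgebra k C] [LieRing L]
    [LieAlgebra k L] : Type _ := C →ₗc[k] U k L

namespace Pt

variable {C D : Type*} [AddCommMonoid C] [Module k C] [Coalgebra k C]
  [AddCommMonoid D] [Module k D] [Coalgebra k D]
  {L : Type*} [LieRing L] [LieAlgebra k L] {L' : Type*} [LieRing L'] [LieAlgebra k L']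
  {L'' : Type*} [LieRing L''] [LieAlgebra k L'']

/-- The underlying morphism of coalgebras. -/
def hom (g : Pt k C L) : C →ₗc[k] U k L := g

/-- A morphism of coalgebras as a point. -/
def of (g : C →ₗc[k] U k L) : Pt k C L := g

@[simp] theorem hom_of (g : C →ₗc[k] U k L) : (of g).hom = g := rfl

@[ext] theorem ext {g h : Pt k C L} (H : ∀ c, g.hom c = h.hom c) : g = h := CoalgHom.ext H

/-- A point as an element of the convolution algebra. -/
def conv (g : Pt k C L) : WithConv (C →ₗ[k] U k L) := WithConv.toConv (g.hom : C →ₗ[k] U k L)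

/-- Group laws for points are inherited from the convolution algebra, where associativity and the
unit laws are already available. -/
theorem conv_injective : Function.Injective (conv : Pt k C L → WithConv (C →ₗ[k] U k L)) :=
  fun _ _ h => ext fun c => congrArg (fun φ : WithConv (C →ₗ[k] U k L) => φ c) h

instance : One (Pt k C L) :=
  ⟨of
    { toLinearMap := Algebra.linearMap k (U k L) ∘ₗ Coalgebra.counit (R := k)
      counit_comp := by ext; simp
      map_comp_comul := by
        ext c
        have h := congrArg (TensorProduct.map (Algebra.linearMap k (U k L))
          (Algebra.linearMap k (U k L) ∘ₗ Coalgebra.counit (R := k)))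
          (Coalgebra.rTensor_counit_comul (R := k) c)
        rw [LinearMap.rTensor, ← LinearMap.comp_apply, ← TensorProduct.map_comp] at h
        simp only [LinearMap.comp_id] at h
        rw [LinearMap.comp_apply, h]
        simp [Algebra.algebraMap_eq_smul_one, Algebra.TensorProduct.one_def] }⟩

theorem one_hom_apply (c : C) :
    (1 : Pt k C L).hom c = algebraMap k (U k L) (Coalgebra.counit (R := k) c) := rfl

theorem conv_one : (1 : Pt k C L).conv = 1 := rfl

instance : Inv (Pt k C L) := ⟨fun g => of ((antipodeCoalgHom k L).comp g.hom)⟩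

variable [Coalgebra.IsCocomm k C] [Coalgebra.IsCocomm k D]

instance : Mul (Pt k C L) :=
  ⟨fun f g => of ((Bialgebra.mulCoalgHom k (U k L)).comp (pairHom f.hom g.hom))⟩

theorem mul_hom_apply (f g : Pt k C L) (c : C) : (f * g).hom c = LinearMap.mul' k (U k L)
    (TensorProduct.map (f.hom : C →ₗ[k] U k L) (g.hom : C →ₗ[k] U k L)
      (Coalgebra.comul (R := k) c)) := rfl

theorem conv_mul (f g : Pt k C L) : (f * g).conv = f.conv * g.conv := rfl

instance : Group (Pt k C L) :=
  Group.ofLeftAxioms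
    (fun f g h => conv_injective (by simp only [conv_mul, mul_assoc]))
    (fun f => conv_injective (by rw [conv_mul, conv_one, one_mul]))
    (fun f => conv_injective (by
      -- In the convolution algebra of endomorphisms the antipode is inverse to the identity;
      -- precomposing this relation with the coalgebra morphism underlying `f` gives the inverse of
      -- `f`.
      have h := LinearMap.convMul_comp_coalgHom_distrib
        (WithConv.toConv (HopfAlgebra.antipode k (A := U k L))) (WithConv.toConv LinearMap.id) f.hom
      rw [LinearMap.antipode_mul_id] at h
      rw [conv_mul]
      refine WithConv.ofConv_injective (Eq.trans h.symm ?_)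
      ext c
      simp [conv_one]))

/-- Functoriality of the group of points in the Lie algebra. -/
def map (f : L →ₗ⁅k⁆ L') : Pt k C L →* Pt k C L' where
  toFun g := of ((mapC f).comp g.hom)
  map_one' := ext fun c => by
    change mapU f ((1 : Pt k C L).hom c) = _
    simp [one_hom_apply]
  map_mul' g h := ext fun c => by
    change mapU f ((g * h).hom c) = _
    rw [mul_hom_apply, mul_hom_apply]
    generalize Coalgebra.comul (R := k) c = z
    induction z using TensorProduct.induction_on with
    | zero => simp
    | add z w hz hw => simp only [map_add, hz, hw]
    | tmul a b => simp

/-- Functoriality of the group of points in the coalgebra. -/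
def comap (h : D →ₗc[k] C) : Pt k C L →* Pt k D L where
  toFun g := of (g.hom.comp h)
  map_one' := ext fun d => by
    change (1 : Pt k C L).hom (h d) = _
    simp [one_hom_apply]
  map_mul' f g := ext fun d => by
    change (f * g).hom (h d) = _
    rw [mul_hom_apply, mul_hom_apply, ← CoalgHomClass.map_comp_comul_apply h d]
    generalize Coalgebra.comul (R := k) d = z
    induction z using TensorProduct.induction_on with
    | zero => simp
    | add z w hz hw => simp only [map_add, hz, hw]
    | tmul a b => simp

@[simp] theorem map_hom_apply (f : L →ₗ⁅k⁆ L') (g : Pt k C L) (c : C) :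
    (map f g).hom c = mapU f (g.hom c) := rfl

@[simp] theorem comap_hom_apply (h : D →ₗc[k] C) (g : Pt k C L) (d : D) :
    (comap h g).hom d = g.hom (h d) := rfl

theorem comap_map (h : D →ₗc[k] C) (f : L →ₗ⁅k⁆ L') (g : Pt k C L) :
    comap h (map f g) = map f (comap h g) := rfl

theorem map_map (f : L' →ₗ⁅k⁆ L'') (f' : L →ₗ⁅k⁆ L') (g : Pt k C L) :
    map f (map f' g) = map (f.comp f') g := by
  ext c; simp [mapU_comp]

theorem map_id (g : Pt k C L) : map LieHom.id g = g := by
  ext c; simp [mapU_id]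

theorem map_zero (g : Pt k C L) : map (0 : L →ₗ⁅k⁆ L') g = 1 := by
  ext c; simp [mapU_zero_apply, one_hom_apply]

/-- The universal point. -/
def univ (k L : Type*) [CommRing k] [LieRing L] [LieAlgebra k L] : Pt k (U k L) L :=
  of (CoalgHom.id k (U k L))

-- Yoneda: each point is the pullback of the universal one, so an identity natural in the coalgebra
-- need only be checked on `Pt.univ`.
@[simp] theorem comap_univ (g : Pt k C L) : comap g.hom (univ k L) = g := rfl

@[simp] theorem univ_hom_apply (a : U k L) : (univ k L).hom a = a := rfl

theorem comap_of_univ (h : C →ₗc[k] U k L) : comap h (univ k L) = of h := rfl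

end Pt

/-! ### Factorization of points along L = A ⊕ M and the resulting pair of actions -/

namespace LieSplitting

variable {A M L : Type*}
  [LieRing A] [LieAlgebra k A] [LieRing M] [LieAlgebra k M] [LieRing L] [LieAlgebra k L]
  (S : LieSplitting k A M L)

/-- On a product u c the projection is ε(c) u, and the coproduct of u c splits into coproducts of u
and of c; the counits applied to both halves of the latter collapse to ε(c). So `piA` carries points
to points. -/
theorem comul_piA (b : U k L) : Coalgebra.comul (R := k) (S.piA b)
    = TensorProduct.map S.piA S.piA (Coalgebra.comul b) := by
  induction b using S.induction_mul with
  | zero => simp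
  | add a b ha hb => simp only [map_add, ha, hb]
  | mul u c =>
    rw [piA_mul, Bialgebra.comul_mul, comul_mapU, comul_mapU, map_smul]
    have h : ∀ (x : U k A ⊗[k] U k A) (y : U k M ⊗[k] U k M),
        TensorProduct.map S.piA S.piA
          (TensorProduct.map (mapU S.inA).toLinearMap (mapU S.inA).toLinearMap x
            * TensorProduct.map (mapU S.inM).toLinearMap (mapU S.inM).toLinearMap y)
        = (TensorProduct.lid k k (TensorProduct.map (Coalgebra.counit (R := k))
            (Coalgebra.counit (R := k)) y)) • x := by
      intro x y
      induction x using TensorProduct.induction_on with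
      | zero => simp
      | add x x' hx hx' => simp only [map_add, add_mul, hx, hx', smul_add]
      | tmul p q =>
        induction y using TensorProduct.induction_on with
        | zero => simp
        | add y y' hy hy' => simp only [map_add, mul_add, hy, hy', add_smul]
        | tmul c d =>
          simp [piA_mul, TensorProduct.smul_tmul', smul_smul, mul_comm]
    rw [h]
    congr 1
    have h2 : (TensorProduct.map (Coalgebra.counit (R := k)) (Coalgebra.counit (R := k)))
        (Coalgebra.comul (R := k) c) = (Coalgebra.counit (R := k)).lTensor k
          ((Coalgebra.counit (R := k)).rTensor (U k M) (Coalgebra.comul (R := k) c)) := by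
      rw [← LinearMap.comp_apply, ← LinearMap.comp_apply, LinearMap.lTensor_comp_rTensor,
        LinearMap.comp_apply]
    rw [h2, Coalgebra.rTensor_counit_comul]
    simp

theorem counit_piA (b : U k L) :
    Coalgebra.counit (R := k) (S.piA b) = Coalgebra.counit (R := k) b := by
  induction b using S.induction_mul with
  | zero => simp
  | add a b ha hb => simp only [map_add, ha, hb]
  | mul u c => simp [piA_mul, counit_mapU, mul_comm]

/-- `piA` as a morphism of coalgebras. -/
def piAC : U k L →ₗc[k] U k A where
  toLinearMap := S.piA
  counit_comp := LinearMap.ext S.counit_piA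
  map_comp_comul := LinearMap.ext fun b => (S.comul_piA b).symm

/-- `piM` as a morphism of coalgebras. -/
def piMC : U k L →ₗc[k] U k M where
  toLinearMap := S.piM
  counit_comp := LinearMap.ext S.counit_piM
  map_comp_comul := LinearMap.ext fun b => (S.comul_piM b).symm

variable {C D : Type*} [AddCommMonoid C] [Module k C] [Coalgebra k C]
  [AddCommMonoid D] [Module k D] [Coalgebra k D]

/-- The factor in `A` of a point of `L`. -/
def ptA (g : Pt k C L) : Pt k C A := Pt.of (S.piAC.comp g.hom)

/-- The factor in `M` of a point of `L`. -/
def ptM (g : Pt k C L) : Pt k C M := Pt.of (S.piMC.comp g.hom)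

theorem ptA_hom_apply (g : Pt k C L) (c : C) : (S.ptA g).hom c = S.piA (g.hom c) := rfl

theorem ptM_hom_apply (g : Pt k C L) (c : C) : (S.ptM g).hom c = S.piM (g.hom c) := rfl

variable [Coalgebra.IsCocomm k C] [Coalgebra.IsCocomm k D]

theorem inA_ptA_mul_inM_ptM (g : Pt k C L) :
    Pt.map S.inA (S.ptA g) * Pt.map S.inM (S.ptM g) = g := by
  -- By pullback it is enough to treat the universal point, that is, the identity of `U(L)`, which
  -- can be evaluated on products u c.
  suffices h : Pt.map S.inA (S.ptA (Pt.univ k L)) * Pt.map S.inM (S.ptM (Pt.univ k L))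
      = Pt.univ k L by
    have h' := congrArg (Pt.comap g.hom) h
    rw [map_mul] at h'
    exact h'
  ext b
  rw [Pt.mul_hom_apply]
  change _ = b
  induction b using S.induction_mul with
  | zero => simp
  | add a b ha hb => simp only [map_add, ha, hb]
  | mul u c =>
    have h : ∀ (x : U k A ⊗[k] U k A) (y : U k M ⊗[k] U k M),
        LinearMap.mul' k (U k L) (TensorProduct.map
          ((mapU S.inA).toLinearMap ∘ₗ S.piA) ((mapU S.inM).toLinearMap ∘ₗ S.piM)
          (TensorProduct.map (mapU S.inA).toLinearMap (mapU S.inA).toLinearMap x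
            * TensorProduct.map (mapU S.inM).toLinearMap (mapU S.inM).toLinearMap y))
        = mapU S.inA (TensorProduct.rid k _ ((Coalgebra.counit (R := k)).lTensor _ x))
          * mapU S.inM (TensorProduct.lid k _ ((Coalgebra.counit (R := k)).rTensor _ y)) := by
      intro x y
      induction x using TensorProduct.induction_on with
      | zero => simp
      | add x x' hx hx' => simp only [map_add, add_mul, hx, hx']
      | tmul p q =>
        induction y using TensorProduct.induction_on with
        | zero => simp
        | add y y' hy hy' => simp only [map_add, mul_add, hy, hy']
        | tmul c d => simp [piA_mul, piM_mul, smul_smul, mul_comm]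
    refine Eq.trans ?_ ((h (Coalgebra.comul (R := k) u) (Coalgebra.comul (R := k) c)).trans ?_)
    · rw [Bialgebra.comul_mul, comul_mapU, comul_mapU]
      rfl
    · simp

/-- Uniqueness of the factorization: the projections of a product evaluate the other factor by its
counit, which amounts to convolving with the trivial point. -/
theorem ptA_ptM_mul (a : Pt k C A) (m : Pt k C M) :
    S.ptA (Pt.map S.inA a * Pt.map S.inM m) = a ∧
      S.ptM (Pt.map S.inA a * Pt.map S.inM m) = m := by
  constructor
  · conv_rhs => rw [← mul_one a]
    ext c
    rw [ptA_hom_apply, Pt.mul_hom_apply, Pt.mul_hom_apply]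
    generalize Coalgebra.comul (R := k) c = z
    induction z using TensorProduct.induction_on with
    | zero => simp
    | add z w hz hw => simp only [map_add, hz, hw]
    | tmul x y => simp [piA_mul, Pt.one_hom_apply, Algebra.smul_def, Algebra.commutes]
  · conv_rhs => rw [← one_mul m]
    ext c
    rw [ptM_hom_apply, Pt.mul_hom_apply, Pt.mul_hom_apply]
    generalize Coalgebra.comul (R := k) c = z
    induction z using TensorProduct.induction_on with
    | zero => simp
    | add z w hz hw => simp only [map_add, hz, hw]
    | tmul x y => simp [piM_mul, Pt.one_hom_apply, Algebra.smul_def]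

/-- The way the factors are computed throughout: exhibit some factorization and read off its
`A`-part. -/
theorem ptA_eq {g : Pt k C L} {a : Pt k C A} {m : Pt k C M}
    (h : g = Pt.map S.inA a * Pt.map S.inM m) : S.ptA g = a := h ▸ (S.ptA_ptM_mul a m).1

theorem ptM_eq {g : Pt k C L} {a : Pt k C A} {m : Pt k C M}
    (h : g = Pt.map S.inA a * Pt.map S.inM m) : S.ptM g = m := h ▸ (S.ptA_ptM_mul a m).2

/-- The right action of points of `A` on points of `M`. -/
def ptAct (m : Pt k C M) (a : Pt k C A) : Pt k C M := S.ptM (Pt.map S.inM m * Pt.map S.inA a)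

/-- The dressing action of points of `M` on points of `A`. -/
def ptDress (m : Pt k C M) (a : Pt k C A) : Pt k C A := S.ptA (Pt.map S.inM m * Pt.map S.inA a)

theorem inM_mul_inA (m : Pt k C M) (a : Pt k C A) : Pt.map S.inM m * Pt.map S.inA a
    = Pt.map S.inA (S.ptDress m a) * Pt.map S.inM (S.ptAct m a) :=
  (S.inA_ptA_mul_inM_ptM _).symm

/-- Move m past ab in two steps; uniqueness of the factorization identifies the `M`-part. The next
lemma does the same for (mn)a, where n acts first and m meets the dressed element n ▷ a. -/
theorem ptAct_mul (m : Pt k C M) (a b : Pt k C A) :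
    S.ptAct m (a * b) = S.ptAct (S.ptAct m a) b :=
  S.ptM_eq (a := S.ptDress m a * S.ptDress (S.ptAct m a) b) (by
    rw [map_mul, ← mul_assoc, inM_mul_inA, mul_assoc, inM_mul_inA, ← mul_assoc, map_mul])

theorem mul_ptAct (m n : Pt k C M) (a : Pt k C A) :
    S.ptAct (m * n) a = S.ptAct m (S.ptDress n a) * S.ptAct n a :=
  S.ptM_eq (a := S.ptDress m (S.ptDress n a)) (by
    rw [map_mul, mul_assoc, inM_mul_inA, ← mul_assoc, inM_mul_inA, mul_assoc, map_mul])

@[simp] theorem ptAct_one (m : Pt k C M) : S.ptAct m 1 = m := S.ptM_eq (a := 1) (by simp)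

@[simp] theorem one_ptDress (a : Pt k C A) : S.ptDress 1 a = a := S.ptA_eq (m := 1) (by simp)

theorem comap_ptM (h : D →ₗc[k] C) (g : Pt k C L) :
    Pt.comap h (S.ptM g) = S.ptM (Pt.comap h g) := rfl

theorem comap_ptA (h : D →ₗc[k] C) (g : Pt k C L) :
    Pt.comap h (S.ptA g) = S.ptA (Pt.comap h g) := rfl

theorem comap_ptAct (h : D →ₗc[k] C) (m : Pt k C M) (a : Pt k C A) :
    Pt.comap h (S.ptAct m a) = S.ptAct (Pt.comap h m) (Pt.comap h a) := by
  rw [ptAct, comap_ptM, map_mul, Pt.comap_map, Pt.comap_map, ← ptAct]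

theorem comap_ptDress (h : D →ₗc[k] C) (m : Pt k C M) (a : Pt k C A) :
    Pt.comap h (S.ptDress m a) = S.ptDress (Pt.comap h m) (Pt.comap h a) := by
  rw [ptDress, comap_ptA, map_mul, Pt.comap_map, Pt.comap_map, ← ptDress]

end LieSplitting

end Points

/-! ### Powers of Lie algebra elements span the enveloping algebra; linear maps described by power
series -/

section Powers

variable {k : Type*} [CommRing k]

/-- The coefficients of the expansion of `(w + r v) ^ n` in powers of a central element `r`. -/
def polarCoeff {B : Type*} [Ring B] (w v : B) : ℕ → ℕ → B
  | 0, 0 => 1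
  | 0, _ + 1 => 0
  | n + 1, 0 => polarCoeff w v n 0 * w
  | n + 1, i + 1 => polarCoeff w v n (i + 1) * w + polarCoeff w v n i * v

theorem polarCoeff_zero {B : Type*} [Ring B] (w v : B) (n : ℕ) : polarCoeff w v n 0 = w ^ n := by
  induction n with
  | zero => simp [polarCoeff]
  | succ n ih => rw [polarCoeff, ih, pow_succ]

theorem polarCoeff_of_lt {B : Type*} [Ring B] (w v : B) {n i : ℕ} (h : n < i) :
    polarCoeff w v n i = 0 := by
  induction n generalizing i with
  | zero => obtain ⟨i, rfl⟩ := Nat.exists_eq_succ_of_ne_zero h.ne'; rfl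
  | succ n ih =>
    obtain ⟨i, rfl⟩ := Nat.exists_eq_succ_of_ne_zero (Nat.ne_zero_of_lt h)
    rw [polarCoeff, ih (by omega), ih (by omega)]
    simp

theorem add_smul_pow_eq_sum {B : Type*} [Ring B] [Algebra k B] (w v : B) (r : k) (n : ℕ) :
    (w + r • v) ^ n = ∑ i ∈ Finset.range (n + 1), r ^ i • polarCoeff w v n i := by
  induction n with
  | zero => simp [polarCoeff]
  | succ n ih =>
    have h : ∑ i ∈ Finset.range (n + 1), r ^ i • polarCoeff w v n i
        = ∑ i ∈ Finset.range (n + 2), r ^ i • polarCoeff w v n i := by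
      rw [Finset.sum_range_succ _ (n + 1), polarCoeff_of_lt w v (Nat.lt_succ_self n)]
      simp
    rw [pow_succ, mul_add, ih]
    nth_rewrite 1 [h]
    rw [Finset.sum_range_succ' _ (n + 1), Finset.sum_range_succ' _ (n + 1), add_mul,
      Finset.sum_mul, Finset.sum_mul, add_right_comm, ← Finset.sum_add_distrib]
    congr 1
    · refine Finset.sum_congr rfl fun i _ => ?_
      simp only [polarCoeff, smul_add, smul_mul_assoc, mul_smul_comm, smul_smul, pow_succ,
        mul_comm r]
    · simp [polarCoeff]

/-- A polynomial in r whose values at all rational r lie in `P` has its coefficients in `P`: apply a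
ℚ-linear functional on the quotient and use that a rational polynomial vanishing everywhere is zero.
-/
theorem polarCoeff_mem {B : Type*} [Ring B] [Algebra k B] [Algebra ℚ k] (P : Submodule k B)
    (w v : B) (n : ℕ) (h : ∀ r : k, (w + r • v) ^ n ∈ P) (i : ℕ) : polarCoeff w v n i ∈ P := by
  -- Over the field ℚ the functionals on the quotient separate points.
  let _ : Module ℚ (B ⧸ P) := Module.compHom _ (algebraMap ℚ k)
  rw [← Submodule.Quotient.mk_eq_zero, ← Module.forall_dual_apply_eq_zero_iff ℚ]
  intro f
  let q : Polynomial ℚ := ∑ i ∈ Finset.range (n + 1),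
    Polynomial.monomial i (f (Submodule.Quotient.mk (polarCoeff w v n i)))
  have hq : q = 0 := by
    refine Polynomial.funext fun r => ?_
    have h1 := h (algebraMap ℚ k r)
    rw [add_smul_pow_eq_sum, ← Submodule.Quotient.mk_eq_zero, ← Submodule.mkQ_apply,
      map_sum] at h1
    have h2 := congrArg f h1
    rw [map_sum, map_zero] at h2
    simp only [q, Polynomial.eval_finsetSum, Polynomial.eval_monomial, Polynomial.eval_zero]
    rw [← h2]
    refine Finset.sum_congr rfl fun i _ => ?_
    rw [map_smul, ← map_pow, mul_comm, ← smul_eq_mul, ← map_smul]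
    rfl
  rcases lt_or_ge n i with hi | hi
  · rw [polarCoeff_of_lt w v hi]; simp
  · have h3 := congrArg (fun q => Polynomial.coeff q i) hq
    simp only [q, Polynomial.finsetSum_coeff, Polynomial.coeff_monomial, Polynomial.coeff_zero] at h3
    rwa [Finset.sum_ite_eq' , if_pos (Finset.mem_range.mpr (by omega))] at h3

variable {L : Type*} [LieRing L] [LieAlgebra k L]

/-- Polarization. Modulo the span of powers, the position of v in a word wⁱ v wʲ is irrelevant,
because moving it costs commutators of lower degree. The linear coefficient of (w + r v)ⁿ is the sum
of all n such words and lies in the span, so after division by n each word does. Hence the span is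
stable under right multiplication by generators. -/
theorem span_gen_pow [Algebra ℚ k] :
    Submodule.span k {a : U k L | ∃ (w : L) (n : ℕ), a = gen k w ^ n} = ⊤ := by
  set P := Submodule.span k {a : U k L | ∃ (w : L) (n : ℕ), a = gen k w ^ n} with hP
  have hpow : ∀ (w : L) (n : ℕ), gen k w ^ n ∈ P := fun w n => Submodule.subset_span ⟨w, n, rfl⟩
  have key : ∀ (n i j : ℕ), i + j = n → ∀ w v : L, gen k w ^ i * gen k v * gen k w ^ j ∈ P := by
    intro n
    induction n with
    | zero =>
      intro i j h w v
      obtain ⟨rfl, rfl⟩ : i = 0 ∧ j = 0 := by omega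
      simpa using hpow v 1
    | succ n ih =>
      -- Exchanging v with an adjacent w produces wⁱ [v, w] wʲ with i + j = n, which the induction
      -- hypothesis puts in the span.
      have hcongr : ∀ (j i : ℕ), i + j = n + 1 → ∀ w v : L,
          gen k w ^ i * gen k v * gen k w ^ j - gen k w ^ (n + 1) * gen k v ∈ P := by
        intro j
        induction j with
        | zero =>
          intro i h w v
          obtain rfl : i = n + 1 := h
          simp
        | succ j ihj =>
          intro i h w v
          have h1 := ihj (i + 1) (by omega) w v
          have h2 := ih i j (by omega) w ⁅v, w⁆
          have h3 : gen k w ^ i * gen k v * gen k w ^ (j + 1) - gen k w ^ (n + 1) * gen k v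
              = (gen k w ^ (i + 1) * gen k v * gen k w ^ j - gen k w ^ (n + 1) * gen k v)
                + gen k w ^ i * gen k ⁅v, w⁆ * gen k w ^ j := by
            rw [gen_lie, pow_succ' _ j, pow_succ _ i]
            noncomm_ring
          rw [h3]
          exact add_mem h1 h2
      -- The linear coefficient of (w + r v)^(m+1) has m + 1 terms, all congruent to one another
      -- once padded on the right by wʲ to total degree n + 2.
      have hsum : ∀ (w v : L) (m j : ℕ), m + j = n + 1 →
          polarCoeff (gen k w) (gen k v) (m + 1) 1 * gen k w ^ j
            - (m + 1) • (gen k w ^ (n + 1) * gen k v) ∈ P := by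
        intro w v m
        induction m with
        | zero =>
          intro j h
          have h1 := hcongr j 0 (by omega) w v
          simpa [polarCoeff] using h1
        | succ m ihm =>
          intro j h
          have h1 := ihm (j + 1) (by omega)
          have h2 := hcongr j (m + 1) (by omega) w v
          have h3 := add_mem h1 h2
          rw [polarCoeff, polarCoeff_zero, add_mul, mul_assoc _ _ (gen k w ^ j), ← pow_succ',
            succ_nsmul, add_sub_add_comm]
          exact h3
      intro i j h w v
      have h1 := hsum w v (n + 1) 0 rfl
      rw [pow_zero, mul_one] at h1
      have h2 : polarCoeff (gen k w) (gen k v) (n + 2) 1 ∈ P :=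
        polarCoeff_mem P _ _ _ (fun r => by
          rw [← map_smul, ← map_add]
          exact hpow _ _) 1
      have h3 : (n + 1 + 1) • (gen k w ^ (n + 1) * gen k v) ∈ P := by
        have := sub_mem h2 h1
        rwa [sub_sub_cancel] at this
      -- Division by n + 2 is where characteristic zero enters a second time.
      have h4 : gen k w ^ (n + 1) * gen k v ∈ P := by
        have h5 := P.smul_mem (algebraMap ℚ k (1 / ((n + 1 + 1 : ℕ) : ℚ))) h3
        rw [← Nat.cast_smul_eq_nsmul k, smul_smul, ← map_natCast (algebraMap ℚ k), ← map_mul,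
          one_div, inv_mul_cancel₀ (by positivity), map_one, one_smul] at h5
        exact h5
      have h6 := add_mem (hcongr j i h w v) h4
      rwa [sub_add_cancel] at h6
  rw [eq_top_iff]
  intro a _
  have hmul : ∀ (v : L) (a : U k L), a ∈ P → a * gen k v ∈ P := by
    intro v a ha
    induction ha using Submodule.span_induction with
    | mem a ha =>
      obtain ⟨w, n, rfl⟩ := ha
      simpa using key n n 0 rfl w v
    | zero => simp
    | add a b _ _ ha hb => rw [add_mul]; exact add_mem ha hb
    | smul r a _ ha => rw [smul_mul_assoc]; exact P.smul_mem r ha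
  induction a using U_induction with
  | zero => exact zero_mem P
  | one => simpa using hpow 0 0
  | add a b ha hb => exact add_mem (ha trivial) (hb trivial)
  | smul r a ha => exact P.smul_mem r (ha trivial)
  | mul a x ha => exact hmul x a (ha trivial)

/-- Over a `ℚ`-algebra, the powers of elements of `L` span the enveloping algebra. -/
theorem U_pow_induction [Algebra ℚ k] {p : U k L → Prop} (zero : p 0)
    (add : ∀ a b, p a → p b → p (a + b)) (smul : ∀ (r : k) a, p a → p (r • a))
    (pow : ∀ (w : L) (n : ℕ), p (gen k w ^ n)) (a : U k L) : p a := by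
  have ha : a ∈ Submodule.span k {a : U k L | ∃ (w : L) (n : ℕ), a = gen k w ^ n} := by
    rw [span_gen_pow]; trivial
  induction ha using Submodule.span_induction with
  | mem a ha => obtain ⟨w, n, rfl⟩ := ha; exact pow w n
  | zero => exact zero
  | add a b _ _ ha hb => exact add a b ha hb
  | smul r a _ ha => exact smul r a ha

theorem comul_gen_pow (w : L) (n : ℕ) : Coalgebra.comul (R := k) (gen k w ^ n)
    = ∑ m ∈ Finset.HasAntidiagonal.antidiagonal n, n.choose m.1 • (gen k w ^ m.1) ⊗ₜ[k] (gen k w ^ m.2) := by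
  rw [Bialgebra.comul_pow, comul_gen, Commute.add_pow']
  · simp [Algebra.TensorProduct.tmul_pow]
  · simp [commute_iff_eq]

/-- The linear map `g` takes the values `n! p_n u ^ n` on the powers `w ^ n`. -/
def HasProfile [Algebra ℚ k] {B : Type*} [Ring B] [Algebra k B] (w : L) (u : B)
    (g : WithConv (U k L →ₗ[k] B)) (p : PowerSeries ℚ) : Prop :=
  ∀ n : ℕ, g (gen k w ^ n) = algebraMap ℚ k (n.factorial * PowerSeries.coeff n p) • u ^ n

namespace HasProfile

variable [Algebra ℚ k] {B : Type*} [Ring B] [Algebra k B] {w : L} {u : B}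
  {g h : WithConv (U k L →ₗ[k] B)} {p q : PowerSeries ℚ}

theorem one : HasProfile w u (1 : WithConv (U k L →ₗ[k] B)) 1 := by
  intro n
  rw [LinearMap.convOne_apply, Bialgebra.counit_pow, counit_gen, PowerSeries.coeff_one]
  rcases n with _ | n <;> simp

theorem add (hg : HasProfile w u g p) (hh : HasProfile w u h q) : HasProfile w u (g + h) (p + q) := by
  intro n
  have : (g + h) (gen k w ^ n) = g (gen k w ^ n) + h (gen k w ^ n) := rfl
  rw [this, hg n, hh n, map_add, mul_add, map_add, add_smul]

theorem neg (hg : HasProfile w u g p) : HasProfile w u (-g) (-p) := by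
  intro n
  have : (-g) (gen k w ^ n) = -g (gen k w ^ n) := rfl
  rw [this, hg n, map_neg, mul_neg, map_neg, neg_smul]

theorem sub (hg : HasProfile w u g p) (hh : HasProfile w u h q) : HasProfile w u (g - h) (p - q) := by
  rw [sub_eq_add_neg, sub_eq_add_neg]
  exact hg.add hh.neg

/-- Formally a profile says g(exp(sw)) = p(su). Since exp(sw) is group-like, convolution multiplies
the values; on coefficients this is the binomial coproduct of wⁿ. -/
theorem mul (hg : HasProfile w u g p) (hh : HasProfile w u h q) : HasProfile w u (g * h) (p * q) := by
  intro n
  rw [LinearMap.convMul_apply, comul_gen_pow, map_sum, map_sum, PowerSeries.coeff_mul,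
    Finset.mul_sum, map_sum, Finset.sum_smul]
  refine Finset.sum_congr rfl fun m hm => ?_
  rw [Finset.HasAntidiagonal.mem_antidiagonal] at hm
  subst hm
  have h1 : g.ofConv (gen k w ^ m.1) = _ := hg m.1
  have h2 : h.ofConv (gen k w ^ m.2) = _ := hh m.2
  rw [map_nsmul, map_nsmul, TensorProduct.map_tmul, LinearMap.mul'_apply, h1, h2, smul_mul_assoc,
    mul_smul_comm, ← pow_add, smul_smul, ← Nat.cast_smul_eq_nsmul k, smul_smul,
    ← map_natCast (algebraMap ℚ k), ← map_mul, ← map_mul]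
  congr 2
  rw [← Nat.add_choose_mul_factorial_mul_factorial m.1 m.2, Nat.choose_symm_add]
  push_cast
  ring

theorem pow (hg : HasProfile w u g p) (j : ℕ) : HasProfile w u (g ^ j) (p ^ j) := by
  induction j with
  | zero => rw [pow_zero, pow_zero]; exact one
  | succ j ih => rw [pow_succ, pow_succ]; exact ih.mul hg

theorem smul (hg : HasProfile w u g p) (r : ℚ) :
    HasProfile w u (algebraMap ℚ k r • g) (r • p) := by
  intro n
  have : (algebraMap ℚ k r • g) (gen k w ^ n) = algebraMap ℚ k r • g (gen k w ^ n) := rfl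
  rw [this, hg n, smul_smul, ← map_mul, PowerSeries.coeff_smul, smul_eq_mul]
  congr 2
  ring

end HasProfile

/-- A homomorphism of groups sends exp(w) to exp(f(w)), so its profile is the exponential series. -/
theorem hasProfile_mapU [Algebra ℚ k] {L' : Type*} [LieRing L'] [LieAlgebra k L']
    (f : L →ₗ⁅k⁆ L') (w : L) : HasProfile w (gen k (f w))
      (WithConv.toConv (mapU f : U k L →ₐ[k] U k L').toLinearMap) (PowerSeries.exp ℚ) := by
  intro n
  have : (n.factorial : ℚ) ≠ 0 := by positivity
  simp [PowerSeries.coeff_exp, this]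

theorem antipodeU_gen_pow (w : L) (n : ℕ) :
    antipodeU (gen k w ^ n) = (-1 : k) ^ n • gen k w ^ n := by
  induction n with
  | zero => simp [antipodeU_one]
  | succ n ih => rw [pow_succ (gen k w), antipodeU_mul_gen, ih, mul_smul_comm, ← pow_succ', ← pow_succ, pow_succ (-1 : k)]; simp

theorem hasProfile_antipode_mapU [Algebra ℚ k] {L' : Type*} [LieRing L'] [LieAlgebra k L']
    (f : L →ₗ⁅k⁆ L') (w : L) : HasProfile w (gen k (f w))
      (WithConv.toConv (antipodeU ∘ₗ (mapU f : U k L →ₐ[k] U k L').toLinearMap))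
      (PowerSeries.evalNegHom (PowerSeries.exp ℚ)) := by
  intro n
  have : (n.factorial : ℚ) ≠ 0 := by positivity
  have h2 : ((n.factorial : ℚ) * ((-1) ^ n * (n.factorial : ℚ)⁻¹)) = (-1) ^ n := by field_simp
  simp [PowerSeries.evalNegHom, PowerSeries.coeff_rescale, PowerSeries.coeff_exp, 
    antipodeU_gen_pow, h2]

/-- `log (exp X) = X`, up to order `N`. -/
theorem coeff_log_exp (N n : ℕ) (h : n ≤ N) :
    PowerSeries.coeff n (∑ j ∈ Finset.range N, ((-1 : ℚ) ^ j / ((j : ℚ) + 1)) •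
      (PowerSeries.exp ℚ - 1) ^ (j + 1)) = if n = 1 then 1 else 0 := by
  set E : PowerSeries ℚ := PowerSeries.exp ℚ - 1 with hE
  have hE0 : PowerSeries.constantCoeff E = 0 := by simp [hE]
  rcases n with _ | n
  · simp only [PowerSeries.coeff_zero_eq_constantCoeff, map_sum]
    simp [hE0]
  -- With E = exp - 1 and E' = 1 + E the derivative is the geometric sum of (-E)ʲ times 1 + E, which
  -- telescopes. The remainder (-E)^N has order at least N, so it does not reach the coefficient in
  -- question.
  · have hd : PowerSeries.derivative ℚ (∑ j ∈ Finset.range N, ((-1 : ℚ) ^ j / ((j : ℚ) + 1)) •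
      E ^ (j + 1)) = 1 - (-E) ^ N := by
      have h1 : ∀ j ∈ Finset.range N, PowerSeries.derivative ℚ (((-1 : ℚ) ^ j / ((j : ℚ) + 1)) •
          E ^ (j + 1)) = (-E) ^ j * (1 + E) := by
        intro j _
        have hj : ((j : ℚ) + 1) ≠ 0 := by positivity
        have hdE : PowerSeries.derivative ℚ E = 1 + E := by
          simp [hE, PowerSeries.derivative_exp]
        rw [Derivation.map_smul, Derivation.leibniz_pow, hdE, Nat.add_sub_cancel, smul_eq_mul]
        rw [← Nat.cast_smul_eq_nsmul ℚ, smul_smul]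
        push_cast
        rw [div_mul_cancel₀ _ hj, PowerSeries.smul_eq_C_mul]
        rw [neg_pow E, map_pow, map_neg, map_one, mul_assoc]
      rw [map_sum, Finset.sum_congr rfl h1, ← Finset.sum_mul]
      have := geom_sum_mul_neg (-E) N
      rwa [sub_neg_eq_add] at this
    have h2 := congrArg (PowerSeries.coeff n) hd
    rw [PowerSeries.coeff_derivative] at h2
    have h3 : PowerSeries.coeff n ((-E) ^ N) = 0 :=
      PowerSeries.coeff_of_lt_order _ (lt_of_lt_of_le (by exact_mod_cast h)
        (PowerSeries.le_order_pow_of_constantCoeff_eq_zero N (by simp [hE0])))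
    rw [map_sub, h3, sub_zero, PowerSeries.coeff_one] at h2
    have hn : ((n : ℚ) + 1) ≠ 0 := by positivity
    rcases n with _ | n
    · simpa using h2
    · simp only [Nat.add_eq_zero_iff, one_ne_zero, and_false, if_false] at h2
      rw [mul_eq_zero_iff_right hn] at h2
      rw [h2]; simp

end Powers

/-! ### Exponentials and logarithms of symbols -/

section ExpLog

variable {k : Type*} [CommRing k] {A M L : Type*}
  [LieRing A] [LieAlgebra k A] [LieRing M] [LieAlgebra k M] [LieRing L] [LieAlgebra k L]

namespace LieSplitting

variable (S : LieSplitting k A M L)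

theorem Sym.add_apply (φ ψ : S.Sym) (c : U k M) : (φ + ψ) c = φ c + ψ c := rfl

theorem Sym.neg_apply (φ : S.Sym) (c : U k M) : (-φ) c = -φ c := rfl

theorem Sym.map_add' (φ : S.Sym) (c d : U k M) : φ (c + d) = φ c + φ d :=
  map_add (S.toSym.symm φ) c d

theorem Sym.map_smul' (φ : S.Sym) (r : k) (c : U k M) : φ (r • c) = r • φ c :=
  map_smul (S.toSym.symm φ) r c

theorem Sym.map_zero' (φ : S.Sym) : φ 0 = 0 := map_zero (S.toSym.symm φ)

/-- Evaluation of symbols as a homomorphism of additive groups. -/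
def evalHom : S.Sym →+ (U k M → U k A) where
  toFun φ c := φ c
  map_zero' := rfl
  map_add' _ _ := rfl

/-- A pointwise finite series of symbols converges to its pointwise sum. -/
theorem tsum_apply_eq_sum (F : ℕ → S.Sym) (hF : ∀ c, ∃ N, ∀ j ≥ N, F j c = 0) (c : U k M)
    (N : ℕ) (hN : ∀ j ≥ N, F j c = 0) : (∑' j, F j) c = ∑ j ∈ Finset.range N, F j c := by
  let _ : TopologicalSpace (U k A) := ⊥
  have _ : DiscreteTopology (U k A) := ⟨rfl⟩
  have hind : Topology.IsInducing S.evalHom := ⟨rfl⟩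
  -- The infinite sum is well determined only in a Hausdorff topology; here symbols embed
  -- continuously into a product of discrete spaces.
  have _ : T2Space S.Sym := T2Space.of_injective_continuous
    (fun φ ψ h => Sym.ext S fun c => congrFun h c) hind.continuous
  have hfin : ∀ c, (Function.support fun j => F j c).Finite := fun c => by
    obtain ⟨N, hN⟩ := hF c
    -- For fixed c only finitely many terms are nonzero, so the pointwise sum is linear in c even
    -- though the number of terms depends on c.
    refine (Finset.range N).finite_toSet.subset fun j hj => ?_
    by_contra h
    exact hj (hN j (by simpa using h))
  let φ : S.Sym := S.toSym
    { toFun := fun c => ∑ᶠ j, F j c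
      map_add' := fun c d => by
        rw [← finsum_add_distrib (hfin c) (hfin d)]
        exact finsum_congr fun j => Sym.map_add' S _ _ _
      map_smul' := fun r c => by
        rw [RingHom.id_apply, smul_finsum' r (hfin c)]
        exact finsum_congr fun j => Sym.map_smul' S _ _ _ }
  have hval : ∀ c N, (∀ j ≥ N, F j c = 0) → φ c = ∑ j ∈ Finset.range N, F j c := by
    intro c N hN
    refine finsum_eq_sum_of_support_subset _ fun j hj => ?_
    by_contra h
    exact hj (hN j (by simpa using h))
  have hsum : HasSum F φ := by
    rw [← hind.hasSum_iff, Pi.hasSum]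
    intro c
    obtain ⟨N, hN⟩ := hF c
    change HasSum (fun j => F j c) (φ c)
    rw [hval c N hN]
    exact hasSum_sum_of_ne_finset_zero fun j hj => hN j (by simpa using hj)
  rw [hsum.tsum_eq, hval c N hN]

/-- Powers span `U(M)`, and the bound for a sum is the maximum of the bounds, so local finiteness
can be tested on powers. -/
theorem eventually_zero_of_pow [Algebra ℚ k] (F : ℕ → S.Sym)
    (hF : ∀ (w : M) (n : ℕ), ∃ N, ∀ j ≥ N, F j (gen k w ^ n) = 0) (c : U k M) :
    ∃ N, ∀ j ≥ N, F j c = 0 := by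
  induction c using U_pow_induction with
  | zero => exact ⟨0, fun j _ => Sym.map_zero' S _⟩
  | add a b ha hb =>
    obtain ⟨N, hN⟩ := ha
    obtain ⟨N', hN'⟩ := hb
    exact ⟨max N N', fun j hj => by
      rw [Sym.map_add', hN j (le_trans (le_max_left _ _) hj),
        hN' j (le_trans (le_max_right _ _) hj), add_zero]⟩
  | smul r a ha =>
    obtain ⟨N, hN⟩ := ha
    exact ⟨N, fun j hj => by rw [Sym.map_smul', hN j hj, smul_zero]⟩
  | pow w n => exact hF w n

/-- A symbol as an element of the convolution algebra. -/
def symConv (φ : S.Sym) : WithConv (U k M →ₗ[k] U k A) := WithConv.toConv (S.toSym.symm φ)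

theorem symConv_apply (φ : S.Sym) (c : U k M) : S.symConv φ c = φ c := rfl

section Invariant

variable (f : M →ₗ⁅k⁆ A)

/-- For `ψ` invariant under the values of `φ`, the product of symbols is the convolution. -/
theorem mul_eq_conv_of_invariant (φ ψ : WithConv (U k M →ₗ[k] U k A))
    (hφ : ∀ c, φ c ∈ LinearMap.range (mapU f : U k M →ₐ[k] U k A).toLinearMap)
    (hψ : ∀ c u, ψ (S.act (c ⊗ₜ mapU f u)) = Coalgebra.counit (R := k) u • ψ c) :
    S.toSym φ.ofConv * S.toSym ψ.ofConv = S.toSym (φ * ψ).ofConv := by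
  ext c
  rw [mul_def, toSym_apply, toSym_apply]
  change S.applyAct ψ.ofConv (φ.ofConv.lTensor _ (Coalgebra.comul (R := k) c))
    = LinearMap.mul' k (U k A) (TensorProduct.map φ.ofConv ψ.ofConv (Coalgebra.comul (R := k) c))
  -- The smash product feeds the second coproduct factor to φ, the convolution the first;
  -- cocommutativity reconciles the two.
  conv_rhs => rw [← Coalgebra.comm_comul (R := k) c]
  generalize Coalgebra.comul (R := k) c = z
  -- The translation by the second part of a value of φ is seen by ψ only through its counit, so the
  -- twisting disappears.
  have key : ∀ (c : U k M) (u : U k M), S.applyAct ψ.ofConv (c ⊗ₜ mapU f u)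
      = mapU f u * ψ c := by
    intro c u
    have h1 : ∀ t : U k M ⊗[k] U k M, LinearMap.mul' k (U k A)
        ((ψ.ofConv ∘ₗ S.act).lTensor (U k A) (TensorProduct.leftComm k (U k M) (U k A) (U k A)
          (c ⊗ₜ (TensorProduct.map (mapU f).toLinearMap (mapU f).toLinearMap t))))
        = mapU f (TensorProduct.rid k _ ((Coalgebra.counit (R := k)).lTensor _ t)) * ψ c := by
      intro t
      induction t using TensorProduct.induction_on with
      | zero => simp
      | add t s ht hs => simp only [map_add, tmul_add, ht, hs, add_mul]
      | tmul a b =>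
        have := hψ c b
        change ψ.ofConv (S.act (c ⊗ₜ mapU f b)) = _ at this
        simp [this]
    have h2 := h1 (Coalgebra.comul (R := k) u)
    rw [← comul_mapU] at h2
    refine Eq.trans h2 ?_
    simp
  induction z using TensorProduct.induction_on with
  | zero => simp
  | add z w hz hw => simp only [map_add, hz, hw]
  | tmul a b =>
    obtain ⟨u, hu⟩ := hφ b
    have hu' : φ.ofConv b = mapU f u := hu.symm
    simp only [LinearMap.lTensor_tmul, TensorProduct.comm_tmul, TensorProduct.map_tmul,
      LinearMap.mul'_apply, hu', key]

/-- Invariance of a linear map under the translations by the image of `f`. -/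
def IsInvariant (ψ : WithConv (U k M →ₗ[k] U k A)) : Prop :=
  ∀ c u, ψ (S.act (c ⊗ₜ mapU f u)) = Coalgebra.counit (R := k) u • ψ c

variable {S f}

/-- Invariance is restated as equality of two precompositions with coalgebra morphisms, the action
and the projection. Convolution distributes over such precompositions, so products of invariant maps
are invariant. -/
theorem isInvariant_iff (ψ : WithConv (U k M →ₗ[k] U k A)) :
    S.IsInvariant f ψ ↔
      ψ.ofConv ∘ₗ ((S.piMC.comp ((Bialgebra.mulCoalgHom k (U k L)).comp
        (Coalgebra.TensorProduct.map (mapC S.inM) (mapC (S.inA.comp f))))) :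
          U k M ⊗[k] U k M →ₗc[k] U k M).toLinearMap =
      ψ.ofConv ∘ₗ (((Coalgebra.TensorProduct.rid k k (U k M)).toCoalgHom.comp
        (Coalgebra.TensorProduct.map (CoalgHom.id k (U k M)) (Coalgebra.counitCoalgHom k (U k M)))) :
          U k M ⊗[k] U k M →ₗc[k] U k M).toLinearMap := by
  have h1 : ∀ c u, S.act (c ⊗ₜ mapU f u) = (S.piMC.comp ((Bialgebra.mulCoalgHom k (U k L)).comp
        (Coalgebra.TensorProduct.map (mapC S.inM) (mapC (S.inA.comp f))))) (c ⊗ₜ u) := by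
    intro c u
    change _ = S.piM (mapU S.inM c * mapU (S.inA.comp f) u)
    rw [mapU_comp]
    rfl
  constructor
  · intro h
    refine TensorProduct.ext' fun c u => ?_
    have h2 := h c u
    rw [h1] at h2
    refine Eq.trans h2 ?_
    have h3 : Coalgebra.counit (R := k) u • ψ c = ψ.ofConv (Coalgebra.counit (R := k) u • c) :=
      (map_smul ψ.ofConv _ _).symm
    rw [h3]
    rfl
  · intro h c u
    have h2 := LinearMap.congr_fun h (c ⊗ₜ u)
    rw [h1]
    refine Eq.trans h2 ?_
    have h3 : Coalgebra.counit (R := k) u • ψ c = ψ.ofConv (Coalgebra.counit (R := k) u • c) :=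
      (map_smul ψ.ofConv _ _).symm
    rw [h3]
    rfl

namespace IsInvariant

variable {φ ψ : WithConv (U k M →ₗ[k] U k A)}

theorem mul (hφ : S.IsInvariant f φ) (hψ : S.IsInvariant f ψ) : S.IsInvariant f (φ * ψ) := by
  rw [isInvariant_iff] at *
  rw [LinearMap.convMul_comp_coalgHom_distrib, hφ, hψ, LinearMap.convMul_comp_coalgHom_distrib]

theorem one : S.IsInvariant f 1 := by
  intro c u
  have h : ∀ z : U k L, Coalgebra.counit (R := k) (S.piM z) = Coalgebra.counit (R := k) z :=
    S.counit_piM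
  simp only [LinearMap.convOne_apply, act, LinearMap.comp_apply, h, TensorProduct.map_tmul,
    LinearMap.mul'_apply, Bialgebra.counit_mul, AlgHom.toLinearMap_apply, counit_mapU,
    Algebra.smul_def, ← map_mul, mul_comm (Coalgebra.counit (R := k) u)]

theorem sub (hφ : S.IsInvariant f φ) (hψ : S.IsInvariant f ψ) : S.IsInvariant f (φ - ψ) := by
  intro c u
  have h : ∀ c, (φ - ψ) c = φ c - ψ c := fun _ => rfl
  rw [h, h, hφ, hψ, smul_sub]

theorem smul (hφ : S.IsInvariant f φ) (r : k) : S.IsInvariant f (r • φ) := by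
  intro c u
  have h : ∀ c, (r • φ) c = r • φ c := fun _ => rfl
  rw [h, h, hφ, smul_comm]

theorem pow (hφ : S.IsInvariant f φ) (j : ℕ) : S.IsInvariant f (φ ^ j) := by
  induction j with
  | zero => rw [pow_zero]; exact one
  | succ j ih => rw [pow_succ]; exact ih.mul hφ

end IsInvariant

end Invariant

variable [Algebra ℚ k]

/-- A series without constant term has a j-th power of order at least j. -/
theorem _root_.DoubleYangian.HasProfile.eq_zero_of_lt {w : M} {u : U k A}
    {g : WithConv (U k M →ₗ[k] U k A)} {p : PowerSeries ℚ} {j n : ℕ}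
    (hg : HasProfile w u g (p ^ j)) (hp : PowerSeries.constantCoeff p = 0) (h : n < j) :
    g (gen k w ^ n) = 0 := by
  rw [hg n, PowerSeries.coeff_of_lt_order _ (lt_of_lt_of_le (by exact_mod_cast h)
    (PowerSeries.le_order_pow_of_constantCoeff_eq_zero j hp))]
  simp

section Log

variable (f : M →ₗ⁅k⁆ A)

/-- The terms of the series `convLog`. -/
def convLogTerm (j : ℕ) : S.Sym := algebraMap ℚ k ((-1) ^ j / ((j : ℚ) + 1)) • S.toSym
  (((WithConv.toConv (mapU f : U k M →ₐ[k] U k A).toLinearMap - 1) ^ (j + 1) :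
    WithConv (U k M →ₗ[k] U k A)).ofConv)

theorem hasProfile_convLogTerm (j : ℕ) (w : M) : HasProfile w (gen k (f w))
    (S.symConv (S.convLogTerm f j))
    (((-1 : ℚ) ^ j / ((j : ℚ) + 1)) • (PowerSeries.exp ℚ - 1) ^ (j + 1)) :=
  (((hasProfile_mapU f w).sub HasProfile.one).pow (j + 1)).smul _

theorem convLogTerm_pow_eq_zero {j n : ℕ} (h : n ≤ j) (w : M) :
    S.convLogTerm f j (gen k w ^ n) = 0 := by
  have h1 := (((hasProfile_mapU f w).sub HasProfile.one).pow (j + 1)).eq_zero_of_lt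
    (by simp) (Nat.lt_succ_of_le h)
  have h2 : S.convLogTerm f j (gen k w ^ n) = algebraMap ℚ k ((-1) ^ j / ((j : ℚ) + 1)) •
    ((WithConv.toConv (mapU f : U k M →ₐ[k] U k A).toLinearMap - 1) ^ (j + 1) :
    WithConv (U k M →ₗ[k] U k A)) (gen k w ^ n) := rfl
  rw [h2, h1, smul_zero]

theorem convLogTerm_eventually_zero (c : U k M) :
    ∃ N, ∀ j ≥ N, S.convLogTerm f j c = 0 :=
  S.eventually_zero_of_pow _ (fun w n => ⟨n, fun _ hj => S.convLogTerm_pow_eq_zero f hj w⟩) c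

theorem convLog_apply (c : U k M) (N : ℕ) (hN : ∀ j ≥ N, S.convLogTerm f j c = 0) :
    S.convLog (mapU f : U k M →ₐ[k] U k A).toLinearMap c
      = ∑ j ∈ Finset.range N, S.convLogTerm f j c :=
  S.tsum_apply_eq_sum (S.convLogTerm f) (S.convLogTerm_eventually_zero f) c N hN

/-- The logarithm of the map of formal groups induced by `f` is `exp(w) ↦ f(w)`. -/
theorem hasProfile_convLog (w : M) : HasProfile w (gen k (f w))
    (S.symConv (S.convLog (mapU f : U k M →ₐ[k] U k A).toLinearMap)) PowerSeries.X := by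
  intro n
  rw [symConv_apply, S.convLog_apply f _ n (fun j hj => S.convLogTerm_pow_eq_zero f hj w)]
  have h1 : ∀ j ∈ Finset.range n, S.convLogTerm f j (gen k w ^ n) = _ :=
    fun j _ => S.hasProfile_convLogTerm f j w n
  rw [Finset.sum_congr rfl h1, ← Finset.sum_smul, ← map_sum, ← Finset.mul_sum, ← map_sum,
    coeff_log_exp n n le_rfl, PowerSeries.coeff_X]

/-- Since log(exp X) = X, the logarithm is supported on the linear terms: it is the Lie algebra map
regarded as the function exp(w) ↦ f(w). -/
theorem convLog_gen_pow (w : M) (n : ℕ) :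
    S.convLog (mapU f : U k M →ₐ[k] U k A).toLinearMap (gen k w ^ n)
      = if n = 1 then gen k (f w) else 0 := by
  have h := S.hasProfile_convLog f w n
  rw [symConv_apply] at h
  rw [h, PowerSeries.coeff_X]
  split_ifs with hn
  · subst hn; simp
  · simp

variable {S f}

theorem isInvariant_convLog
    (hf : S.IsInvariant f (WithConv.toConv (mapU f : U k M →ₐ[k] U k A).toLinearMap)) :
    S.IsInvariant f (S.symConv (S.convLog (mapU f : U k M →ₐ[k] U k A).toLinearMap)) := by
  intro c u
  have hj : ∀ j, S.IsInvariant f (S.symConv (S.convLogTerm f j)) :=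
    fun j => ((hf.sub IsInvariant.one).pow (j + 1)).smul _
  -- A common truncation order for both arguments reduces invariance of the series to that of its
  -- terms.
  obtain ⟨N, hN⟩ := S.convLogTerm_eventually_zero f c
  obtain ⟨N', hN'⟩ := S.convLogTerm_eventually_zero f (S.act (c ⊗ₜ mapU f u))
  rw [symConv_apply, symConv_apply,
    S.convLog_apply f c (max N N') (fun j h => hN j (le_trans (le_max_left _ _) h)),
    S.convLog_apply f _ (max N N') (fun j h => hN' j (le_trans (le_max_right _ _) h)),
    Finset.smul_sum]
  exact Finset.sum_congr rfl fun j _ => hj j c u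

theorem convLog_mem_range (c : U k M) :
    S.convLog (mapU f : U k M →ₐ[k] U k A).toLinearMap c
      ∈ LinearMap.range (mapU f : U k M →ₐ[k] U k A).toLinearMap := by
  induction c using U_pow_induction with
  | zero => rw [Sym.map_zero']; exact zero_mem _
  | add a b ha hb => rw [Sym.map_add']; exact add_mem ha hb
  | smul r a ha => rw [Sym.map_smul']; exact Submodule.smul_mem _ r ha
  | pow w n =>
    rw [convLog_gen_pow]
    split_ifs
    · exact ⟨gen k w, by simp⟩
    · exact zero_mem _

theorem hasProfile_ext {g h : WithConv (U k M →ₗ[k] U k A)} {p : PowerSeries ℚ}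
    (hg : ∀ w, HasProfile w (gen k (f w)) g p) (hh : ∀ w, HasProfile w (gen k (f w)) h p) :
    g = h := by
  have : ∀ c, g.ofConv c = h.ofConv c := by
    intro c
    induction c using U_pow_induction with
    | zero => rw [map_zero, map_zero]
    | add a b ha hb => rw [map_add, map_add, ha, hb]
    | smul r a ha => rw [map_smul, map_smul, ha]
    | pow w n => exact (hg w n).trans (hh w n).symm
  exact WithConv.ofConv_injective (LinearMap.ext this)

/-- Invariance together with values in the image of f turns powers in the smash product into
convolution powers. On the powers wⁿ the exponential series then becomes the identity exp(rX) = Σ rʲ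
Xʲ / j!. It is applied with r = 1 and r = -1, giving the exponential and its inverse. -/
theorem symExp_eq (φ : S.Sym) (g : WithConv (U k M →ₗ[k] U k A)) (r : ℚ)
    (hrange : ∀ c, φ c ∈ LinearMap.range (mapU f : U k M →ₐ[k] U k A).toLinearMap)
    (hinv : S.IsInvariant f (S.symConv φ))
    (hφ : ∀ w, HasProfile w (gen k (f w)) (S.symConv φ) (r • PowerSeries.X))
    (hg : ∀ w, HasProfile w (gen k (f w)) g (PowerSeries.rescale r (PowerSeries.exp ℚ))) :
    S.symExp φ = S.toSym g.ofConv := by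
  have hpow : ∀ j, φ ^ j = S.toSym (S.symConv φ ^ j).ofConv := by
    intro j
    induction j with
    | zero => rfl
    | succ j ih =>
      rw [pow_succ', pow_succ', ih]
      exact S.mul_eq_conv_of_invariant f (S.symConv φ) (S.symConv φ ^ j) hrange (hinv.pow j)
  let F : ℕ → S.Sym := fun j => algebraMap ℚ k (1 / (Nat.factorial j : ℚ)) • φ ^ j
  have hFp : ∀ j w, HasProfile w (gen k (f w)) (S.symConv (F j))
      ((1 / (Nat.factorial j : ℚ)) • (r • PowerSeries.X) ^ j) := by
    intro j w
    have h1 : S.symConv (F j) = algebraMap ℚ k (1 / (Nat.factorial j : ℚ)) • S.symConv φ ^ j := by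
      simp only [F, hpow]
      rfl
    rw [h1]
    exact ((hφ w).pow j).smul _
  have hF0 : ∀ (w : M) (n : ℕ), ∀ j ≥ n + 1, F j (gen k w ^ n) = 0 := by
    intro w n j hj
    rw [← symConv_apply, hFp j w n, smul_pow, PowerSeries.coeff_smul, PowerSeries.coeff_smul,
      PowerSeries.coeff_X_pow, if_neg (by omega)]
    simp
  -- Evaluated on wⁿ, only the term j = n of the exponential series contributes, so n + 1 terms
  -- suffice.
  have hsym : S.symConv (S.symExp φ) = g := by
    refine hasProfile_ext (f := f) (p := PowerSeries.rescale r (PowerSeries.exp ℚ))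
      (fun w n => ?_) hg
    have h1 : S.symExp φ (gen k w ^ n) = ∑ j ∈ Finset.range (n + 1), F j (gen k w ^ n) :=
      S.tsum_apply_eq_sum F (S.eventually_zero_of_pow F fun w n => ⟨n + 1, hF0 w n⟩) _ _ (hF0 w n)
    rw [symConv_apply, h1]
    have h2 : ∀ j ∈ Finset.range (n + 1), F j (gen k w ^ n) = _ := fun j _ => hFp j w n
    rw [Finset.sum_congr rfl h2, ← Finset.sum_smul, ← map_sum, ← Finset.mul_sum]
    congr 3
    have h3 : ∀ j ∈ Finset.range (n + 1), PowerSeries.coeff n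
        ((1 / (Nat.factorial j : ℚ)) • (r • (PowerSeries.X : PowerSeries ℚ)) ^ j)
        = if n = j then r ^ j * (1 / (Nat.factorial j : ℚ)) else 0 := by
      intro j _
      rw [smul_pow, PowerSeries.coeff_smul, PowerSeries.coeff_smul, PowerSeries.coeff_X_pow]
      split_ifs <;> simp [mul_comm]
    rw [Finset.sum_congr rfl h3, Finset.sum_ite_eq, if_pos (by simp), PowerSeries.coeff_rescale,
      PowerSeries.coeff_exp]
    simp
  exact S.toSym.symm.injective (congrArg WithConv.ofConv hsym)

/-- The exponential of the logarithm of the map of formal groups induced by `f`. -/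
theorem symExp_convLog
    (hf : S.IsInvariant f (WithConv.toConv (mapU f : U k M →ₐ[k] U k A).toLinearMap)) :
    S.symExp (S.convLog (mapU f : U k M →ₐ[k] U k A).toLinearMap)
      = S.toSym (mapU f : U k M →ₐ[k] U k A).toLinearMap :=
  symExp_eq (f := f) (g := WithConv.toConv (mapU f : U k M →ₐ[k] U k A).toLinearMap) _ 1
    convLog_mem_range (isInvariant_convLog hf)
    (fun w => by rw [one_smul]; exact S.hasProfile_convLog f w)
    (fun w => by rw [PowerSeries.rescale_one]; exact hasProfile_mapU f w)

theorem symExp_neg_convLog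
    (hf : S.IsInvariant f (WithConv.toConv (mapU f : U k M →ₐ[k] U k A).toLinearMap)) :
    S.symExp (-S.convLog (mapU f : U k M →ₐ[k] U k A).toLinearMap)
      = S.toSym (antipodeU ∘ₗ (mapU f : U k M →ₐ[k] U k A).toLinearMap) :=
  symExp_eq (f := f)
    (g := WithConv.toConv (antipodeU ∘ₗ (mapU f : U k M →ₐ[k] U k A).toLinearMap)) _ (-1)
    (fun c => neg_mem (convLog_mem_range c))
    (fun c u => by
      have h := isInvariant_convLog hf c u
      rw [symConv_apply, symConv_apply] at h ⊢
      rw [Sym.neg_apply, Sym.neg_apply, h, smul_neg])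
    (fun w => by rw [neg_smul, one_smul]; exact (S.hasProfile_convLog f w).neg)
    (fun w => hasProfile_antipode_mapU f w)

end Log

end LieSplitting

end ExpLog

/-! ### Points of powers of a Lie algebra and their components -/

section Components

variable {k : Type*} [CommRing k] {C D : Type*} [AddCommMonoid C] [Module k C] [Coalgebra k C]
  [Coalgebra.IsCocomm k C] [AddCommMonoid D] [Module k D] [Coalgebra k D]
  [Coalgebra.IsCocomm k D] {X : Type*} [LieRing X] [LieAlgebra k X]

/-- The inclusion of a factor into a power of a Lie algebra. -/
def singleHom (k : Type*) [CommRing k] {n : ℕ} (X : Type*) [LieRing X] [LieAlgebra k X]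
    (i : Fin n) : X →ₗ⁅k⁆ (Fin n → X) :=
  { LinearMap.single k (fun _ => X) i with
    map_lie' := fun {x y} => funext fun j => by
      change (Pi.single i ⁅x, y⁆ : Fin n → X) j
        = ⁅(Pi.single i x : Fin n → X) j, (Pi.single i y : Fin n → X) j⁆
      by_cases h : j = i
      · subst h; simp
      · simp [h] }

@[simp] theorem projHom_apply {n : ℕ} (i : Fin n) (w : Fin n → X) :
    projHom (k := k) i w = w i := rfl

namespace Pt

/-- exp(u) exp(v) = exp(u + v) for commuting u and v, in the form of the binomial theorem. -/
theorem hom_mul_gen_pow {L L' : Type*} [LieRing L] [LieAlgebra k L] [LieRing L']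
    [LieAlgebra k L'] {g h : Pt k (U k L) L'} {w : L} {u v : L'}
    (hg : ∀ n, g.hom (gen k w ^ n) = gen k u ^ n) (hh : ∀ n, h.hom (gen k w ^ n) = gen k v ^ n)
    (huv : ⁅u, v⁆ = 0) (n : ℕ) : (g * h).hom (gen k w ^ n) = gen k (u + v) ^ n := by
  have hc : Commute (gen k u) (gen k v) := by
    have := gen_lie (k := k) u v
    rw [huv, _root_.map_zero] at this
    exact (sub_eq_zero.mp this.symm)
  rw [mul_hom_apply, comul_gen_pow, map_add, hc.add_pow', map_sum, map_sum]
  refine Finset.sum_congr rfl fun m _ => ?_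
  rw [map_nsmul, map_nsmul, TensorProduct.map_tmul, LinearMap.mul'_apply]
  change _ • (g.hom _ * h.hom _) = _
  rw [hg, hh]

theorem list_prod_univ_gen_pow {n : ℕ} (l : List (Fin n)) (hl : l.Nodup) (w : Fin n → X) (j : ℕ) :
    ((l.map fun i => map ((singleHom k X i).comp (projHom i)) (univ k (Fin n → X))).prod).hom
      (gen k w ^ j) = gen k ((l.map fun i => (Pi.single i (w i) : Fin n → X)).sum) ^ j := by
  induction l generalizing j with
  | nil =>
    rw [List.map_nil, List.prod_nil, List.map_nil, List.sum_nil, _root_.map_zero, one_hom_apply,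
      Bialgebra.counit_pow, counit_gen, map_pow, _root_.map_zero]
  | cons i l ih =>
    rw [List.nodup_cons] at hl
    rw [List.map_cons, List.prod_cons, List.map_cons, List.sum_cons]
    refine hom_mul_gen_pow (fun n => ?_) (ih hl.2) ?_ j
    · rw [map_hom_apply, univ_hom_apply, map_pow, mapU_gen]
      rfl
    -- The list has no repetitions, so the remaining summands vanish in the slot i and commute with
    -- the one placed there.
    · have h : ∀ l : List (Fin n), i ∉ l →
          ((l.map fun i => (Pi.single i (w i) : Fin n → X)).sum) i = 0 := by
        intro l
        induction l with
        | nil => intro _; rfl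
        | cons i' l ih' =>
          intro h
          rw [List.mem_cons, not_or] at h
          rw [List.map_cons, List.sum_cons, Pi.add_apply, ih' h.2, Pi.single_eq_of_ne h.1, add_zero]
      funext i'
      change ⁅(Pi.single i (w i) : Fin n → X) i', _⁆ = (0 : X)
      by_cases hi : i' = i
      · subst hi; rw [h l hl.1, lie_zero]
      · rw [Pi.single_eq_of_ne hi, zero_lie]

variable [Algebra ℚ k]

/-- exp of a tuple is the product of the exponentials of its commuting entries. The order is fixed
by the list, as the group of points is not commutative. -/
theorem univ_pi_eq_prod (n : ℕ) : univ k (Fin n → X) = ((List.finRange n).map fun i =>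
    map ((singleHom k X i).comp (projHom i)) (univ k (Fin n → X))).prod := by
  ext c
  induction c using U_pow_induction with
  | zero => rw [_root_.map_zero, _root_.map_zero]
  | add a b ha hb => rw [map_add, map_add, ha, hb]
  | smul r a ha => rw [map_smul, map_smul, ha]
  | pow w j =>
    rw [list_prod_univ_gen_pow _ (List.nodup_finRange n), univ_hom_apply]
    congr 2
    have h : ((List.finRange n).map fun i => (Pi.single i (w i) : Fin n → X)).sum
        = ∑ i, Pi.single i (w i) := by
      rw [← List.ofFn_eq_map, List.sum_ofFn]
    rw [h, Finset.univ_sum_single]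

/-- A point of a power is determined by its components. -/
theorem ext_proj {n : ℕ} {g h : Pt k C (Fin n → X)}
    (H : ∀ i, map (projHom i) g = map (projHom i) h) : g = h := by
  have key : ∀ g : Pt k C (Fin n → X), g = ((List.finRange n).map fun i =>
      map (singleHom k X i) (map (projHom i) g)).prod := by
    intro g
    have h1 := congrArg (comap g.hom) (univ_pi_eq_prod (k := k) (X := X) n)
    rw [map_list_prod, List.map_map] at h1
    refine Eq.trans h1 (congrArg List.prod (List.map_congr_left fun i _ => ?_))
    rw [Function.comp_apply, comap_map, map_map]
    rfl
  rw [key g, key h]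
  simp only [H]

end Pt

/-- An empty leg corresponds to the zero homomorphism, hence to the trivial point. -/
theorem map_projHom_legHom {m n : ℕ} (r : Fin n → Option (Fin m)) (j : Fin n)
    (g : Pt k C (Fin m → X)) : Pt.map (projHom j) (Pt.map (legHom k X r) g)
      = (r j).elim 1 fun i => Pt.map (projHom i) g := by
  have h : (projHom j).comp (legHom k X r) = (r j).elim 0 projHom := rfl
  rw [Pt.map_map, h]
  cases r j with
  | none => exact Pt.map_zero g
  | some i => rfl

namespace LieSplitting

variable {A M L : Type*}
  [LieRing A] [LieAlgebra k A] [LieRing M] [LieAlgebra k M] [LieRing L] [LieAlgebra k L]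
  (S : LieSplitting k A M L)

theorem map_projHom_inA {n : ℕ} (i : Fin n) (g : Pt k C (Fin n → A)) :
    Pt.map (projHom i) (Pt.map (S.pow n).inA g) = Pt.map S.inA (Pt.map (projHom i) g) := by
  rw [Pt.map_map, Pt.map_map]; rfl

theorem map_projHom_inM {n : ℕ} (i : Fin n) (g : Pt k C (Fin n → M)) :
    Pt.map (projHom i) (Pt.map (S.pow n).inM g) = Pt.map S.inM (Pt.map (projHom i) g) := by
  rw [Pt.map_map, Pt.map_map]; rfl

/-- Projecting a factorization in the power to one leg gives a factorization in that leg, so by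
uniqueness factors, actions and dressing are all computed leg by leg. -/
theorem map_projHom_ptA {n : ℕ} (i : Fin n) (g : Pt k C (Fin n → L)) :
    Pt.map (projHom i) ((S.pow n).ptA g) = S.ptA (Pt.map (projHom i) g) :=
  (S.ptA_eq (m := Pt.map (projHom i) ((S.pow n).ptM g)) (by
    rw [← map_projHom_inA, ← map_projHom_inM, ← map_mul, inA_ptA_mul_inM_ptM])).symm

theorem map_projHom_ptM {n : ℕ} (i : Fin n) (g : Pt k C (Fin n → L)) :
    Pt.map (projHom i) ((S.pow n).ptM g) = S.ptM (Pt.map (projHom i) g) :=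
  (S.ptM_eq (a := Pt.map (projHom i) ((S.pow n).ptA g)) (by
    rw [← map_projHom_inA, ← map_projHom_inM, ← map_mul, inA_ptA_mul_inM_ptM])).symm

theorem map_projHom_ptAct {n : ℕ} (i : Fin n) (m : Pt k C (Fin n → M)) (a : Pt k C (Fin n → A)) :
    Pt.map (projHom i) ((S.pow n).ptAct m a)
      = S.ptAct (Pt.map (projHom i) m) (Pt.map (projHom i) a) := by
  rw [ptAct, map_projHom_ptM, map_mul, map_projHom_inA, map_projHom_inM, ptAct]

theorem map_projHom_ptDress {n : ℕ} (i : Fin n) (m : Pt k C (Fin n → M))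
    (a : Pt k C (Fin n → A)) : Pt.map (projHom i) ((S.pow n).ptDress m a)
      = S.ptDress (Pt.map (projHom i) m) (Pt.map (projHom i) a) := by
  rw [ptDress, map_projHom_ptA, map_mul, map_projHom_inA, map_projHom_inM, ptDress]

end LieSplitting

end Components

/-! ### Projections of tensor products of coalgebras -/

section TensorCoalgebra

variable {k : Type*} [CommRing k] {C D E : Type*}
  [AddCommMonoid C] [Module k C] [Coalgebra k C]
  [AddCommMonoid D] [Module k D] [Coalgebra k D]
  [AddCommMonoid E] [Module k E] [Coalgebra k E]

/-- `c ⊗ d ↦ ε(d) c`. -/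
def fstC (k C D : Type*) [CommRing k] [AddCommMonoid C] [Module k C] [Coalgebra k C]
    [AddCommMonoid D] [Module k D] [Coalgebra k D] : C ⊗[k] D →ₗc[k] C :=
  (Coalgebra.TensorProduct.rid k k C).toCoalgHom.comp
    (Coalgebra.TensorProduct.map (CoalgHom.id k C) (Coalgebra.counitCoalgHom k D))

/-- `c ⊗ d ↦ ε(c) d`. -/
def sndC (k C D : Type*) [CommRing k] [AddCommMonoid C] [Module k C] [Coalgebra k C]
    [AddCommMonoid D] [Module k D] [Coalgebra k D] : C ⊗[k] D →ₗc[k] D :=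
  (Coalgebra.TensorProduct.lid k D).toCoalgHom.comp
    (Coalgebra.TensorProduct.map (Coalgebra.counitCoalgHom k C) (CoalgHom.id k D))

@[simp] theorem fstC_tmul (c : C) (d : D) :
    fstC k C D (c ⊗ₜ d) = Coalgebra.counit (R := k) d • c := rfl

@[simp] theorem sndC_tmul (c : C) (d : D) :
    sndC k C D (c ⊗ₜ d) = Coalgebra.counit (R := k) c • d := rfl

/-- The projection to `C` on the left half of the coproduct applies the counit to one half of the
coproduct of d; the counit axiom leaves d whole in the right half. -/
theorem map_fstC_comul {F G : Type*} [AddCommMonoid F] [Module k F] [AddCommMonoid G] [Module k G]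
    (f : C →ₗ[k] F) (g : C ⊗[k] D →ₗ[k] G) (c : C) (d : D) :
    TensorProduct.map (f ∘ₗ (fstC k C D : C ⊗[k] D →ₗ[k] C)) g
      (Coalgebra.comul (R := k) (c ⊗ₜ[k] d))
    = TensorProduct.map f (g ∘ₗ (TensorProduct.mk k C D).flip d) (Coalgebra.comul (R := k) c) := by
  rw [TensorProduct.comul_tmul]
  have h : ∀ (z : C ⊗[k] C) (t : D ⊗[k] D),
      TensorProduct.map (f ∘ₗ (fstC k C D : C ⊗[k] D →ₗ[k] C)) g
        (TensorProduct.AlgebraTensorModule.tensorTensorTensorComm k k k k C C D D (z ⊗ₜ t))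
      = TensorProduct.map f (g ∘ₗ (TensorProduct.mk k C D).flip
          (TensorProduct.lid k D ((Coalgebra.counit (R := k)).rTensor D t))) z := by
    intro z t
    induction t using TensorProduct.induction_on with
    | zero => simp
    | add t s ht hs =>
      simp only [map_add, tmul_add, ht, hs, LinearMap.comp_add, TensorProduct.map_add_right,
        LinearMap.add_apply]
    | tmul a b =>
      induction z using TensorProduct.induction_on with
      | zero => simp
      | add z w hz hw => simp only [add_tmul, map_add, hz, hw]
      | tmul x y =>
        simp
        rw [TensorProduct.smul_tmul']
  rw [h]
  simp

theorem map_sndC_comul {F G : Type*} [AddCommMonoid F] [Module k F] [AddCommMonoid G] [Module k G]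
    (f : D →ₗ[k] F) (g : C ⊗[k] D →ₗ[k] G) (c : C) (d : D) :
    TensorProduct.map (f ∘ₗ (sndC k C D : C ⊗[k] D →ₗ[k] D)) g
      (Coalgebra.comul (R := k) (c ⊗ₜ[k] d))
    = TensorProduct.map f (g ∘ₗ TensorProduct.mk k C D c) (Coalgebra.comul (R := k) d) := by
  rw [TensorProduct.comul_tmul]
  have h : ∀ (z : C ⊗[k] C) (t : D ⊗[k] D),
      TensorProduct.map (f ∘ₗ (sndC k C D : C ⊗[k] D →ₗ[k] D)) g
        (TensorProduct.AlgebraTensorModule.tensorTensorTensorComm k k k k C C D D (z ⊗ₜ t))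
      = TensorProduct.map f (g ∘ₗ TensorProduct.mk k C D
          (TensorProduct.lid k C ((Coalgebra.counit (R := k)).rTensor C z))) t := by
    intro z t
    induction z using TensorProduct.induction_on with
    | zero => simp
    | add z w hz hw =>
      simp only [map_add, add_tmul, hz, hw, LinearMap.comp_add, TensorProduct.map_add_right,
        LinearMap.add_apply]
    | tmul a b =>
      induction t using TensorProduct.induction_on with
      | zero => simp
      | add z w hz hw => simp only [tmul_add, map_add, hz, hw]
      | tmul x y =>
        simp
        rw [TensorProduct.smul_tmul']
  rw [h]
  simp

variable [Coalgebra.IsCocomm k C]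

/-- For a cocommutative source the tensor product behaves as a categorical product, with `fstC`,
`sndC` and `pairHom` as projections and pairing. -/
theorem fstC_comp_pairHom (f : C →ₗc[k] D) (g : C →ₗc[k] E) :
    (fstC k D E).comp (pairHom f g) = f := by
  ext c
  change fstC k D E (TensorProduct.map (f : C →ₗ[k] D) (g : C →ₗ[k] E) (Coalgebra.comul c)) = _
  have h : ∀ z, fstC k D E (TensorProduct.map (f : C →ₗ[k] D) (g : C →ₗ[k] E) z)
      = f (TensorProduct.rid k C ((Coalgebra.counit (R := k)).lTensor C z)) := by
    intro z
    induction z using TensorProduct.induction_on with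
    | zero => simp
    | add z w hz hw => simp only [map_add, hz, hw]
    | tmul a b => simp
  rw [h]
  simp

theorem sndC_comp_pairHom (f : C →ₗc[k] D) (g : C →ₗc[k] E) :
    (sndC k D E).comp (pairHom f g) = g := by
  ext c
  change sndC k D E (TensorProduct.map (f : C →ₗ[k] D) (g : C →ₗ[k] E) (Coalgebra.comul c)) = _
  have h : ∀ z, sndC k D E (TensorProduct.map (f : C →ₗ[k] D) (g : C →ₗ[k] E) z)
      = g (TensorProduct.lid k C ((Coalgebra.counit (R := k)).rTensor C z)) := by
    intro z
    induction z using TensorProduct.induction_on with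
    | zero => simp
    | add z w hz hw => simp only [map_add, hz, hw]
    | tmul a b => simp
  rw [h]
  simp

end TensorCoalgebra

/-! ### Symbols of points and of twisted points in the smash product -/

section SymbolsOfPoints

variable {k : Type*} [CommRing k] {A M L : Type*}
  [LieRing A] [LieAlgebra k A] [LieRing M] [LieAlgebra k M] [LieRing L] [LieAlgebra k L]

/-- Points over the two factors, pulled back to the tensor product and multiplied, give the external
product. This connects operations defined on pure tensors with the group of points. -/
theorem tensor_pt_mul_apply {C D X : Type*} [AddCommMonoid C] [Module k C] [Coalgebra k C]
    [Coalgebra.IsCocomm k C] [AddCommMonoid D] [Module k D] [Coalgebra k D]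
    [Coalgebra.IsCocomm k D] [LieRing X] [LieAlgebra k X] (f : Pt k C X) (g : Pt k D X)
    (c : C) (d : D) : (Pt.comap (fstC k C D) f * Pt.comap (sndC k C D) g).hom (c ⊗ₜ d)
      = f.hom c * g.hom d := by
  rw [Pt.mul_hom_apply]
  change LinearMap.mul' k (U k X) (TensorProduct.map
    ((f.hom : C →ₗ[k] U k X) ∘ₗ (fstC k C D : C ⊗[k] D →ₗ[k] C))
    ((g.hom : D →ₗ[k] U k X) ∘ₗ (sndC k C D : C ⊗[k] D →ₗ[k] D)) _) = _
  rw [map_fstC_comul]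
  have h : ∀ z, LinearMap.mul' k (U k X) (TensorProduct.map (f.hom : C →ₗ[k] U k X)
      (((g.hom : D →ₗ[k] U k X) ∘ₗ (sndC k C D : C ⊗[k] D →ₗ[k] D)) ∘ₗ
        (TensorProduct.mk k C D).flip d) z)
      = f.hom (TensorProduct.rid k C ((Coalgebra.counit (R := k)).lTensor C z)) * g.hom d := by
    intro z
    induction z using TensorProduct.induction_on with
    | zero => simp
    | add z w hz hw => simp only [map_add, hz, hw, add_mul]
    | tmul a b => simp
  rw [h]
  simp

namespace LieSplitting

variable (S : LieSplitting k A M L)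

/-- The universal action as a morphism of coalgebras. -/
def actC : U k M ⊗[k] U k A →ₗc[k] U k M :=
  (S.ptAct (Pt.of (fstC k (U k M) (U k A))) (Pt.of (sndC k (U k M) (U k A)))).hom

theorem actC_eq : (S.actC : U k M ⊗[k] U k A →ₗ[k] U k M) = S.act := by
  refine TensorProduct.ext' fun c u => ?_
  change S.piM ((Pt.comap (fstC k (U k M) (U k A)) (Pt.map S.inM (Pt.univ k M)) *
    Pt.comap (sndC k (U k M) (U k A)) (Pt.map S.inA (Pt.univ k A))).hom (c ⊗ₜ u)) = _
  rw [tensor_pt_mul_apply]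
  rfl

/-- Identifies the linear dressing map with its version for points, over the tensor product of the
two parameter coalgebras. -/
theorem dress_map {C D : Type*} [AddCommMonoid C] [Module k C] [Coalgebra k C]
    [Coalgebra.IsCocomm k C] [AddCommMonoid D] [Module k D] [Coalgebra k D]
    [Coalgebra.IsCocomm k D] (m : Pt k C M) (a : Pt k D A) (z : C ⊗[k] D) :
    S.dress (TensorProduct.map (m.hom : C →ₗ[k] U k M) (a.hom : D →ₗ[k] U k A) z)
      = (S.ptDress (Pt.comap (fstC k C D) m) (Pt.comap (sndC k C D) a)).hom z := by
  induction z using TensorProduct.induction_on with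
  | zero => simp
  | add z w hz hw => simp only [map_add, hz, hw]
  | tmul c d =>
    change _ = S.piA ((Pt.comap (fstC k C D) (Pt.map S.inM m) *
      Pt.comap (sndC k C D) (Pt.map S.inA a)).hom (c ⊗ₜ d))
    rw [tensor_pt_mul_apply]
    rfl

/-- The symbol of a point. -/
def ofPt (g : Pt k (U k M) A) : S.Sym := S.toSym (g.hom : U k M →ₗ[k] U k A)

@[simp] theorem ofPt_apply (g : Pt k (U k M) A) (c : U k M) : S.ofPt g c = g.hom c := rfl

/-- The translation `c ↦ c₁ ◁ R(c₂)`. -/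
def shift (R : Pt k (U k M) A) : Pt k (U k M) M := S.ptAct (Pt.univ k M) R

theorem actC_comp_pairHom (R : Pt k (U k M) A) :
    S.actC.comp (pairHom (CoalgHom.id k (U k M)) R.hom) = (S.shift R).hom := by
  have h := S.comap_ptAct (pairHom (CoalgHom.id k (U k M)) R.hom)
    (Pt.of (fstC k (U k M) (U k A))) (Pt.of (sndC k (U k M) (U k A)))
  have h1 : Pt.comap (pairHom (CoalgHom.id k (U k M)) R.hom) (Pt.of (fstC k (U k M) (U k A)))
      = Pt.univ k M := fstC_comp_pairHom _ _
  have h2 : Pt.comap (pairHom (CoalgHom.id k (U k M)) R.hom) (Pt.of (sndC k (U k M) (U k A)))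
      = R := sndC_comp_pairHom _ _
  rw [h1, h2] at h
  exact h

/-- Rewriting the twisted evaluation through coalgebra morphisms and one coproduct allows further
coalgebra morphisms to be substituted into it. -/
theorem applyAct_eq (ψ : U k M →ₗ[k] U k A) : S.applyAct ψ = LinearMap.mul' k (U k A) ∘ₗ
    TensorProduct.map (sndC k (U k M) (U k A) : U k M ⊗[k] U k A →ₗ[k] U k A)
      (ψ ∘ₗ (S.actC : U k M ⊗[k] U k A →ₗ[k] U k M)) ∘ₗ Coalgebra.comul (R := k) := by
  refine TensorProduct.ext' fun c v => ?_
  have h := map_sndC_comul (k := k) LinearMap.id (ψ ∘ₗ (S.actC : U k M ⊗[k] U k A →ₗ[k] U k M)) c v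
  rw [LinearMap.id_comp] at h
  rw [LinearMap.comp_apply, LinearMap.comp_apply, h, actC_eq, applyAct, LinearMap.comp_apply,
    LinearMap.comp_apply, LinearMap.comp_apply, LinearMap.lTensor_tmul]
  generalize Coalgebra.comul (R := k) v = z
  induction z using TensorProduct.induction_on with
  | zero => simp
  | add z w hz hw => simp only [map_add, tmul_add, hz, hw]
  | tmul a b => simp

/-- Left multiplication by the symbol of a point: `(R φ)(c) = R(c₁) φ(c₂ ◁ R(c₃))`. -/
theorem ofPt_mul_apply (R : Pt k (U k M) A) (φ : S.Sym) (c : U k M) :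
    (S.ofPt R * φ) c = LinearMap.mul' k (U k A) (TensorProduct.map (R.hom : U k M →ₗ[k] U k A)
      (S.toSym.symm φ ∘ₗ ((S.shift R).hom : U k M →ₗ[k] U k M)) (Coalgebra.comul (R := k) c)) := by
  have h1 : (S.ofPt R * φ) c = S.applyAct (S.toSym.symm φ)
      (pairHom (CoalgHom.id k (U k M)) R.hom c) := rfl
  rw [h1, applyAct_eq, LinearMap.comp_apply, LinearMap.comp_apply,
    ← CoalgHomClass.map_comp_comul_apply, ← LinearMap.comp_apply (TensorProduct.map _ _),
    ← TensorProduct.map_comp]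
  congr 2
  rw [← actC_comp_pairHom]
  have h2 := sndC_comp_pairHom (CoalgHom.id k (U k M)) R.hom
  congr 1
  exact congrArg (fun f : U k M →ₗc[k] U k A => (f : U k M →ₗ[k] U k A)) h2

/-- On points: (RT)(κ) = R(κ) T(κ ◁ R(κ)). -/
theorem ofPt_mul_ofPt (R T : Pt k (U k M) A) :
    S.ofPt R * S.ofPt T = S.ofPt (R * Pt.comap (S.shift R).hom T) := by
  ext c
  rw [ofPt_mul_apply]
  rfl

theorem ofPt_one : S.ofPt 1 = 1 := rfl

/-- The symbol `c ↦ Φ(c₁ ⊗ l(c₂))`. -/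
def twisted {P : Type*} [AddCommMonoid P] [Module k P] [Coalgebra k P]
    (Φ : Pt k (U k M ⊗[k] P) A) (l : U k M →ₗ[k] P) : S.Sym :=
  S.toSym ((Φ.hom : U k M ⊗[k] P →ₗ[k] U k A) ∘ₗ l.lTensor (U k M) ∘ₗ Coalgebra.comul (R := k))

variable {P : Type*} [AddCommMonoid P] [Module k P] [Coalgebra k P]

theorem twisted_apply (Φ : Pt k (U k M ⊗[k] P) A) (l : U k M →ₗ[k] P) (c : U k M) :
    S.twisted Φ l c = Φ.hom (l.lTensor (U k M) (Coalgebra.comul (R := k) c)) := rfl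

/-- Coassociativity: splitting off the first tensor factor of c₁ ⊗ l(c₂) again is the same as
splitting c first. No compatibility of l with coproducts is needed. -/
theorem map_fstC_comul_lTensor {F G : Type*} [AddCommMonoid F] [Module k F] [AddCommMonoid G]
    [Module k G] (f : U k M →ₗ[k] F) (g : U k M ⊗[k] P →ₗ[k] G) (l : U k M →ₗ[k] P) (c : U k M) :
    TensorProduct.map (f ∘ₗ (fstC k (U k M) P : U k M ⊗[k] P →ₗ[k] U k M)) g
      (Coalgebra.comul (R := k) (l.lTensor (U k M) (Coalgebra.comul (R := k) c)))
    = TensorProduct.map f (g ∘ₗ l.lTensor (U k M) ∘ₗ Coalgebra.comul (R := k))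
      (Coalgebra.comul (R := k) c) := by
  have h1 : ∀ z : U k M ⊗[k] U k M,
      TensorProduct.map (f ∘ₗ (fstC k (U k M) P : U k M ⊗[k] P →ₗ[k] U k M)) g
        (Coalgebra.comul (R := k) (l.lTensor (U k M) z))
      = TensorProduct.map f (g ∘ₗ l.lTensor (U k M)) (TensorProduct.assoc k _ _ _
          ((Coalgebra.comul (R := k)).rTensor (U k M) z)) := by
    intro z
    induction z using TensorProduct.induction_on with
    | zero => simp
    | add z w hz hw => simp only [map_add, hz, hw]
    | tmul a b =>
      rw [LinearMap.lTensor_tmul, map_fstC_comul, LinearMap.rTensor_tmul]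
      generalize Coalgebra.comul (R := k) a = z
      induction z using TensorProduct.induction_on with
      | zero => simp
      | add z w hz hw => simp only [map_add, add_tmul, hz, hw]
      | tmul x y => simp
  rw [h1, Coalgebra.coassoc_apply]
  generalize Coalgebra.comul (R := k) c = z
  induction z using TensorProduct.induction_on with
  | zero => simp
  | add z w hz hw => simp only [map_add, hz, hw]
  | tmul x y => simp

theorem twisted_counit_smulRight (Φ : Pt k (U k M ⊗[k] P) A) (p : P) (c : U k M) :
    S.twisted Φ ((Coalgebra.counit (R := k)).smulRight p) c = Φ.hom (c ⊗ₜ p) := by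
  have h : ∀ z : U k M ⊗[k] U k M,
      ((Coalgebra.counit (R := k) (A := U k M)).smulRight p).lTensor (U k M) z
      = (TensorProduct.rid k _ ((Coalgebra.counit (R := k)).lTensor _ z)) ⊗ₜ p := by
    intro z
    induction z using TensorProduct.induction_on with
    | zero => simp
    | add z w hz hw => simp only [map_add, add_tmul, hz, hw]
    | tmul x y => simp [TensorProduct.smul_tmul]
  rw [twisted_apply, h]
  simp

variable [Coalgebra.IsCocomm k P]

/-- On group-like arguments the product is R(κ) Φ(κ', l(κ')) with κ' = κ ◁ R(κ). The substitution κ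
↦ κ' is made in the point Φ and in the linear map l separately. -/
theorem ofPt_mul_twisted (R : Pt k (U k M) A) (Φ : Pt k (U k M ⊗[k] P) A) (l : U k M →ₗ[k] P) :
    S.ofPt R * S.twisted Φ l = S.twisted (Pt.comap (fstC k (U k M) P) R *
      Pt.comap (Coalgebra.TensorProduct.map (S.shift R).hom (CoalgHom.id k P)) Φ)
      (l ∘ₗ ((S.shift R).hom : U k M →ₗ[k] U k M)) := by
  ext c
  rw [ofPt_mul_apply, twisted_apply, Pt.mul_hom_apply]
  congr 1
  refine Eq.trans ?_ (map_fstC_comul_lTensor (R.hom : U k M →ₗ[k] U k A) _ _ c).symm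
  congr 2
  refine LinearMap.ext fun d => ?_
  change Φ.hom (l.lTensor (U k M) (Coalgebra.comul (R := k) ((S.shift R).hom d))) = _
  rw [← CoalgHomClass.map_comp_comul_apply]
  change _ = Φ.hom (TensorProduct.map ((S.shift R).hom : U k M →ₗ[k] U k M) LinearMap.id
    ((l ∘ₗ ((S.shift R).hom : U k M →ₗ[k] U k M)).lTensor (U k M) (Coalgebra.comul (R := k) d)))
  congr 1
  generalize Coalgebra.comul (R := k) d = z
  induction z using TensorProduct.induction_on with
  | zero => simp
  | add z w hz hw => simp only [map_add, hz, hw]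
  | tmul x y => simp

/-- On group-like arguments the product is Φ(κ, l(κ)) R(κ ◁ Φ(κ, l(κ))). The parameter in `P` is
shared by both factors, and l itself is unchanged. -/
theorem twisted_mul_ofPt (R : Pt k (U k M) A) (Φ : Pt k (U k M ⊗[k] P) A) (l : U k M →ₗ[k] P) :
    S.twisted Φ l * S.ofPt R
      = S.twisted (Φ * Pt.comap (S.ptAct (Pt.of (fstC k (U k M) P)) Φ).hom R) l := by
  ext c
  have h1 : (S.twisted Φ l * S.ofPt R) c = S.applyAct (R.hom : U k M →ₗ[k] U k A)
      ((S.toSym.symm (S.twisted Φ l)).lTensor (U k M) (Coalgebra.comul (R := k) c)) := rfl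
  have h2 : (S.toSym.symm (S.twisted Φ l)).lTensor (U k M) (Coalgebra.comul (R := k) c)
      = pairHom (fstC k (U k M) P) Φ.hom (l.lTensor (U k M) (Coalgebra.comul (R := k) c)) := by
    have h := map_fstC_comul_lTensor LinearMap.id (Φ.hom : U k M ⊗[k] P →ₗ[k] U k A) l c
    rw [LinearMap.id_comp] at h
    exact h.symm
  rw [h1, h2, twisted_apply, applyAct_eq, LinearMap.comp_apply, LinearMap.comp_apply,
    ← CoalgHomClass.map_comp_comul_apply, ← LinearMap.comp_apply (TensorProduct.map _ _),
    ← TensorProduct.map_comp, Pt.mul_hom_apply]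
  congr 2
  have h3 := sndC_comp_pairHom (fstC k (U k M) P) Φ.hom
  have h4 := fstC_comp_pairHom (fstC k (U k M) P) Φ.hom
  have h5 : S.actC.comp (pairHom (fstC k (U k M) P) Φ.hom)
      = (S.ptAct (Pt.of (fstC k (U k M) P)) Φ).hom := by
    have h := S.comap_ptAct (pairHom (fstC k (U k M) P) Φ.hom)
      (Pt.of (fstC k (U k M) (U k A))) (Pt.of (sndC k (U k M) (U k A)))
    have h1 : Pt.comap (pairHom (fstC k (U k M) P) Φ.hom) (Pt.of (fstC k (U k M) (U k A)))
        = Pt.of (fstC k (U k M) P) := h4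
    have h2 : Pt.comap (pairHom (fstC k (U k M) P) Φ.hom) (Pt.of (sndC k (U k M) (U k A)))
        = Φ := h3
    rw [h1, h2] at h
    exact h
  congr 1
  · exact congrArg (fun f : U k M ⊗[k] P →ₗc[k] U k A => (f : U k M ⊗[k] P →ₗ[k] U k A)) h3
  · exact congrArg (fun f : U k M ⊗[k] P →ₗc[k] U k M =>
      (R.hom : U k M →ₗ[k] U k A) ∘ₗ (f : U k M ⊗[k] P →ₗ[k] U k M)) h5

section Coproducts

variable {m n : ℕ}

theorem embed_ofPt (ins : Fin n → Option (Fin m)) (res : Fin m → Option (Fin n))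
    (R : Pt k (U k (Fin m → M)) (Fin m → A)) : S.embed ins res ((S.pow m).ofPt R)
      = (S.pow n).ofPt (Pt.map (legHom k A ins)
        (Pt.comap (Pt.map (legHom k M res) (Pt.univ k (Fin n → M))).hom R)) := rfl

theorem embed_twisted (ins : Fin n → Option (Fin m)) (res : Fin m → Option (Fin n))
    (Φ : Pt k (U k (Fin m → M) ⊗[k] P) (Fin m → A)) (l : U k (Fin m → M) →ₗ[k] P) :
    S.embed ins res ((S.pow m).twisted Φ l) = (S.pow n).twisted (Pt.map (legHom k A ins)
      (Pt.comap (Coalgebra.TensorProduct.map (mapC (legHom k M res)) (CoalgHom.id k P)) Φ))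
      (l ∘ₗ (mapU (legHom k M res)).toLinearMap) := by
  ext c
  rw [embed_apply, twisted_apply, twisted_apply, Pt.map_hom_apply, Pt.comap_hom_apply, comul_mapU]
  change _ = mapU (legHom k A ins) (Φ.hom (TensorProduct.map (mapU (legHom k M res)).toLinearMap
    LinearMap.id _))
  congr 2
  generalize Coalgebra.comul (R := k) c = z
  induction z using TensorProduct.induction_on with
  | zero => simp
  | add z w hz hw => simp only [map_add, hz, hw]
  | tmul x y => simp

/-- The multiplication `(α, β)` of legs. -/
def legMul (α β : Fin m → Option (Fin n)) : Pt k (U k (Fin n → M)) (Fin m → M) :=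
  Pt.map (legHom k M α) (Pt.univ k _) * Pt.map (legHom k M β) (Pt.univ k _)

/-- The coproduct separates into the universal point (κ, a) ↦ τ(κ) ▷ δ(a), which does not involve φ,
and the linear map κ ↦ φ(α(κ) β(κ)). Identities for arbitrary φ thereby reduce to identities of
points. -/
theorem coprod_eq_twisted (δ : Fin n → Option (Fin m)) (α β : Fin m → Option (Fin n))
    (τ : Fin n → Option (Fin n)) (φ : S.T m) : S.coprod δ α β τ φ
      = (S.pow n).twisted ((S.pow n).ptDress
        (Pt.comap (fstC k _ (U k (Fin m → A))) (Pt.map (legHom k M τ) (Pt.univ k _)))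
        (Pt.comap (sndC k _ _) (Pt.map (legHom k A δ) (Pt.univ k _))))
        ((S.pow m).toSym.symm φ ∘ₗ ((legMul α β : Pt k (U k (Fin n → M)) (Fin m → M)).hom :
          U k (Fin n → M) →ₗ[k] U k (Fin m → M))) := by
  ext c
  rw [coprod_apply, twisted_apply, ← dress_map]
  congr 1
  generalize Coalgebra.comul (R := k) c = z
  induction z using TensorProduct.induction_on with
  | zero => simp
  | add z w hz hw => simp only [map_add, hz, hw]
  | tmul x y => rfl

theorem coprod_ofPt (δ : Fin n → Option (Fin m)) (α β : Fin m → Option (Fin n))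
    (τ : Fin n → Option (Fin n)) (R : Pt k (U k (Fin m → M)) (Fin m → A)) :
    S.coprod δ α β τ ((S.pow m).ofPt R) = (S.pow n).ofPt ((S.pow n).ptDress
      (Pt.map (legHom k M τ) (Pt.univ k _)) (Pt.map (legHom k A δ)
        (Pt.comap (legMul α β : Pt k (U k (Fin n → M)) (Fin m → M)).hom R))) := by
  ext c
  rw [coprod_eq_twisted, twisted_apply, ofPt_apply]
  have h1 := (S.pow n).comap_ptDress (pairHom (CoalgHom.id k (U k (Fin n → M)))
    (Pt.comap (legMul α β : Pt k (U k (Fin n → M)) (Fin m → M)).hom R).hom)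
    (Pt.comap (fstC k _ (U k (Fin m → A))) (Pt.map (legHom k M τ) (Pt.univ k _)))
    (Pt.comap (sndC k _ _) (Pt.map (legHom k A δ) (Pt.univ k _)))
  have h2 : Pt.comap (pairHom (CoalgHom.id k (U k (Fin n → M)))
      (Pt.comap (legMul α β : Pt k (U k (Fin n → M)) (Fin m → M)).hom R).hom)
      (Pt.comap (fstC k _ (U k (Fin m → A))) (Pt.map (legHom k M τ) (Pt.univ k _)))
      = Pt.map (legHom k M τ) (Pt.univ k _) :=
    congrArg (fun f => Pt.comap f (Pt.map (legHom k M τ) (Pt.univ k _))) (fstC_comp_pairHom _ _)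
  have h3 : Pt.comap (pairHom (CoalgHom.id k (U k (Fin n → M)))
      (Pt.comap (legMul α β : Pt k (U k (Fin n → M)) (Fin m → M)).hom R).hom)
      (Pt.comap (sndC k _ _) (Pt.map (legHom k A δ) (Pt.univ k _)))
      = Pt.map (legHom k A δ)
        (Pt.comap (legMul α β : Pt k (U k (Fin n → M)) (Fin m → M)).hom R) :=
    congrArg (fun f => Pt.comap f (Pt.map (legHom k A δ) (Pt.univ k _))) (sndC_comp_pairHom _ _)
  rw [h2, h3] at h1
  rw [← h1]
  rfl

end Coproducts

end LieSplitting

end SymbolsOfPoints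

/-! ### Points of products of Lie algebras and commuting points -/

section Products

variable {k : Type*} [CommRing k] {C D : Type*} [AddCommMonoid C] [Module k C] [Coalgebra k C]
  [Coalgebra.IsCocomm k C] [AddCommMonoid D] [Module k D] [Coalgebra k D]
  [Coalgebra.IsCocomm k D]

namespace Pt

variable [Algebra ℚ k] {X Y Z : Type*} [LieRing X] [LieAlgebra k X] [LieRing Y] [LieAlgebra k Y]
  [LieRing Z] [LieAlgebra k Z]

/-- Checked on powers of w, where it is exp(f(w) + g(w)) = exp(f(w)) exp(g(w)) for commuting
summands. -/
theorem map_eq_mul_of_add {f g h : X →ₗ⁅k⁆ Z} (hadd : ∀ x, h x = f x + g x)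
    (hcomm : ∀ x, ⁅f x, g x⁆ = 0) (a : Pt k C X) : map h a = map f a * map g a := by
  suffices H : map h (univ k X) = map f (univ k X) * map g (univ k X) by
    have H' := congrArg (comap a.hom) H
    rw [map_mul] at H'
    exact H'
  ext c
  induction c using U_pow_induction with
  | zero => rw [_root_.map_zero, _root_.map_zero]
  | add a b ha hb => rw [map_add, map_add, ha, hb]
  | smul r a ha => rw [map_smul, map_smul, ha]
  | pow w j =>
    rw [hom_mul_gen_pow (u := f w) (v := g w) (fun n => by simp) (fun n => by simp) (hcomm w),
      ← hadd]
    simp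

/-- The components of a point of a product. -/
theorem inl_mul_inr (a : Pt k C (X × Y)) :
    map (LieHom.inl k X Y) (map (LieHom.fst k X Y) a)
      * map (LieHom.inr k X Y) (map (LieHom.snd k X Y) a) = a := by
  rw [map_map, map_map]
  conv_rhs => rw [← map_id a]
  refine (map_eq_mul_of_add (fun x => ?_) (fun x => ?_) a).symm
  · simp
  · simp

theorem ext_prod {a b : Pt k C (X × Y)}
    (h1 : map (LieHom.fst k X Y) a = map (LieHom.fst k X Y) b)
    (h2 : map (LieHom.snd k X Y) a = map (LieHom.snd k X Y) b) : a = b := by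
  rw [← inl_mul_inr a, ← inl_mul_inr b, h1, h2]

/-- The point of a product with given components. -/
def mkProd (a : Pt k C X) (b : Pt k C Y) : Pt k C (X × Y) :=
  map (LieHom.inl k X Y) a * map (LieHom.inr k X Y) b

omit [Algebra ℚ k] in
@[simp] theorem fst_mkProd (a : Pt k C X) (b : Pt k C Y) :
    map (LieHom.fst k X Y) (mkProd a b) = a := by
  have h1 : (LieHom.fst k X Y).comp (LieHom.inl k X Y) = LieHom.id := rfl
  have h2 : (LieHom.fst k X Y).comp (LieHom.inr k X Y) = 0 := rfl
  rw [mkProd, map_mul, map_map, map_map, h1, h2, map_id, map_zero, mul_one]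

omit [Algebra ℚ k] in
@[simp] theorem snd_mkProd (a : Pt k C X) (b : Pt k C Y) :
    map (LieHom.snd k X Y) (mkProd a b) = b := by
  have h1 : (LieHom.snd k X Y).comp (LieHom.inl k X Y) = 0 := rfl
  have h2 : (LieHom.snd k X Y).comp (LieHom.inr k X Y) = LieHom.id := rfl
  rw [mkProd, map_mul, map_map, map_map, h1, h2, map_id, map_zero, one_mul]

/-- The sum of the two homomorphisms is a homomorphism on the product, and its value on a pair
factors in either order. -/
theorem commute_map {f : X →ₗ⁅k⁆ Z} {g : Y →ₗ⁅k⁆ Z} (hcomm : ∀ x y, ⁅f x, g y⁆ = 0)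
    (a : Pt k C X) (b : Pt k C Y) : map f a * map g b = map g b * map f a := by
  let h : X × Y →ₗ⁅k⁆ Z :=
    { (f : X →ₗ[k] Z) ∘ₗ LinearMap.fst k X Y + (g : Y →ₗ[k] Z) ∘ₗ LinearMap.snd k X Y with
      map_lie' := fun {v w} => by
        have h1 : ⁅g v.2, f w.1⁆ = 0 := by rw [← lie_skew, hcomm, neg_zero]
        change f ⁅v.1, w.1⁆ + g ⁅v.2, w.2⁆ = ⁅f v.1 + g v.2, f w.1 + g w.2⁆
        rw [LieHom.map_lie, LieHom.map_lie, add_lie, lie_add, lie_add, hcomm, h1, add_zero,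
          zero_add] }
  have h1 := map_eq_mul_of_add (f := f.comp (LieHom.fst k X Y)) (g := g.comp (LieHom.snd k X Y))
    (h := h) (fun _ => rfl) (fun x => hcomm _ _) (mkProd a b)
  have h2 := map_eq_mul_of_add (f := g.comp (LieHom.snd k X Y)) (g := f.comp (LieHom.fst k X Y))
    (h := h) (fun _ => add_comm _ _) (fun x => by
      rw [← lie_skew]
      exact neg_eq_zero.mpr (hcomm _ _)) (mkProd a b)
  rw [h1] at h2
  simp only [← map_map, fst_mkProd, snd_mkProd] at h2
  exact h2

end Pt

end Products

/-! ### Group identities for the decomposition A × A = diag(A) ⊕ (P × N) -/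

section Double

variable {k : Type*} [CommRing k] {A P N L H : Type*}
  [LieRing A] [LieAlgebra k A] [LieRing P] [LieAlgebra k P] [LieRing N] [LieAlgebra k N]
  [LieRing L] [LieAlgebra k L] [LieRing H] [LieAlgebra k H]

/-- A decomposition `L = A ⊕ (P × N)` which comes from `A × A = diag(A) ⊕ (P × N)`, where the ideal
`H` of `A` is the direct sum of its subalgebras `N` and `P`. -/
structure DoubleSplitting (S : LieSplitting k A (P × N) L) (H : Type*) [LieRing H]
    [LieAlgebra k H] where
  plus : P →ₗ⁅k⁆ A
  minus : N →ₗ⁅k⁆ A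
  pr₁ : L →ₗ⁅k⁆ A
  pr₂ : L →ₗ⁅k⁆ A
  pr₁_inA : pr₁.comp S.inA = LieHom.id
  pr₂_inA : pr₂.comp S.inA = LieHom.id
  pr₁_inM : pr₁.comp S.inM = plus.comp (LieHom.fst k P N)
  pr₂_inM : pr₂.comp S.inM = minus.comp (LieHom.snd k P N)
  T : LieSplitting k N P H
  j₁ : H →ₗ⁅k⁆ L
  j₂ : H →ₗ⁅k⁆ L
  lie_j : ∀ x y, ⁅j₁ x, j₂ y⁆ = 0
  inM_eq : ∀ v, S.inM v = j₁ (T.inM v.1) + j₂ (T.inA v.2)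
  inA_plus : ∀ p, S.inA (plus p) = j₁ (T.inM p) + j₂ (T.inM p)
  inA_minus : ∀ n, S.inA (minus n) = j₁ (T.inA n) + j₂ (T.inA n)

namespace DoubleSplitting

variable {S : LieSplitting k A (P × N) L} (W : DoubleSplitting S H)

variable {C D : Type*} [AddCommMonoid C] [Module k C] [Coalgebra k C]
  [Coalgebra.IsCocomm k C] [AddCommMonoid D] [Module k D] [Coalgebra k D]
  [Coalgebra.IsCocomm k D]

/-- The component in `P` of a point, as a point of `A`. -/
def pl : Pt k C (P × N) →* Pt k C A := Pt.map (W.plus.comp (LieHom.fst k P N))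

/-- The component in `N` of a point, as a point of `A`. -/
def mi : Pt k C (P × N) →* Pt k C A := Pt.map (W.minus.comp (LieHom.snd k P N))

theorem pl_apply (m : Pt k C (P × N)) :
    W.pl m = Pt.map W.plus (Pt.map (LieHom.fst k P N) m) := (Pt.map_map _ _ _).symm

theorem mi_apply (m : Pt k C (P × N)) :
    W.mi m = Pt.map W.minus (Pt.map (LieHom.snd k P N) m) := (Pt.map_map _ _ _).symm

/-- Project ma = (m ▷ a)(m ◁ a) to the first copy of `A`: the diagonal factor goes to itself and a
point of `P × N` to its `P`-part. The second copy gives the analogous statement for `N`. -/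
theorem dress_mul_pl (m : Pt k C (P × N)) (a : Pt k C A) :
    S.ptDress m a * W.pl (S.ptAct m a) = W.pl m * a := by
  have h := congrArg (Pt.map W.pr₁) (S.inM_mul_inA m a)
  rw [map_mul, map_mul, Pt.map_map, Pt.map_map, Pt.map_map, Pt.map_map, W.pr₁_inA, W.pr₁_inM,
    Pt.map_id, Pt.map_id] at h
  exact h.symm

theorem dress_mul_mi (m : Pt k C (P × N)) (a : Pt k C A) :
    S.ptDress m a * W.mi (S.ptAct m a) = W.mi m * a := by
  have h := congrArg (Pt.map W.pr₂) (S.inM_mul_inA m a)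
  rw [map_mul, map_mul, Pt.map_map, Pt.map_map, Pt.map_map, Pt.map_map, W.pr₂_inA, W.pr₂_inM,
    Pt.map_id, Pt.map_id] at h
  exact h.symm

/-- The element `y_{P} x_{N}` of `H`. -/
def cross (x y : Pt k C (P × N)) : Pt k C H :=
  Pt.map W.T.inM (Pt.map (LieHom.fst k P N) y) * Pt.map W.T.inA (Pt.map (LieHom.snd k P N) x)

theorem cross_eq (x y : Pt k C (P × N)) : W.cross x y
    = Pt.map W.T.inA (W.T.ptA (W.cross x y)) * Pt.map W.T.inM (W.T.ptM (W.cross x y)) :=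
  (W.T.inA_ptA_mul_inM_ptM _).symm

variable [Algebra ℚ k]

theorem map_j_comm (a b : Pt k C H) :
    Pt.map W.j₁ a * Pt.map W.j₂ b = Pt.map W.j₂ b * Pt.map W.j₁ a :=
  Pt.commute_map W.lie_j a b

theorem map_inM_eq (m : Pt k C (P × N)) : Pt.map S.inM m
    = Pt.map W.j₁ (Pt.map W.T.inM (Pt.map (LieHom.fst k P N) m))
      * Pt.map W.j₂ (Pt.map W.T.inA (Pt.map (LieHom.snd k P N) m)) := by
  simp only [Pt.map_map]
  exact Pt.map_eq_mul_of_add (f := W.j₁.comp (W.T.inM.comp (LieHom.fst k P N)))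
    (g := W.j₂.comp (W.T.inA.comp (LieHom.snd k P N))) (h := S.inM)
    W.inM_eq (fun x => W.lie_j _ _) m

theorem map_inA_plus (p : Pt k C P) : Pt.map S.inA (Pt.map W.plus p)
    = Pt.map W.j₁ (Pt.map W.T.inM p) * Pt.map W.j₂ (Pt.map W.T.inM p) := by
  simp only [Pt.map_map]
  exact Pt.map_eq_mul_of_add (f := W.j₁.comp W.T.inM)
    (g := W.j₂.comp W.T.inM) (h := S.inA.comp W.plus)
    W.inA_plus (fun x => W.lie_j _ _) p

theorem map_inA_minus (n : Pt k C N) : Pt.map S.inA (Pt.map W.minus n)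
    = Pt.map W.j₁ (Pt.map W.T.inA n) * Pt.map W.j₂ (Pt.map W.T.inA n) := by
  simp only [Pt.map_map]
  exact Pt.map_eq_mul_of_add (f := W.j₁.comp W.T.inA)
    (g := W.j₂.comp W.T.inA) (h := S.inA.comp W.minus)
    W.inA_minus (fun x => W.lie_j _ _) n

/-- Products in exp(L) of elements coming from the two commuting copies of `H` are computed
componentwise. -/
theorem j_mul_j (a b c d : Pt k C H) :
    (Pt.map W.j₁ a * Pt.map W.j₂ b) * (Pt.map W.j₁ c * Pt.map W.j₂ d)
      = Pt.map W.j₁ (a * c) * Pt.map W.j₂ (b * d) := by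
  rw [map_mul, map_mul, mul_assoc, ← mul_assoc (Pt.map W.j₂ b), ← map_j_comm, mul_assoc, mul_assoc]

/-- With y_P x_N = n'p' one has y · x_N = (y_P x_N, y_N x_N) = n' · (p', n'⁻¹ y_N x_N), where n'
acts diagonally. -/
theorem inM_mul_inA_mi (x y : Pt k C (P × N)) :
    Pt.map S.inM y * Pt.map S.inA (W.mi x)
      = Pt.map S.inA (Pt.map W.minus (W.T.ptA (W.cross x y)))
        * Pt.map S.inM (Pt.mkProd (W.T.ptM (W.cross x y)) ((W.T.ptA (W.cross x y))⁻¹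
          * (Pt.map (LieHom.snd k P N) y * Pt.map (LieHom.snd k P N) x))) := by
  have h := W.cross_eq x y
  rw [mi_apply, map_inM_eq W y, map_inA_minus W, map_inA_minus W, map_inM_eq W, j_mul_j W, j_mul_j W,
    Pt.fst_mkProd, Pt.snd_mkProd, ← h, ← map_mul (Pt.map W.T.inA), ← map_mul (Pt.map W.T.inA),
    mul_inv_cancel_left]
  rfl

theorem act_mi (x y : Pt k C (P × N)) : S.ptAct y (W.mi x)
    = Pt.mkProd (W.T.ptM (W.cross x y)) ((W.T.ptA (W.cross x y))⁻¹
      * (Pt.map (LieHom.snd k P N) y * Pt.map (LieHom.snd k P N) x)) :=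
  S.ptM_eq (W.inM_mul_inA_mi x y)

theorem dress_mi (x y : Pt k C (P × N)) : S.ptDress y (W.mi x)
    = Pt.map W.minus (W.T.ptA (W.cross x y)) :=
  S.ptA_eq (W.inM_mul_inA_mi x y)

theorem pl_act_mi (x y : Pt k C (P × N)) : W.pl (S.ptAct y (W.mi x))
    = Pt.map W.plus (W.T.ptM (W.cross x y)) := by
  rw [act_mi, pl_apply, Pt.fst_mkProd]

/-- From y_P x_N = n'p' follows x_N p'⁻¹ = y_P⁻¹ n', hence x · p'⁻¹ = y_P⁻¹ · (y_P x_P p'⁻¹, n'). -/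
theorem inM_mul_inA_inv (x y : Pt k C (P × N)) :
    Pt.map S.inM x * Pt.map S.inA (W.pl (S.ptAct y (W.mi x)))⁻¹
      = Pt.map S.inA (W.pl y)⁻¹ * Pt.map S.inM (Pt.mkProd (Pt.map (LieHom.fst k P N) y *
        Pt.map (LieHom.fst k P N) x * (W.T.ptM (W.cross x y))⁻¹) (W.T.ptA (W.cross x y))) := by
  have h1 : ∀ p : Pt k C P, (Pt.map W.plus p)⁻¹ = Pt.map W.plus p⁻¹ := fun p => (map_inv _ p).symm
  rw [pl_act_mi, pl_apply, h1, h1, map_inA_plus W, map_inA_plus W, map_inM_eq W, map_inM_eq W, j_mul_j W, j_mul_j W, Pt.fst_mkProd, Pt.snd_mkProd]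
  have h := W.cross_eq x y
  congr 2
  · rw [← map_mul, ← map_mul]
    congr 1
    group
  · rw [map_inv, map_inv, eq_inv_mul_iff_mul_eq, ← mul_assoc, mul_inv_eq_iff_eq_mul, ← h]
    rfl

theorem dress_inv (x y : Pt k C (P × N)) :
    S.ptDress x (W.pl (S.ptAct y (W.mi x)))⁻¹ = (W.pl y)⁻¹ :=
  S.ptA_eq (W.inM_mul_inA_inv x y)

theorem act_inv (x y : Pt k C (P × N)) :
    S.ptAct x (W.pl (S.ptAct y (W.mi x)))⁻¹ = Pt.mkProd (Pt.map (LieHom.fst k P N) y *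
        Pt.map (LieHom.fst k P N) x * (W.T.ptM (W.cross x y))⁻¹) (W.T.ptA (W.cross x y)) :=
  S.ptM_eq (W.inM_mul_inA_inv x y)

/-- Both sides are n', the `N`-factor of y_P x_N. -/
theorem mi_act_inv (x y : Pt k C (P × N)) :
    W.mi (S.ptAct x (W.pl (S.ptAct y (W.mi x)))⁻¹) = S.ptDress y (W.mi x) := by
  rw [act_inv, mi_apply, Pt.snd_mkProd, dress_mi]

/-- In (y_P x_P p'⁻¹, n') · (p', n'⁻¹ y_N x_N) the auxiliary factors cancel. So translation by the
R-matrix carries (x, y) to a pair with product yx. -/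
theorem act_inv_mul_act (x y : Pt k C (P × N)) :
    S.ptAct x (W.pl (S.ptAct y (W.mi x)))⁻¹ * S.ptAct y (W.mi x) = y * x := by
  rw [act_inv, act_mi]
  refine Pt.ext_prod ?_ ?_
  · rw [map_mul, map_mul, Pt.fst_mkProd, Pt.fst_mkProd]
    group
  · rw [map_mul, map_mul, Pt.snd_mkProd, Pt.snd_mkProd]
    group

end DoubleSplitting

end Double

/-! ### The R-matrix as a point, and its identities leg by leg -/

section RMatrix

variable {k : Type*} [CommRing k] {A P N L H : Type*}
  [LieRing A] [LieAlgebra k A] [LieRing P] [LieAlgebra k P] [LieRing N] [LieAlgebra k N]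
  [LieRing L] [LieAlgebra k L] [LieRing H] [LieAlgebra k H]

theorem map_projHom_piHom {C X Y : Type*} [AddCommMonoid C] [Module k C] [Coalgebra k C]
    [Coalgebra.IsCocomm k C] [LieRing X] [LieAlgebra k X] [LieRing Y] [LieAlgebra k Y] {n : ℕ}
    (f : Fin n → (X →ₗ⁅k⁆ Y)) (i : Fin n) (g : Pt k C X) :
    Pt.map (projHom i) (Pt.map (piHom f) g) = Pt.map (f i) g :=
  Pt.map_map _ _ _

theorem fstC_comp_map {C C' D D' : Type*} [AddCommMonoid C] [Module k C] [Coalgebra k C]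
    [AddCommMonoid D] [Module k D] [Coalgebra k D] [AddCommMonoid C'] [Module k C'] [Coalgebra k C']
    [AddCommMonoid D'] [Module k D'] [Coalgebra k D'] (f : C →ₗc[k] C') (g : D →ₗc[k] D') :
    (fstC k C' D').comp (Coalgebra.TensorProduct.map f g) = f.comp (fstC k C D) := by
  refine CoalgHom.ext fun z => ?_
  induction z using TensorProduct.induction_on with
  | zero => simp
  | add z w hz hw => rw [map_add, map_add, hz, hw]
  | tmul c d =>
    change Coalgebra.counit (R := k) (g d) • f c = f (Coalgebra.counit (R := k) d • c)
    rw [CoalgHomClass.counit_comp_apply, map_smul]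

theorem sndC_comp_map {C C' D D' : Type*} [AddCommMonoid C] [Module k C] [Coalgebra k C]
    [AddCommMonoid D] [Module k D] [Coalgebra k D] [AddCommMonoid C'] [Module k C'] [Coalgebra k C']
    [AddCommMonoid D'] [Module k D'] [Coalgebra k D'] (f : C →ₗc[k] C') (g : D →ₗc[k] D') :
    (sndC k C' D').comp (Coalgebra.TensorProduct.map f g) = g.comp (sndC k C D) := by
  refine CoalgHom.ext fun z => ?_
  induction z using TensorProduct.induction_on with
  | zero => simp
  | add z w hz hw => rw [map_add, map_add, hz, hw]
  | tmul c d =>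
    change Coalgebra.counit (R := k) (f c) • g d = g (Coalgebra.counit (R := k) c • d)
    rw [CoalgHomClass.counit_comp_apply, map_smul]

section

variable {C C' D D' X : Type*} [AddCommMonoid C] [Module k C] [Coalgebra k C]
  [Coalgebra.IsCocomm k C] [AddCommMonoid D] [Module k D] [Coalgebra k D]
  [Coalgebra.IsCocomm k D] [AddCommMonoid C'] [Module k C'] [Coalgebra k C']
  [Coalgebra.IsCocomm k C'] [AddCommMonoid D'] [Module k D'] [Coalgebra k D']
  [Coalgebra.IsCocomm k D'] [LieRing X] [LieAlgebra k X]

theorem Pt.comap_map_fstC (f : C →ₗc[k] C') (g : D →ₗc[k] D') (a : Pt k C' X) :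
    Pt.comap (Coalgebra.TensorProduct.map f g) (Pt.comap (fstC k C' D') a)
      = Pt.comap (fstC k C D) (Pt.comap f a) :=
  congrArg (fun h => Pt.comap h a) (fstC_comp_map f g)

theorem Pt.comap_map_sndC (f : C →ₗc[k] C') (g : D →ₗc[k] D') (a : Pt k D' X) :
    Pt.comap (Coalgebra.TensorProduct.map f g) (Pt.comap (sndC k C' D') a)
      = Pt.comap (sndC k C D) (Pt.comap g a) :=
  congrArg (fun h => Pt.comap h a) (sndC_comp_map f g)

@[simp] theorem Pt.comap_id (a : Pt k C X) : Pt.comap (CoalgHom.id k C) a = a := rfl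

theorem Pt.comap_mapC_univ {Y : Type*} [LieRing Y] [LieAlgebra k Y] (f : X →ₗ⁅k⁆ Y) :
    Pt.comap (mapC f) (Pt.univ k Y) = Pt.map f (Pt.univ k X) := rfl

end

theorem mapU_mem {X Y : Type*} [LieRing X] [LieAlgebra k X] [LieRing Y] [LieAlgebra k Y]
    {f : X →ₗ⁅k⁆ Y} {B : Subalgebra k (U k Y)} (h : ∀ x, gen k (f x) ∈ B) (a : U k X) :
    mapU f a ∈ B := by
  induction a using U_induction with
  | zero => rw [map_zero]; exact B.zero_mem
  | one => rw [map_one]; exact B.one_mem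
  | add a b ha hb => rw [map_add]; exact B.add_mem ha hb
  | smul r a ha => rw [map_smul]; exact B.smul_mem ha r
  | mul a x ha => rw [map_mul, mapU_gen]; exact B.mul_mem ha (h x)

theorem Pt.mul_hom_mem {C X : Type*} [AddCommMonoid C] [Module k C] [Coalgebra k C]
    [Coalgebra.IsCocomm k C] [LieRing X] [LieAlgebra k X] {f g : Pt k C X}
    {B : Subalgebra k (U k X)} (hf : ∀ c, f.hom c ∈ B) (hg : ∀ c, g.hom c ∈ B) (c : C) :
    (f * g).hom c ∈ B := by
  rw [Pt.mul_hom_apply]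
  generalize Coalgebra.comul (R := k) c = z
  induction z using TensorProduct.induction_on with
  | zero => rw [_root_.map_zero, _root_.map_zero]; exact B.zero_mem
  | add z w hz hw => rw [map_add, map_add]; exact B.add_mem hz hw
  | tmul x y => exact B.mul_mem (hf x) (hg y)

namespace LieSplitting

variable {M : Type*} [LieRing M] [LieAlgebra k M] (S : LieSplitting k A M L)

/-- Invariance for all c and u is one identity of points over U(M) ⊗ U(M), for the two universal
arguments. -/
theorem isInvariant_of_map_ptAct {f : M →ₗ⁅k⁆ A}
    (h : Pt.map f (S.ptAct (Pt.comap (fstC k (U k M) (U k M)) (Pt.univ k M))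
      (Pt.comap (sndC k (U k M) (U k M)) (Pt.map f (Pt.univ k M))))
      = Pt.map f (Pt.comap (fstC k (U k M) (U k M)) (Pt.univ k M))) :
    S.IsInvariant f (WithConv.toConv (mapU f : U k M →ₐ[k] U k A).toLinearMap) := by
  intro c u
  have h1 := congrArg (fun g : Pt k (U k M ⊗[k] U k M) A => g.hom (c ⊗ₜ u)) h
  have h2 := tensor_pt_mul_apply (Pt.map S.inM (Pt.univ k M))
    (Pt.map S.inA (Pt.map f (Pt.univ k M))) c u
  have h3 : S.act (c ⊗ₜ mapU f u) = (S.ptAct (Pt.comap (fstC k (U k M) (U k M)) (Pt.univ k M))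
      (Pt.comap (sndC k (U k M) (U k M)) (Pt.map f (Pt.univ k M)))).hom (c ⊗ₜ u) :=
    (congrArg S.piM h2).symm
  refine Eq.trans (congrArg (mapU f) h3) (h1.trans ?_)
  change mapU f (fstC k _ _ (c ⊗ₜ u)) = _
  rw [fstC_tmul, map_smul]
  rfl

end LieSplitting

namespace DoubleSplitting

variable {S : LieSplitting k A (P × N) L} (W : DoubleSplitting S H)

variable {C D : Type*} [AddCommMonoid C] [Module k C] [Coalgebra k C]
  [Coalgebra.IsCocomm k C] [AddCommMonoid D] [Module k D] [Coalgebra k D]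
  [Coalgebra.IsCocomm k D]

/-- The homomorphism `(x, y) ↦ (y_P, 0)`. -/
def plusHom : (Fin 2 → P × N) →ₗ⁅k⁆ (Fin 2 → A) :=
  piHom ![W.plus.comp ((LieHom.fst k P N).comp (projHom 1)), 0]

/-- The homomorphism `(x, y) ↦ (0, x_N)`. -/
def minusHom : (Fin 2 → P × N) →ₗ⁅k⁆ (Fin 2 → A) :=
  piHom ![0, W.minus.comp ((LieHom.snd k P N).comp (projHom 0))]

theorem proj_zero_plusHom (c : Pt k C (Fin 2 → P × N)) :
    Pt.map (projHom 0) (Pt.map W.plusHom c) = W.pl (Pt.map (projHom 1) c) := by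
  rw [plusHom, map_projHom_piHom, pl, Pt.map_map]
  rfl

theorem proj_one_plusHom (c : Pt k C (Fin 2 → P × N)) :
    Pt.map (projHom 1) (Pt.map W.plusHom c) = 1 := by
  rw [plusHom, map_projHom_piHom]
  exact Pt.map_zero c

theorem proj_zero_minusHom (c : Pt k C (Fin 2 → P × N)) :
    Pt.map (projHom 0) (Pt.map W.minusHom c) = 1 := by
  rw [minusHom, map_projHom_piHom]
  exact Pt.map_zero c

theorem proj_one_minusHom (c : Pt k C (Fin 2 → P × N)) :
    Pt.map (projHom 1) (Pt.map W.minusHom c) = W.mi (Pt.map (projHom 0) c) := by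
  rw [minusHom, map_projHom_piHom, mi, Pt.map_map]
  rfl

/-- The R-matrix `(x, y) ↦ ((y ◁ x_N)_P⁻¹, x_N)`. -/
def rPt (c : Pt k C (Fin 2 → P × N)) : Pt k C (Fin 2 → A) :=
  Pt.map W.minusHom c * (Pt.map W.plusHom ((S.pow 2).ptAct c (Pt.map W.minusHom c)))⁻¹

theorem comap_rPt (h : D →ₗc[k] C) (c : Pt k C (Fin 2 → P × N)) :
    Pt.comap h (W.rPt c) = W.rPt (Pt.comap h c) := by
  rw [rPt, rPt, map_mul, map_inv, Pt.comap_map, Pt.comap_map, LieSplitting.comap_ptAct,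
    Pt.comap_map]

theorem proj_zero_rPt (c : Pt k C (Fin 2 → P × N)) : Pt.map (projHom 0) (W.rPt c)
    = (W.pl (S.ptAct (Pt.map (projHom 1) c) (W.mi (Pt.map (projHom 0) c))))⁻¹ := by
  rw [rPt, map_mul, map_inv, proj_zero_plusHom, proj_zero_minusHom, one_mul,
    LieSplitting.map_projHom_ptAct, proj_one_minusHom]

theorem proj_one_rPt (c : Pt k C (Fin 2 → P × N)) : Pt.map (projHom 1) (W.rPt c)
    = W.mi (Pt.map (projHom 0) c) := by
  rw [rPt, map_mul, map_inv, proj_one_plusHom, proj_one_minusHom, inv_one, mul_one]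

/-- The symbol of the R-matrix. -/
def rSym : S.T 2 := (S.pow 2).ofPt (W.rPt (Pt.univ k _))

/-- The R-matrix in the given legs. -/
def legPt {n : ℕ} (ins : Fin n → Option (Fin 2)) (res : Fin 2 → Option (Fin n))
    (c : Pt k C (Fin n → P × N)) : Pt k C (Fin n → A) :=
  Pt.map (legHom k A ins) (W.rPt (Pt.map (legHom k (P × N) res) c))

theorem comap_legPt {n : ℕ} (ins : Fin n → Option (Fin 2)) (res : Fin 2 → Option (Fin n))
    (h : D →ₗc[k] C) (c : Pt k C (Fin n → P × N)) :
    Pt.comap h (W.legPt ins res c) = W.legPt ins res (Pt.comap h c) := by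
  rw [legPt, legPt, Pt.comap_map, comap_rPt, Pt.comap_map]

theorem comap_legPt_univ {n : ℕ} (ins : Fin n → Option (Fin 2)) (res : Fin 2 → Option (Fin n))
    (c : Pt k C (Fin n → P × N)) :
    Pt.comap c.hom (W.legPt ins res (Pt.univ k _)) = W.legPt ins res c := by
  rw [comap_legPt, Pt.comap_univ]

theorem embed_rSym {n : ℕ} (ins : Fin n → Option (Fin 2)) (res : Fin 2 → Option (Fin n)) :
    S.embed ins res W.rSym = (S.pow n).ofPt (W.legPt ins res (Pt.univ k _)) := by
  rw [rSym, LieSplitting.embed_ofPt, comap_rPt, Pt.comap_univ, legPt]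

theorem embed_rSym_mul {n : ℕ} (ins ins' : Fin n → Option (Fin 2))
    (res res' : Fin 2 → Option (Fin n)) :
    S.embed ins res W.rSym * S.embed ins' res' W.rSym
      = (S.pow n).ofPt (W.legPt ins res (Pt.univ k _) * W.legPt ins' res'
        ((S.pow n).ptAct (Pt.univ k _) (W.legPt ins res (Pt.univ k _)))) := by
  rw [embed_rSym, embed_rSym, LieSplitting.ofPt_mul_ofPt, comap_legPt_univ, LieSplitting.shift]

/-- The base point moves after each factor: c is its position after the first factor and c' after
the second. -/
theorem embed_rSym_mul_mul {n : ℕ} (ins ins' ins'' : Fin n → Option (Fin 2))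
    (res res' res'' : Fin 2 → Option (Fin n)) {c c' : Pt k (U k (Fin n → P × N)) (Fin n → P × N)}
    (hc : c = (S.pow n).ptAct (Pt.univ k _) (W.legPt ins res (Pt.univ k _)))
    (hc' : c' = (S.pow n).ptAct c (W.legPt ins' res' c)) :
    S.embed ins res W.rSym * S.embed ins' res' W.rSym * S.embed ins'' res'' W.rSym
      = (S.pow n).ofPt (W.legPt ins res (Pt.univ k _) * W.legPt ins' res' c
        * W.legPt ins'' res'' c') := by
  rw [embed_rSym_mul, embed_rSym, LieSplitting.ofPt_mul_ofPt, comap_legPt_univ, LieSplitting.shift,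
    LieSplitting.ptAct_mul, ← hc, ← hc']

theorem proj_legPt {n : ℕ} (ins : Fin n → Option (Fin 2)) (res : Fin 2 → Option (Fin n))
    (c : Pt k C (Fin n → P × N)) (j : Fin n) : Pt.map (projHom j) (W.legPt ins res c)
      = (ins j).elim 1 ![(W.pl (S.ptAct ((res 1).elim 1 fun i => Pt.map (projHom i) c)
          (W.mi ((res 0).elim 1 fun i => Pt.map (projHom i) c))))⁻¹,
        W.mi ((res 0).elim 1 fun i => Pt.map (projHom i) c)] := by
  rw [legPt, map_projHom_legHom]
  cases ins j with
  | none => rfl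
  | some i =>
    fin_cases i
    · exact (W.proj_zero_rPt _).trans (by rw [map_projHom_legHom, map_projHom_legHom]; rfl)
    · exact (W.proj_one_rPt _).trans (by rw [map_projHom_legHom]; rfl)

variable [Algebra ℚ k]

/-- `plusHom` reads only the second leg, and a point trivial in that leg translates only the first.
With the values of `plusHom` in the first leg, this makes it invariant under its own image. -/
theorem map_plusHom_ptAct {c : Pt k C (Fin 2 → P × N)} {a : Pt k C (Fin 2 → A)}
    (ha : Pt.map (projHom 1) a = 1) :
    Pt.map W.plusHom ((S.pow 2).ptAct c a) = Pt.map W.plusHom c := by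
  refine Pt.ext_proj fun i => ?_
  fin_cases i
  · change Pt.map (projHom 0) _ = Pt.map (projHom 0) _
    rw [proj_zero_plusHom, proj_zero_plusHom, LieSplitting.map_projHom_ptAct, ha,
      LieSplitting.ptAct_one]
  · change Pt.map (projHom 1) _ = Pt.map (projHom 1) _
    rw [proj_one_plusHom, proj_one_plusHom]

theorem map_minusHom_ptAct {c : Pt k C (Fin 2 → P × N)} {a : Pt k C (Fin 2 → A)}
    (ha : Pt.map (projHom 0) a = 1) :
    Pt.map W.minusHom ((S.pow 2).ptAct c a) = Pt.map W.minusHom c := by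
  refine Pt.ext_proj fun i => ?_
  fin_cases i
  · change Pt.map (projHom 0) _ = Pt.map (projHom 0) _
    rw [proj_zero_minusHom, proj_zero_minusHom]
  · change Pt.map (projHom 1) _ = Pt.map (projHom 1) _
    rw [proj_one_minusHom, proj_one_minusHom, LieSplitting.map_projHom_ptAct, ha,
      LieSplitting.ptAct_one]

theorem isInvariant_plusHom : (S.pow 2).IsInvariant W.plusHom
    (WithConv.toConv (mapU W.plusHom : U k (Fin 2 → P × N) →ₐ[k] U k (Fin 2 → A)).toLinearMap) :=
  (S.pow 2).isInvariant_of_map_ptAct (W.map_plusHom_ptAct (by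
    rw [Pt.comap_map, proj_one_plusHom]))

theorem isInvariant_minusHom : (S.pow 2).IsInvariant W.minusHom
    (WithConv.toConv (mapU W.minusHom : U k (Fin 2 → P × N) →ₐ[k] U k (Fin 2 → A)).toLinearMap) :=
  (S.pow 2).isInvariant_of_map_ptAct (W.map_minusHom_ptAct (by
    rw [Pt.comap_map, proj_zero_minusHom]))

theorem symExp_plusHom : (S.pow 2).symExp ((S.pow 2).convLog
    (mapU W.plusHom : U k (Fin 2 → P × N) →ₐ[k] U k (Fin 2 → A)).toLinearMap)
      = (S.pow 2).ofPt (Pt.map W.plusHom (Pt.univ k _)) :=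
  (S.pow 2).symExp_convLog W.isInvariant_plusHom

theorem symExp_neg_plusHom : (S.pow 2).symExp (-(S.pow 2).convLog
    (mapU W.plusHom : U k (Fin 2 → P × N) →ₐ[k] U k (Fin 2 → A)).toLinearMap)
      = (S.pow 2).ofPt (Pt.map W.plusHom (Pt.univ k _))⁻¹ :=
  (S.pow 2).symExp_neg_convLog W.isInvariant_plusHom

theorem symExp_minusHom : (S.pow 2).symExp ((S.pow 2).convLog
    (mapU W.minusHom : U k (Fin 2 → P × N) →ₐ[k] U k (Fin 2 → A)).toLinearMap)
      = (S.pow 2).ofPt (Pt.map W.minusHom (Pt.univ k _)) :=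
  (S.pow 2).symExp_convLog W.isInvariant_minusHom

/-- The two exponentials are (x, y) ↦ (1, x_N) and (x, y) ↦ (y_P⁻¹, 1). In the product the second is
evaluated at the translate (x, y ◁ x_N). -/
theorem rSym_eq : (S.pow 2).symExp ((S.pow 2).convLog
      (mapU W.minusHom : U k (Fin 2 → P × N) →ₐ[k] U k (Fin 2 → A)).toLinearMap) *
    (S.pow 2).symExp (-(S.pow 2).convLog
      (mapU W.plusHom : U k (Fin 2 → P × N) →ₐ[k] U k (Fin 2 → A)).toLinearMap) = W.rSym := by
  rw [symExp_minusHom, symExp_neg_plusHom, LieSplitting.ofPt_mul_ofPt, rSym, rPt, map_inv,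
    Pt.comap_map, Pt.comap_univ, LieSplitting.shift]

/-- A symbol unaffected by translation along its own values has its pointwise inverse as its inverse
in the smash product. -/
theorem ofPt_plusHom_mul_inv : (S.pow 2).ofPt (Pt.map W.plusHom (Pt.univ k _)) *
    (S.pow 2).ofPt (Pt.map W.plusHom (Pt.univ k _))⁻¹ = 1 := by
  rw [LieSplitting.ofPt_mul_ofPt, map_inv, Pt.comap_map, Pt.comap_univ, LieSplitting.shift,
    map_plusHom_ptAct W (proj_one_plusHom W _), mul_inv_cancel, LieSplitting.ofPt_one]

theorem ofPt_plusHom_inv_mul : (S.pow 2).ofPt (Pt.map W.plusHom (Pt.univ k _))⁻¹ *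
    (S.pow 2).ofPt (Pt.map W.plusHom (Pt.univ k _)) = 1 := by
  rw [LieSplitting.ofPt_mul_ofPt, Pt.comap_map, Pt.comap_univ, LieSplitting.shift,
    map_plusHom_ptAct W (by rw [map_inv, proj_one_plusHom, inv_one]), inv_mul_cancel,
    LieSplitting.ofPt_one]

theorem ofPt_minusHom_mul_inv : (S.pow 2).ofPt (Pt.map W.minusHom (Pt.univ k _)) *
    (S.pow 2).ofPt (Pt.map W.minusHom (Pt.univ k _))⁻¹ = 1 := by
  rw [LieSplitting.ofPt_mul_ofPt, map_inv, Pt.comap_map, Pt.comap_univ, LieSplitting.shift,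
    map_minusHom_ptAct W (proj_zero_minusHom W _), mul_inv_cancel, LieSplitting.ofPt_one]

theorem ofPt_minusHom_inv_mul : (S.pow 2).ofPt (Pt.map W.minusHom (Pt.univ k _))⁻¹ *
    (S.pow 2).ofPt (Pt.map W.minusHom (Pt.univ k _)) = 1 := by
  rw [LieSplitting.ofPt_mul_ofPt, Pt.comap_map, Pt.comap_univ, LieSplitting.shift,
    map_minusHom_ptAct W (by rw [map_inv, proj_zero_minusHom, inv_one]), inv_mul_cancel,
    LieSplitting.ofPt_one]

theorem isUnit_rSym : IsUnit W.rSym := by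
  rw [← rSym_eq, symExp_minusHom, symExp_neg_plusHom]
  exact IsUnit.mul ⟨⟨_, _, W.ofPt_minusHom_mul_inv, W.ofPt_minusHom_inv_mul⟩, rfl⟩
    ⟨⟨_, _, W.ofPt_plusHom_inv_mul, W.ofPt_plusHom_mul_inv⟩, rfl⟩

/-- Since x'_N = y ▷ x_N, the left side combines to ((zy) ◁ x_N)_P⁻¹ by the rule for a product
acting. The right side combines in the same way with y, z replaced by the R-translated pair, whose
product is again zy. -/
theorem yang_baxter_zero (x y z : Pt k C (P × N)) :
    (W.pl (S.ptAct y (W.mi x)))⁻¹ *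
        (W.pl (S.ptAct z (W.mi (S.ptAct x (W.pl (S.ptAct y (W.mi x)))⁻¹))))⁻¹ =
      (W.pl (S.ptAct (S.ptAct z (W.mi y)) (W.mi x)))⁻¹ *
        (W.pl (S.ptAct (S.ptAct y (W.pl (S.ptAct z (W.mi y)))⁻¹)
          (W.mi (S.ptAct x (W.pl (S.ptAct (S.ptAct z (W.mi y)) (W.mi x)))⁻¹))))⁻¹ := by
  rw [W.mi_act_inv x y, W.mi_act_inv x (S.ptAct z (W.mi y)), ← mul_inv_rev, ← mul_inv_rev,
    ← map_mul, ← map_mul, ← S.mul_ptAct, ← S.mul_ptAct, W.act_inv_mul_act]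

/-- By (y ▷ x_N)(y ◁ x_N)_N = y_N x_N, the point z has been moved on the left to z₁ ◁ x_N with z₁ =
z ◁ y_N. What remains is (z₁ ▷ x_N)(z₁ ◁ x_N)_P = (z₁)_P x_N. -/
theorem yang_baxter_one (x y z : Pt k C (P × N)) :
    W.mi x * (W.pl (S.ptAct (S.ptAct z (W.mi (S.ptAct x (W.pl (S.ptAct y (W.mi x)))⁻¹)))
        (W.mi (S.ptAct y (W.mi x)))))⁻¹ =
      (W.pl (S.ptAct z (W.mi y)))⁻¹ *
        W.mi (S.ptAct x (W.pl (S.ptAct (S.ptAct z (W.mi y)) (W.mi x)))⁻¹) := by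
  rw [W.mi_act_inv x y, W.mi_act_inv x (S.ptAct z (W.mi y)), ← S.ptAct_mul, W.dress_mul_mi,
    S.ptAct_mul, mul_inv_eq_iff_eq_mul, mul_assoc, W.dress_mul_pl, inv_mul_cancel_left]

theorem yang_baxter : S.leg12 W.rSym * S.leg13 W.rSym * S.leg23 W.rSym
    = S.leg23 W.rSym * S.leg13 W.rSym * S.leg12 W.rSym := by
  refine (W.embed_rSym_mul_mul _ _ _ _ _ _ rfl rfl).trans
    (Eq.trans (congrArg _ (Pt.ext_proj fun i => ?_)) (W.embed_rSym_mul_mul _ _ _ _ _ _ rfl rfl).symm)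
  simp only [map_mul, proj_legPt, LieSplitting.map_projHom_ptAct]
  fin_cases i
  · simpa using W.yang_baxter_zero _ _ _
  · simpa using W.yang_baxter_one _ _ _
  -- In the third leg both sides equal y_N x_N.
  · simp [mi_act_inv, dress_mul_mi]

/-- The second and third legs express that z ◁ (xy)_N acts in two steps; the first leg is the
dressing formula `dress_inv` for z ◁ x_N and y. -/
theorem comulLeft_rSym : S.comulLeft W.rSym = S.leg13 W.rSym * S.leg23 W.rSym := by
  refine (LieSplitting.coprod_ofPt _ _ _ _ _ _).trans
    (Eq.trans (congrArg _ (Pt.ext_proj fun i => ?_)) (W.embed_rSym_mul _ _ _ _).symm)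
  rw [comap_rPt, Pt.comap_univ, LieSplitting.map_projHom_ptDress, map_projHom_legHom,
    map_projHom_legHom]
  simp only [map_mul, proj_legPt, LieSplitting.map_projHom_ptAct]
  fin_cases i
  · simp [proj_zero_rPt, LieSplitting.legMul, map_projHom_legHom, LieSplitting.ptAct_mul, dress_inv]
  · simp [proj_zero_rPt, LieSplitting.legMul, map_projHom_legHom, LieSplitting.ptAct_mul]
  · simp [proj_one_rPt, LieSplitting.legMul, map_projHom_legHom]

/-- Here (yz) ◁ x_N = (y ◁ (z ▷ x_N))(z ◁ x_N), and z ▷ x_N is the `N`-part of x after translation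
by the factor in legs 1 and 3. -/
theorem comulRight_rSym : S.comulRight W.rSym = S.leg13 W.rSym * S.leg12 W.rSym := by
  refine (LieSplitting.coprod_ofPt _ _ _ _ _ _).trans
    (Eq.trans (congrArg _ (Pt.ext_proj fun i => ?_)) (W.embed_rSym_mul _ _ _ _).symm)
  rw [comap_rPt, Pt.comap_univ, LieSplitting.map_projHom_ptDress, map_projHom_legHom,
    map_projHom_legHom]
  simp only [map_mul, proj_legPt, LieSplitting.map_projHom_ptAct]
  fin_cases i
  · simp [proj_zero_rPt, LieSplitting.legMul, map_projHom_legHom, LieSplitting.mul_ptAct, mi_act_inv]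
  · simp [proj_one_rPt, LieSplitting.legMul, map_projHom_legHom, mi_act_inv]
  · simp [proj_one_rPt, LieSplitting.legMul, map_projHom_legHom]

/-- The symbol of an element of `A`. -/
def primSym (S : LieSplitting k A (P × N) L) (x : A) : S.T 1 :=
  (S.pow 1).toSym ((Coalgebra.counit (R := k)).smulRight (gen k fun _ => x))

omit [Algebra ℚ k] in
-- An element of `A` placed diagonally in two legs is the sum of its placements in each leg, so this
-- sum is the diagonal universal point evaluated at a primitive element.
theorem leg_primSym (x : A) : S.leg1 (primSym S x) + S.leg2 (primSym S x)
    = (S.pow 2).twisted (Pt.comap (sndC k _ _)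
        (Pt.map (legHom k A ![some 0, some 0]) (Pt.univ k (Fin 1 → A))))
      ((Coalgebra.counit (R := k)).smulRight (gen k fun _ => x)) := by
  ext c
  rw [LieSplitting.twisted_counit_smulRight]
  have h1 : S.leg1 (primSym S x) c = Coalgebra.counit (R := k) c •
      gen k (legHom k A ![some 0, none] fun _ : Fin 1 => x) := by
    change mapU _ (Coalgebra.counit (R := k) (mapU _ c) • gen k _) = _
    rw [counit_mapU, map_smul, mapU_gen]
  have h2 : S.leg2 (primSym S x) c = Coalgebra.counit (R := k) c •
      gen k (legHom k A ![none, some 0] fun _ : Fin 1 => x) := by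
    change mapU _ (Coalgebra.counit (R := k) (mapU _ c) • gen k _) = _
    rw [counit_mapU, map_smul, mapU_gen]
  have h3 : legHom k A ![some 0, some 0] (fun _ : Fin 1 => x)
      = legHom k A ![some 0, none] (fun _ : Fin 1 => x)
        + legHom k A ![none, some 0] (fun _ : Fin 1 => x) := by
    funext i
    fin_cases i
    · exact (add_zero x).symm
    · exact (zero_add x).symm
  rw [LieSplitting.Sym.add_apply, h1, h2, ← smul_add, ← map_add, ← h3]
  rw [Pt.comap_hom_apply, sndC_tmul, Pt.map_hom_apply, Pt.univ_hom_apply, map_smul, mapU_gen]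

/-- For the universal point a in place of the primitive element, the first leg is (y ▷ a)(y ◁ a)_P =
y_P a and the second leg is a on both sides. -/
theorem comulSym_primSym_mul (x : A) :
    S.comulSym (primSym S x) * (S.pow 2).ofPt (Pt.map W.plusHom (Pt.univ k _))
      = (S.pow 2).ofPt (Pt.map W.plusHom (Pt.univ k _))
        * (S.leg1 (primSym S x) + S.leg2 (primSym S x)) := by
  rw [leg_primSym, LieSplitting.ofPt_mul_twisted, LieSplitting.comulSym,
    LieSplitting.coprod_eq_twisted, LieSplitting.twisted_mul_ofPt]
  -- The linear part depends on its argument only through the counit, so no translation changes it.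
  have hl : ∀ {B B' : Type _} [AddCommMonoid B] [Module k B] [Coalgebra k B] [AddCommMonoid B']
      [Module k B'] [Coalgebra k B'] (f : B →ₗc[k] B') (p : U k (Fin 1 → A)),
      (Coalgebra.counit (R := k)).smulRight p ∘ₗ (f : B →ₗ[k] B')
        = (Coalgebra.counit (R := k)).smulRight p := fun f p => LinearMap.ext fun c =>
    congrArg (fun r : k => r • p) (CoalgHomClass.counit_comp_apply f c)
  congr 1
  · rw [← Pt.comap_of_univ]
    simp only [Pt.comap_map, Pt.comap_univ, Pt.comap_map_sndC, Pt.comap_id]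
    refine Pt.ext_proj fun i => ?_
    fin_cases i
    · change Pt.map (projHom 0) _ = Pt.map (projHom 0) _
      rw [map_mul, map_mul, proj_zero_plusHom, proj_zero_plusHom]
      simp [LieSplitting.map_projHom_ptDress, LieSplitting.map_projHom_ptAct, map_projHom_legHom,
        dress_mul_pl]
    · change Pt.map (projHom 1) _ = Pt.map (projHom 1) _
      rw [map_mul, map_mul, proj_one_plusHom, proj_one_plusHom]
      simp [LieSplitting.map_projHom_ptDress, map_projHom_legHom]
  · rw [hl]
    exact hl _ _

theorem comulSym_primSym (x : A) : S.comulSym (primSym S x)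
    = (S.pow 2).symExp ((S.pow 2).convLog
        (mapU W.plusHom : U k (Fin 2 → P × N) →ₐ[k] U k (Fin 2 → A)).toLinearMap) *
      (S.leg1 (primSym S x) + S.leg2 (primSym S x)) *
      (S.pow 2).symExp (-(S.pow 2).convLog
        (mapU W.plusHom : U k (Fin 2 → P × N) →ₐ[k] U k (Fin 2 → A)).toLinearMap) := by
  rw [symExp_plusHom, symExp_neg_plusHom, ← comulSym_primSym_mul, mul_assoc, ofPt_plusHom_mul_inv,
    mul_one]

omit [Algebra ℚ k] in
-- The first leg of the intertwining relation: by the formula for `N`-parts, y ◁ x_N ◁ a and y ◁ (x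
-- ▷ a) ◁ (x ◁ a)_N are both y ◁ (x_N a), and the formula for `P`-parts finishes.
theorem inv_mul_dress_act (x y : Pt k C (P × N)) (a : Pt k C A) :
    (W.pl (S.ptAct y (W.mi x)))⁻¹ * S.ptDress (S.ptAct y (W.mi x)) a
      = a * (W.pl (S.ptAct (S.ptAct y (S.ptDress x a)) (W.mi (S.ptAct x a))))⁻¹ := by
  rw [← S.ptAct_mul, W.dress_mul_mi, S.ptAct_mul, eq_mul_inv_iff_mul_eq, mul_assoc, W.dress_mul_pl,
    inv_mul_cancel_left]

/-- The argument of φ in Δ(φ), after translation by the R-matrix, is x'y' = yx, the argument in the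
opposite coproduct. -/
theorem comap_shift_legMul : Pt.comap ((S.pow 2).shift (W.rPt (Pt.univ k _))).hom
      (LieSplitting.legMul ![some 0] ![some 1] : Pt k (U k (Fin 2 → P × N)) (Fin 1 → P × N))
    = Pt.comap (mapC (legHom k (P × N) ![some 1, some 0]))
      (LieSplitting.legMul ![some 0] ![some 1] :
        Pt k (U k (Fin 2 → P × N)) (Fin 1 → P × N)) := by
  refine Pt.ext_proj fun i => ?_
  fin_cases i
  simp [LieSplitting.legMul, Pt.comap_map, Pt.comap_mapC_univ, map_projHom_legHom,
    LieSplitting.shift, LieSplitting.map_projHom_ptAct, proj_zero_rPt, proj_one_rPt,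
    act_inv_mul_act]

/-- Both sides are twisted symbols. Their universal points agree by `inv_mul_dress_act` in the first
leg and (x ▷ a)(x ◁ a)_N = x_N a in the second; their linear parts agree by `comap_shift_legMul`. -/
theorem rSym_mul_comulSym (φ : S.T 1) : W.rSym * S.comulSym φ = S.comulOp φ * W.rSym := by
  rw [LieSplitting.comulOp, LinearMap.comp_apply, LieSplitting.comulSym,
    LieSplitting.coprod_eq_twisted, LieSplitting.flip, LieSplitting.embed_twisted, rSym,
    LieSplitting.twisted_mul_ofPt, LieSplitting.ofPt_mul_twisted, LinearMap.comp_assoc,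
    LinearMap.comp_assoc]
  congr 1
  · rw [comap_rPt, comap_rPt, Pt.comap_univ, LieSplitting.comap_ptDress, LieSplitting.comap_ptDress,
      Pt.comap_map_fstC, Pt.comap_map_fstC, Pt.comap_map_sndC, Pt.comap_map_sndC,
      ← Pt.comap_of_univ, LieSplitting.shift]
    refine Pt.ext_proj fun i => ?_
    fin_cases i
    · change Pt.map (projHom 0) _ = Pt.map (projHom 0) _
      simp [LieSplitting.map_projHom_ptDress, LieSplitting.map_projHom_ptAct, Pt.comap_map,
        map_projHom_legHom, proj_zero_rPt, proj_one_rPt, Pt.comap_mapC_univ,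
        LieSplitting.comap_ptAct, comap_rPt, inv_mul_dress_act]
    · change Pt.map (projHom 1) _ = Pt.map (projHom 1) _
      simp [LieSplitting.map_projHom_ptDress, LieSplitting.map_projHom_ptAct, Pt.comap_map,
        map_projHom_legHom, proj_one_rPt, Pt.comap_mapC_univ, dress_mul_mi]
  · congr 1
    exact congrArg (fun g : Pt k (U k (Fin 2 → P × N)) (Fin 1 → P × N) =>
      (g.hom : U k (Fin 2 → P × N) →ₗ[k] U k (Fin 1 → P × N))) W.comap_shift_legMul

/-- The projection `((p₁, m₁), (p₂, m₂)) ↦ ((0, m₁), (p₂, 0))`. -/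
def crossProj (k P N : Type*) [CommRing k] [LieRing P] [LieAlgebra k P] [LieRing N]
    [LieAlgebra k N] : (Fin 2 → P × N) →ₗ⁅k⁆ (Fin 2 → P × N) :=
  piHom ![(LieHom.inr k P N).comp ((LieHom.snd k P N).comp (projHom 0)),
    (LieHom.inl k P N).comp ((LieHom.fst k P N).comp (projHom 1))]

/-- The R-matrix is built from x_N and the `P`-factor of y_P x_N, so it does not see x_P and y_N. -/
theorem rPt_crossProj (c : Pt k C (Fin 2 → P × N)) :
    W.rPt (Pt.map (crossProj k P N) c) = W.rPt c := by
  have h0 : Pt.map (LieHom.snd k P N) (Pt.map (projHom 0) (Pt.map (crossProj k P N) c))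
      = Pt.map (LieHom.snd k P N) (Pt.map (projHom 0) c) := by
    rw [crossProj, map_projHom_piHom, Pt.map_map, Pt.map_map]
    rfl
  have h1 : Pt.map (LieHom.fst k P N) (Pt.map (projHom 1) (Pt.map (crossProj k P N) c))
      = Pt.map (LieHom.fst k P N) (Pt.map (projHom 1) c) := by
    rw [crossProj, map_projHom_piHom, Pt.map_map, Pt.map_map]
    rfl
  refine Pt.ext_proj fun i => ?_
  fin_cases i
  · change Pt.map (projHom 0) _ = Pt.map (projHom 0) _
    rw [proj_zero_rPt, proj_zero_rPt, pl_act_mi, pl_act_mi, cross, cross, h0, h1]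
  · change Pt.map (projHom 1) _ = Pt.map (projHom 1) _
    rw [proj_one_rPt, proj_one_rPt, mi_apply, mi_apply, h0]

theorem rSym_crossProj (e : U k (Fin 2 → P × N)) :
    W.rSym (mapU (crossProj k P N) e) = W.rSym e := by
  have h := congrArg (fun g => g.hom e) (W.rPt_crossProj (Pt.univ k _))
  have h' := congrArg (fun g => g.hom e)
    (W.comap_rPt (Pt.map (crossProj k P N) (Pt.univ k _)).hom (Pt.univ k _))
  exact h'.trans h

/-- Displays the values as a product of a point of exp(N) in the second leg and a point of exp(P) in
the first, from which membership in the subalgebra generated by these is visible. -/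
theorem rPt_eq (c : Pt k C (Fin 2 → P × N)) : W.rPt c = Pt.map W.minusHom c *
    Pt.map ((singleHom k A (0 : Fin 2)).comp W.plus)
      (W.T.ptM (W.cross (Pt.map (projHom 0) c) (Pt.map (projHom 1) c)))⁻¹ := by
  refine Pt.ext_proj fun i => ?_
  fin_cases i
  · change Pt.map (projHom 0) _ = Pt.map (projHom 0) _
    rw [proj_zero_rPt, map_mul, proj_zero_minusHom, one_mul, pl_act_mi, Pt.map_map, map_inv]
    rfl
  · change Pt.map (projHom 1) _ = Pt.map (projHom 1) _
    rw [proj_one_rPt, map_mul, proj_one_minusHom, Pt.map_map]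
    have h : (projHom 1).comp ((singleHom k A (0 : Fin 2)).comp W.plus) = 0 := LieHom.ext fun p =>
      Pi.single_eq_of_ne (M := fun _ : Fin 2 => A) (one_ne_zero : (1 : Fin 2) ≠ 0) (W.plus p)
    rw [h, Pt.map_zero, mul_one]

theorem rSym_mem {B : Subalgebra k (U k (Fin 2 → A))}
    (hplus : ∀ p, gen k (Pi.single (M := fun _ => A) 0 (W.plus p)) ∈ B)
    (hminus : ∀ n, gen k (Pi.single (M := fun _ => A) 1 (W.minus n)) ∈ B)
    (e : U k (Fin 2 → P × N)) : W.rSym e ∈ B := by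
  change (W.rPt (Pt.univ k _)).hom e ∈ B
  rw [rPt_eq]
  refine Pt.mul_hom_mem (fun c => mapU_mem (fun w => ?_) c) (fun c => mapU_mem hplus _) e
  have h : W.minusHom w = Pi.single (M := fun _ => A) 1 (W.minus (w 0).2) := by
    funext i
    fin_cases i
    · exact (Pi.single_eq_of_ne (M := fun _ : Fin 2 => A) (by decide) _).symm
    · exact (Pi.single_eq_same (M := fun _ : Fin 2 => A) 1 _).symm
  rw [h]
  exact hminus _

end DoubleSplitting

end RMatrix

/-! ### Specialization to the loop algebra -/

section LoopAlgebra

variable (𝔤 : Type*) [LieRing 𝔤] [LieAlgebra ℂ 𝔤]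

theorem hbarPart_mono {H H' : LieSubalgebra ℂ (Loop 𝔤)} (h : H ≤ H') :
    hbarPart 𝔤 H ≤ hbarPart 𝔤 H' := fun _ hw =>
  hbarPart_induction 𝔤 (p := fun w => w ∈ hbarPart 𝔤 H') (zero_mem _) (fun _ _ => add_mem)
    (fun r _ h => Submodule.smul_mem _ r h) (fun x hx => Submodule.subset_span ⟨x, h hx, rfl⟩) hw

/-- The decomposition `ħ 𝔤(K) = ħ 𝔤_{<0} ⊕ ħ 𝔤(O)`. -/
def loopSplitting : LieSplitting Kh (hbarPart 𝔤 (loopNeg 𝔤)) (hbarPart 𝔤 (loopO 𝔤))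
    (hbarPart 𝔤 ⊤) where
  inA := LieSubalgebra.inclusion (hbarPart_mono 𝔤 le_top)
  inM := LieSubalgebra.inclusion (hbarPart_mono 𝔤 le_top)
  prA := LinearMap.codRestrict (hbarPart 𝔤 (loopNeg 𝔤)).toSubmodule
    (projNeg 𝔤 ∘ₗ (hbarPart 𝔤 ⊤).toSubmodule.subtype) (fun w => by
      obtain ⟨z, hz⟩ := hbarPart_dvd 𝔤 w.2
      change projNeg 𝔤 w.1 ∈ hbarPart 𝔤 (loopNeg 𝔤)
      rw [hz]
      exact projNeg_mem 𝔤 z)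
  prM := LinearMap.codRestrict (hbarPart 𝔤 (loopO 𝔤)).toSubmodule
    (projPos 𝔤 ∘ₗ (hbarPart 𝔤 ⊤).toSubmodule.subtype) (fun w => by
      obtain ⟨z, hz⟩ := hbarPart_dvd 𝔤 w.2
      change projPos 𝔤 w.1 ∈ hbarPart 𝔤 (loopO 𝔤)
      rw [hz]
      exact projPos_mem 𝔤 z)
  prA_inA a := Subtype.ext (projNeg_of_mem_neg 𝔤 a.2)
  prM_inM m := Subtype.ext (by
    change m.1 - projNeg 𝔤 m.1 = m.1
    rw [projNeg_of_mem_O 𝔤 m.2, sub_zero])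
  prA_inM m := Subtype.ext (projNeg_of_mem_O 𝔤 m.2)
  prM_inA a := Subtype.ext (by
    change a.1 - projNeg 𝔤 a.1 = 0
    rw [projNeg_of_mem_neg 𝔤 a.2, sub_self])
  sum_pr w := Subtype.ext (by
    change projNeg 𝔤 w.1 + (w.1 - projNeg 𝔤 w.1) = w.1
    abel)

/-- The decomposition of `𝔤(K) × 𝔤(K)` as a `DoubleSplitting`. -/
def dyDouble : DoubleSplitting (dySplitting 𝔤) (hbarPart 𝔤 ⊤) where
  plus := (hbarPart 𝔤 (loopO 𝔤)).incl
  minus := (hbarPart 𝔤 (loopNeg 𝔤)).incl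
  pr₁ := (LieHom.fst Kh _ _).comp (PairH 𝔤).incl
  pr₂ := (LieHom.snd Kh _ _).comp (PairH 𝔤).incl
  pr₁_inA := rfl
  pr₂_inA := rfl
  pr₁_inM := rfl
  pr₂_inM := rfl
  T := loopSplitting 𝔤
  -- The components of an element of `PairH` agree modulo ħ, so only multiples of ħ embed into a
  -- single factor; hence the choice of ħ𝔤(K) as the ideal.
  j₁ :=
    { toFun := fun h => ⟨(h, 0), by
        obtain ⟨z, hz⟩ := hbarPart_dvd 𝔤 h.2
        exact ⟨z, by rw [sub_zero, hz]⟩⟩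
      map_add' := fun v w => Subtype.ext (Prod.ext rfl (add_zero 0).symm)
      map_smul' := fun r v => Subtype.ext (Prod.ext rfl (smul_zero r).symm)
      map_lie' := fun {v w} => Subtype.ext (Prod.ext rfl (lie_zero (0 : LoopH 𝔤)).symm) }
  j₂ :=
    { toFun := fun h => ⟨(0, h), by
        obtain ⟨z, hz⟩ := hbarPart_dvd 𝔤 h.2
        exact ⟨-z, by rw [zero_sub, smul_neg, hz]⟩⟩
      map_add' := fun v w => Subtype.ext (Prod.ext (add_zero 0).symm rfl)
      map_smul' := fun r v => Subtype.ext (Prod.ext (smul_zero r).symm rfl)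
      map_lie' := fun {v w} => Subtype.ext (Prod.ext (lie_zero (0 : LoopH 𝔤)).symm rfl) }
  lie_j x y := Subtype.ext (Prod.ext (lie_zero _) (zero_lie _))
  inM_eq v := Subtype.ext (Prod.ext (add_zero _).symm (zero_add _).symm)
  inA_plus p := Subtype.ext (Prod.ext (add_zero _).symm (zero_add _).symm)
  inA_minus n := Subtype.ext (Prod.ext (add_zero _).symm (zero_add _).symm)

theorem Rmat_eq : Rmat 𝔤 = (dyDouble 𝔤).rSym := (dyDouble 𝔤).rSym_eq

theorem isUnit_Rmat : IsUnit (Rmat 𝔤) := by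
  rw [Rmat_eq]
  exact (dyDouble 𝔤).isUnit_rSym

/-- Stated as an equality of linear maps, so that it passes to the ħ-adic completion by
functoriality. -/
theorem conjBy_Rmat_comp_dyComul : conjBy 𝔤 (Rmat 𝔤) ∘ₗ dyComul 𝔤 = dyComulOp 𝔤 := by
  refine LinearMap.ext fun φ => ?_
  change Rmat 𝔤 * (dyComul 𝔤 φ * Ring.inverse (Rmat 𝔤)) = _
  have h : Rmat 𝔤 * dyComul 𝔤 φ = dyComulOp 𝔤 φ * Rmat 𝔤 := by
    rw [Rmat_eq]
    exact (dyDouble 𝔤).rSym_mul_comulSym φ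
  rw [← mul_assoc, h, mul_assoc, Ring.mul_inverse_cancel _ (isUnit_Rmat 𝔤), mul_one]

variable {𝔤}

theorem legElem_add (i : Fin 2) (v w : LoopH 𝔤) :
    legElem i (v + w) = legElem i v + legElem i w := by
  rw [legElem, Pi.single_add, map_add, legElem, legElem]

theorem legElem_smul (i : Fin 2) (r : Kh) (v : LoopH 𝔤) :
    legElem i (r • v) = r • legElem i v := by
  rw [legElem, Pi.single_smul, map_smul, legElem]

theorem legElem_zero (i : Fin 2) : legElem i (0 : LoopH 𝔤) = 0 := by
  rw [legElem, Pi.single_zero, map_zero]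

theorem legElem_sum {ι : Type*} (i : Fin 2) (s : Finset ι) (v : ι → LoopH 𝔤) :
    legElem i (∑ j ∈ s, v j) = ∑ j ∈ s, legElem i (v j) :=
  map_sum (AddMonoidHom.mk' (legElem (𝔤 := 𝔤) i) (legElem_add i)) v s

theorem legElem_mem {H : LieSubalgebra ℂ (Loop 𝔤)} {i : Fin 2}
    {B : Subalgebra Kh (U Kh (Fin 2 → LoopH 𝔤))} (hB : ∀ h ∈ H, legElem i (1 ⊗ₜ h) ∈ B)
    {w : LoopH 𝔤} (hw : w ∈ hbarPart 𝔤 H) : legElem i w ∈ B := by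
  refine hbarPart_induction 𝔤 (p := fun w => legElem i w ∈ B) ?_ ?_ ?_ ?_ hw
  · rw [legElem_zero]
    exact zero_mem _
  · intro v w hv hw
    rw [legElem_add]
    exact add_mem hv hw
  · intro r v hv
    rw [legElem_smul]
    exact Subalgebra.smul_mem _ hv r
  · intro h hh
    have : (hbar ⊗ₜ[ℂ] h : LoopH 𝔤) = hbar • (1 ⊗ₜ h) := by
      rw [smul_tmul', smul_eq_mul, mul_one]
    rw [this, legElem_smul]
    exact Subalgebra.smul_mem _ (hB h hh) _

variable (𝔤) in
theorem inYangianTensorDual_Rmat : InYangianTensorDual 𝔤 (Rmat 𝔤) := by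
  intro e
  rw [Rmat_eq]
  exact ⟨((dyDouble 𝔤).rSym_crossProj e).symm, (dyDouble 𝔤).rSym_mem
    (fun p => legElem_mem (fun h hh => Algebra.subset_adjoin (Or.inl ⟨h, hh, rfl⟩)) p.2)
    (fun n => legElem_mem (fun h hh => Algebra.subset_adjoin (Or.inr ⟨h, hh, rfl⟩)) n.2) e⟩

/-! ### Coordinate expansions of γ_< and γ_<^{21} -/

theorem Loop.mk_sum {ι : Type*} (s : Finset ι) (a : Laurent) (x : ι → 𝔤) :
    Loop.mk a (∑ j ∈ s, x j) = ∑ j ∈ s, Loop.mk a (x j) :=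
  TensorProduct.tmul_sum (R := ℂ) a s x

theorem Loop.sum_mk {ι : Type*} (s : Finset ι) (a : ι → Laurent) (x : 𝔤) :
    Loop.mk (∑ j ∈ s, a j) x = ∑ j ∈ s, Loop.mk (a j) x :=
  TensorProduct.sum_tmul (R := ℂ) s a x

theorem Loop.smul_mk (r : ℂ) (a : Laurent) (x : 𝔤) : Loop.mk (r • a) x = r • Loop.mk a x := rfl

theorem Loop.mk_smul (r : ℂ) (a : Laurent) (x : 𝔤) : Loop.mk a (r • x) = r • Loop.mk a x :=
  TensorProduct.tmul_smul (R := ℂ) r a x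

variable {ι : Type*} (b : Module.Basis ι ℂ 𝔤)

theorem coordFun_tmul (α : ι) (n : ℤ) (r : Kh) (a : Laurent) (x : 𝔤) :
    coordFun b α n (r ⊗ₜ Loop.mk a x) = (Laurent.coeff n a * b.coord α x) • r := rfl

variable [Fintype ι]

/-- The part of `v` with exponents in `s`. -/
def expand (s : Finset ℤ) : LoopH 𝔤 →ₗ[Kh] LoopH 𝔤 :=
  ∑ n ∈ s, ∑ α, (coordFun b α n).smulRight (basisElem b α n)

theorem expand_apply (s : Finset ℤ) (v : LoopH 𝔤) :
    expand b s v = ∑ n ∈ s, ∑ α, coordFun b α n v • basisElem b α n := by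
  simp [expand, LinearMap.sum_apply]

theorem expand_tmul_mk (s : Finset ℤ) (r : Kh) (a : Laurent) (x : 𝔤) :
    expand b s (r ⊗ₜ Loop.mk a x) = r ⊗ₜ Loop.mk (∑ n ∈ s, Laurent.coeff n a • Laurent.mono n) x := by
  rw [expand_apply, Loop.sum_mk, tmul_sum]
  refine Finset.sum_congr rfl fun n _ => ?_
  conv_rhs => rw [← b.sum_repr x, Loop.mk_sum, tmul_sum]
  refine Finset.sum_congr rfl fun α _ => ?_
  rw [coordFun_tmul, basisElem, Loop.mk_smul, Loop.smul_mk, smul_smul, smul_tmul', smul_eq_mul,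
    mul_one, ← smul_tmul, mul_comm]
  rfl

theorem Laurent.coeff_sum_mono (s : Finset ℤ) (a : Laurent) (m : ℤ) :
    Laurent.coeff m (∑ n ∈ s, Laurent.coeff n a • Laurent.mono n)
      = if m ∈ s then Laurent.coeff m a else 0 := by
  have h : ∀ n, Laurent.coeff m (Laurent.mono n) = if m = n then 1 else 0 := fun n => by
    change HahnSeries.coeff (HahnSeries.single n (1 : ℂ)) m = _
    rw [HahnSeries.coeff_single]
    split_ifs <;> rfl
  rw [map_sum]
  simp only [map_smul, h, smul_eq_mul, mul_ite, mul_one, mul_zero]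
  rw [Finset.sum_ite_eq]

theorem sub_expand_mem {v : LoopH 𝔤} (hv : v ∈ hbarPart 𝔤 (loopO 𝔤)) (N : ℕ) :
    v - expand b ((Finset.range N).map Nat.castEmbedding) v
      ∈ Submodule.span Kh {w : LoopH 𝔤 | ∃ h ∈ loopGe 𝔤 N, w = 1 ⊗ₜ[ℂ] h} := by
  refine hbarPart_induction 𝔤 (p := fun v => v - expand b _ v ∈ Submodule.span Kh _) ?_ ?_ ?_ ?_ hv
  · rw [map_zero, sub_zero]
    exact zero_mem _
  · intro v w hv hw
    rw [map_add, add_sub_add_comm]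
    exact add_mem hv hw
  · intro r v hv
    rw [map_smul, ← smul_sub]
    exact Submodule.smul_mem _ r hv
  · intro h hh
    change h ∈ Submodule.span ℂ _ at hh
    induction hh using Submodule.span_induction with
    | mem w hw =>
      obtain ⟨a, x, ha, rfl⟩ := hw
      rw [expand_tmul_mk, ← tmul_sub, ← Loop.sub_mk]
      have h1 : ∀ h : Loop 𝔤, (hbar ⊗ₜ[ℂ] h : LoopH 𝔤) = hbar • (1 ⊗ₜ h) := fun h => by
        rw [smul_tmul', smul_eq_mul, mul_one]
      rw [h1]
      refine Submodule.smul_mem _ _ (Submodule.subset_span ⟨_, Submodule.subset_span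
        ⟨_, x, fun n hn => ?_, rfl⟩, rfl⟩)
      rw [map_sub, Laurent.coeff_sum_mono]
      split_ifs with h2
      · rw [sub_self]
      · rw [sub_zero]
        -- Below N, exponents in the range have been subtracted; those outside it are negative and
        -- do not occur in 𝔤(O).
        refine ha n (not_le.mp fun h3 => h2 (Finset.mem_map.mpr ?_))
        exact ⟨n.toNat, Finset.mem_range.mpr (by omega), by
          simpa using h3⟩
    | zero =>
      rw [tmul_zero, map_zero, sub_zero]
      exact zero_mem _
    | add v w _ _ hv hw =>
      rw [tmul_add, map_add, add_sub_add_comm]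
      exact add_mem hv hw
    | smul r v _ hv =>
      have h1 : (hbar ⊗ₜ[ℂ] (r • v) : LoopH 𝔤) = algebraMap ℂ Kh r • (hbar ⊗ₜ v) := by
        rw [algebraMap_smul, tmul_smul]
      rw [h1, map_smul, ← smul_sub]
      exact Submodule.smul_mem _ _ hv

/-- The exponents `-1, …, -N`. -/
def negExponents (N : ℕ) : Finset ℤ :=
  (Finset.range N).map ⟨fun n : ℕ => -(n : ℤ) - 1, fun m n h => by simpa using h⟩

theorem exists_expand_eq {v : LoopH 𝔤} (hv : v ∈ hbarPart 𝔤 (loopNeg 𝔤)) :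
    ∃ N₀ : ℕ, ∀ N ≥ N₀, expand b (negExponents N) v = v := by
  refine hbarPart_induction 𝔤 (p := fun v => ∃ N₀ : ℕ, ∀ N ≥ N₀, expand b (negExponents N) v = v)
    ?_ ?_ ?_ ?_ hv
  · exact ⟨0, fun N _ => map_zero _⟩
  · rintro v w ⟨N, hv⟩ ⟨N', hw⟩
    exact ⟨max N N', fun K hK => by
      rw [map_add, hv K (le_trans (le_max_left _ _) hK), hw K (le_trans (le_max_right _ _) hK)]⟩
  · rintro r v ⟨N, hv⟩
    exact ⟨N, fun K hK => by rw [map_smul, hv K hK]⟩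
  · intro h hh
    change h ∈ Submodule.span ℂ _ at hh
    induction hh using Submodule.span_induction with
    | mem w hw =>
      obtain ⟨a, x, ha, rfl⟩ := hw
      -- A Laurent series has a pole of finite order, so on 𝔤_{<0} the expansion is finite and
      -- becomes exact once N reaches the pole order.
      obtain ⟨N₀, hN₀⟩ : ∃ N₀ : ℕ, ∀ n < -(N₀ : ℤ), Laurent.coeff n a = 0 :=
        ⟨(-HahnSeries.order (a : HahnSeries ℤ ℂ)).toNat, fun n hn =>
          HahnSeries.coeff_eq_zero_of_lt_order (x := (a : HahnSeries ℤ ℂ)) (by omega)⟩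
      refine ⟨N₀, fun N hN => ?_⟩
      rw [expand_tmul_mk]
      congr 2
      refine Laurent.ext fun n => ?_
      rw [Laurent.coeff_sum_mono]
      split_ifs with h1
      · rfl
      · symm
        rcases lt_or_ge n 0 with h2 | h2
        · refine hN₀ n (not_le.mp fun h3 => h1 (Finset.mem_map.mpr ?_))
          refine ⟨(-n - 1).toNat, Finset.mem_range.mpr (by omega), ?_⟩
          change -((-n - 1).toNat : ℤ) - 1 = n
          omega
        · exact ha n h2
    | zero => exact ⟨0, fun N _ => by rw [tmul_zero, map_zero]⟩
    | add v w _ _ hv hw =>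
      obtain ⟨N, hv⟩ := hv
      obtain ⟨N', hw⟩ := hw
      exact ⟨max N N', fun K hK => by
        rw [tmul_add, map_add, hv K (le_trans (le_max_left _ _) hK),
          hw K (le_trans (le_max_right _ _) hK)]⟩
    | smul r v _ hv =>
      obtain ⟨N, hv⟩ := hv
      have h1 : (hbar ⊗ₜ[ℂ] (r • v) : LoopH 𝔤) = algebraMap ℂ Kh r • (hbar ⊗ₜ v) := by
        rw [algebraMap_smul, tmul_smul]
      exact ⟨N, fun K hK => by rw [h1, map_smul, hv K hK]⟩

theorem hbarGamma_gen_pow (w : Fin 2 → MinusH 𝔤) (j : ℕ) :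
    hbarGamma 𝔤 (gen Kh w ^ j) = if j = 1 then legElem 0 ((w 1).1 : LoopH 𝔤) else 0 := by
  refine (LieSplitting.convLog_gen_pow _ _ _ _).trans ?_
  congr 2
  funext i
  fin_cases i
  · rfl
  · rfl

theorem hbarGamma21_gen_pow (w : Fin 2 → MinusH 𝔤) (j : ℕ) :
    hbarGamma21 𝔤 (gen Kh w ^ j) = if j = 1 then legElem 1 ((w 0).2 : LoopH 𝔤) else 0 := by
  refine (LieSplitting.convLog_gen_pow _ _ _ _).trans ?_
  congr 2
  funext i
  fin_cases i
  · rfl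
  · rfl

/-- Both sides are linear in e, so powers wʲ suffice. Only j = 1 contributes, and there the
statement is the expansion of the 𝔤(O)-component of the second leg, with r its tail of t-order at
least N. -/
theorem hbarGamma_eq_sum (I : ι → ℕ → (U Kh (MinusH 𝔤) →ₗ[Kh] Kh))
    (hI : ∀ α n, IsLogCoordinate (I α n) (coordO b α n)) (e : U Kh (Fin 2 → MinusH 𝔤)) (N : ℕ) :
    ∃ r ∈ Submodule.span Kh {w : LoopH 𝔤 | ∃ h ∈ loopGe 𝔤 N, w = 1 ⊗ₜ[ℂ] h},
      hbarGamma 𝔤 e = ∑ n ∈ Finset.range N, ∑ α,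
        (hbar * I α n (mapU (projHom 1) e)) • legElem 0 (basisElem b α n) + legElem 0 r := by
  induction e using U_pow_induction with
  | zero =>
    refine ⟨0, zero_mem _, ?_⟩
    rw [LieSplitting.Sym.map_zero', legElem_zero]
    simp
  | add x y hx hy =>
    obtain ⟨r, hr, hx⟩ := hx
    obtain ⟨s, hs, hy⟩ := hy
    refine ⟨r + s, add_mem hr hs, ?_⟩
    rw [LieSplitting.Sym.map_add', hx, hy, legElem_add]
    simp only [map_add, mul_add, add_smul, Finset.sum_add_distrib]
    abel
  | smul c x hx =>
    obtain ⟨r, hr, hx⟩ := hx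
    refine ⟨c • r, Submodule.smul_mem _ c hr, ?_⟩
    rw [LieSplitting.Sym.map_smul', hx, legElem_smul, smul_add, Finset.smul_sum]
    simp only [map_smul, smul_eq_mul, Finset.smul_sum, smul_smul, mul_left_comm]
  | pow w j =>
    have h1 : ∀ (α : ι) (n : ℕ), hbar * I α n (mapU (projHom 1) (gen Kh w ^ j))
        = if j = 1 then coordFun b α n ((w 1).1 : LoopH 𝔤) else 0 := fun α n => by
      rw [map_pow, mapU_gen]
      exact hI α n (w 1) j
    simp only [h1, hbarGamma_gen_pow]
    by_cases hj : j = 1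
    · refine ⟨_, sub_expand_mem b (w 1).1.2 N, ?_⟩
      simp only [if_pos hj, ← legElem_smul, ← legElem_sum, ← legElem_add]
      congr 1
      rw [expand_apply, Finset.sum_map]
      exact (add_sub_cancel _ _).symm
    · refine ⟨0, zero_mem _, ?_⟩
      simp only [if_neg hj, legElem_zero, zero_smul, Finset.sum_const_zero, add_zero]

/-- As for γ_<, but elements of 𝔤_{<0} have finite expansions, so there is no remainder; N₀ depends
on e. -/
theorem hbarGamma21_eq_sum (I : ι → ℕ → (U Kh (MinusH 𝔤) →ₗ[Kh] Kh))
    (hI : ∀ α n, IsLogCoordinate (I α n) (coordNeg b α n)) (e : U Kh (Fin 2 → MinusH 𝔤)) :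
    ∃ N₀ : ℕ, ∀ N ≥ N₀, hbarGamma21 𝔤 e = ∑ n ∈ Finset.range N, ∑ α,
      (hbar * I α n (mapU (projHom 0) e)) • legElem 1 (basisElem b α (-n - 1)) := by
  induction e using U_pow_induction with
  | zero =>
    refine ⟨0, fun N _ => ?_⟩
    rw [LieSplitting.Sym.map_zero']
    simp
  | add x y hx hy =>
    obtain ⟨N, hx⟩ := hx
    obtain ⟨N', hy⟩ := hy
    refine ⟨max N N', fun K hK => ?_⟩
    rw [LieSplitting.Sym.map_add', hx K (le_trans (le_max_left _ _) hK),
      hy K (le_trans (le_max_right _ _) hK)]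
    simp only [map_add, mul_add, add_smul, Finset.sum_add_distrib]
  | smul c x hx =>
    obtain ⟨N, hx⟩ := hx
    refine ⟨N, fun K hK => ?_⟩
    rw [LieSplitting.Sym.map_smul', hx K hK, Finset.smul_sum]
    simp only [map_smul, smul_eq_mul, Finset.smul_sum, smul_smul, mul_left_comm]
  | pow w j =>
    have h1 : ∀ (α : ι) (n : ℕ), hbar * I α n (mapU (projHom 0) (gen Kh w ^ j))
        = if j = 1 then coordFun b α (-n - 1) ((w 0).2 : LoopH 𝔤) else 0 := fun α n => by
      rw [map_pow, mapU_gen]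
      exact hI α n (w 0) j
    simp only [h1, hbarGamma21_gen_pow]
    by_cases hj : j = 1
    · obtain ⟨N, hN⟩ := exists_expand_eq b (w 0).2.2
      refine ⟨N, fun K hK => ?_⟩
      simp only [if_pos hj, ← legElem_smul, ← legElem_sum]
      congr 1
      conv_lhs => rw [← hN K hK, expand_apply, negExponents, Finset.sum_map]
      rfl
    · refine ⟨0, fun N _ => ?_⟩
      simp only [if_neg hj, zero_smul, Finset.sum_const_zero]

end LoopAlgebra

end DoubleYangian

end

theorem mainTheorem4 {𝔤 : Type*} [LieRing 𝔤] [LieAlgebra ℂ 𝔤] (d : ℕ)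
    (b : Module.Basis (Fin d) ℂ 𝔤) :
    -- `ħ γ_< = ∑_{n ≥ 0} ∑_α ħ I_{α,n} ⊗ I^α_{-n-1}`, as a `t`-adically convergent series
    (∀ I : Fin d → ℕ → (U Kh (MinusH 𝔤)
          →ₗ[Kh] Kh),
      (∀ α n, IsLogCoordinate (I α n) (coordO b α n)) →
      ∀ (e : U Kh (Fin 2 → MinusH 𝔤)) (N : ℕ),
        ∃ r ∈ Submodule.span Kh
            {w : LoopH 𝔤 | ∃ h ∈ loopGe 𝔤 N, w = 1 ⊗ₜ[ℂ] h},
          hbarGamma 𝔤 e =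
            ∑ n ∈ Finset.range N, ∑ α,
              (hbar * I α n (mapU (projHom 1) e)) •
                legElem 0 (basisElem b α n)
            + legElem 0 r) ∧
    -- `ħ γ_<^{21} = ∑_{n ≥ 0} ∑_α ħ I^α_n ⊗ I_{α,-n-1}`
    (∀ I : Fin d → ℕ → (U Kh (MinusH 𝔤)
          →ₗ[Kh] Kh),
      (∀ α n, IsLogCoordinate (I α n) (coordNeg b α n)) →
      ∀ e : U Kh (Fin 2 → MinusH 𝔤),
        ∃ N₀ : ℕ, ∀ N ≥ N₀, hbarGamma21 𝔤 e =
          ∑ n ∈ Finset.range N, ∑ α,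
            (hbar * I α n (mapU (projHom 0) e)) •
              legElem 1 (basisElem b α (-n - 1))) ∧
    -- the coproduct on `𝔤(K)` is `Δ(x) = exp(ħ γ_<) (x ⊗ 1 + 1 ⊗ x) exp(-ħ γ_<)`
    (∀ x : LoopH 𝔤,
      dyComul 𝔤 (dyElem 𝔤 x) =
        dyExp 𝔤 (hbarGamma 𝔤) *
          ((dySplitting 𝔤).leg1 (dyElem 𝔤 x) +
            (dySplitting 𝔤).leg2 (dyElem 𝔤 x)) *
          dyExp 𝔤 (-hbarGamma 𝔤)) ∧
    -- `R` is invertible and lies in the completed tensor product of `Y` and `Y^*`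
    IsUnit (Rmat 𝔤) ∧
    InYangianTensorDual 𝔤 (Rmat 𝔤) ∧
    -- `R Δ(x) R⁻¹ = Δ^op(x)` for all `x` in the double Yangian
    (∀ x ∈ doubleYangian 𝔤,
      AdicCompletion.map hbarIdeal
          (conjBy 𝔤 (Rmat 𝔤))
          (AdicCompletion.map hbarIdeal (dyComul 𝔤) x) =
        AdicCompletion.map hbarIdeal (dyComulOp 𝔤) x) ∧
    -- `(Δ ⊗ 1) R = R^{13} R^{23}` and `(1 ⊗ Δ) R = R^{13} R^{12}`
    (dySplitting 𝔤).comulLeft (Rmat 𝔤) =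
      (dySplitting 𝔤).leg13 (Rmat 𝔤) *
        (dySplitting 𝔤).leg23 (Rmat 𝔤) ∧
    (dySplitting 𝔤).comulRight (Rmat 𝔤) =
      (dySplitting 𝔤).leg13 (Rmat 𝔤) *
        (dySplitting 𝔤).leg12 (Rmat 𝔤) ∧
    -- the Yang-Baxter equation
    (dySplitting 𝔤).leg12 (Rmat 𝔤) *
        (dySplitting 𝔤).leg13 (Rmat 𝔤) *
        (dySplitting 𝔤).leg23 (Rmat 𝔤) =
      (dySplitting 𝔤).leg23 (Rmat 𝔤) *
        (dySplitting 𝔤).leg13 (Rmat 𝔤) *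
        (dySplitting 𝔤).leg12 (Rmat 𝔤) := by
  refine ⟨hbarGamma_eq_sum b, hbarGamma21_eq_sum b, (dyDouble 𝔤).comulSym_primSym, isUnit_Rmat 𝔤,
    inYangianTensorDual_Rmat 𝔤, fun x _ => ?_, ?_⟩
  -- Completion is functorial, so the identity before completion gives the identity for every
  -- element of the completion.
  · rw [AdicCompletion.map_comp_apply, conjBy_Rmat_comp_dyComul]
  · rw [Rmat_eq]
    exact ⟨(dyDouble 𝔤).comulLeft_rSym, (dyDouble 𝔤).comulRight_rSym, (dyDouble 𝔤).yang_baxter⟩
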